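/- Let $\mathbb D$ be the open unit disk, $H(\mathbb D)$ the space of analytic functions on $\mathbb D$, and $dA=\frac1\pi\,dx\,dy$. For $0<p<\infty$ and $\alpha>-1$ let $D^p_\alpha$ be the space of all $f\in H(\mathbb D)$ with $$\|f\|_{D^p_\alpha}=\Big(|f(0)|^p+\int_{\mathbb D}|f'(z)|^p(1-|z|^2)^\alpha\,dA(z)\Big)^{1/p}<\infty .$$ For $g\in H(\mathbb D)$ let $M_gf=gf$. We say that $M_g:D^p_\alpha\to D^q_\beta$ is compact if $M_g$ maps $D^p_\alpha$ into $D^q_\beta$ and, for every bounded sequence $(f_n)$ in $D^p_\alpha$, the sequence $(M_gf_n)$ has a subsequence converging in $D^q_\beta$. For an interval $I\subset\partial\mathbb D$ with normalized length $|I|\in(0,1]$ let $S(I)=\{re^{i\theta}: e^{i\theta}\in I,\ 1-|I|\le r<1\}$. For $s>0$, a positive Borel measure $\mu$ on $\mathbb D$ is a vanishing $s$-Carleson measure if $\mu(S(I))=o(|I|^s)$ as $|I|\to0$. **Theorem.** Let $\alpha,\beta>-1$, $0<p<q<\infty$, $g\in H(\mathbb D)$, and put $d\mu_{g,q,\beta}(z)=(1-|z|^2)^\beta|g'(z)|^q\,dA(z)$.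 1. If $p<\alpha+2$, then $M_g:D^p_\alpha\to D^q_\beta$ is compact if and only if $\mu_{g,q,\beta}$ is a vanishing $\frac{q(\alpha+2-p)}{p}$-Carleson measure and $|g(z)|=o\big((1-|z|^2)^{\frac{2+\alpha}{p}-\frac{2+\beta}{q}}\big)$ as $|z|\to1^-$. 2. If $p=\alpha+2$, then $M_g:D^p_\alpha\to D^q_\beta$ is compact if and only if $|g(z)|=o\big((1-|z|^2)^{\frac{2+\alpha}{p}-\frac{2+\beta}{q}}\big)$ as $|z|\to1^-$ and $\mu_{g,q,\beta}(S(I))=o\Big(\big(\log\frac1{|I|}\big)^{(1/p-1)q}\Big)$ as $|I|\to0$. 3. If $p>\alpha+2$, then $M_g:D^p_\alpha\to D^q_\beta$ is compact if and only if $|g(z)|=o\big((1-|z|^2)^{\frac{2+\alpha}{p}-\frac{2+\beta}{q}}\big)$ as $|z|\to1^-$ and $g\in D^q_\beta$. -/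

import Mathlib

open MeasureTheory Filter Topology Asymptotics

namespace WeightedDirichlet

noncomputable section

/-- The open unit disk of the complex plane. -/
def disk : Set ℂ := Metric.ball 0 1

/-- Normalized area measure on the unit disk: `dA = (1/π) dx dy`. -/
def dA : Measure ℂ := ENNReal.ofReal (1 / Real.pi) • (volume.restrict disk)

/-- The (quasi-)norm of the weighted Dirichlet space, as an extended nonnegative real:
`(|f(0)|^p + ∫_𝔻 |f'(z)|^p (1 - |z|^2)^α dA(z))^{1/p}`. -/
def dirichletNorm (p α : ℝ) (f : ℂ → ℂ) : ENNReal :=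
  (ENNReal.ofReal (‖f 0‖ ^ p) +
    ∫⁻ z, ENNReal.ofReal (‖deriv f z‖ ^ p * (1 - ‖z‖ ^ 2) ^ α) ∂dA) ^ (1 / p)

/-- Membership in the weighted Dirichlet space: `f` is analytic on the disk and has finite norm.
A function on the disk is represented by a function on `ℂ`, whose values off the disk play no
role. -/
def MemDirichlet (p α : ℝ) (f : ℂ → ℂ) : Prop :=
  DifferentiableOn ℂ f disk ∧ dirichletNorm p α f < ⊤

/-- The multiplication operator `f ↦ g f`. -/
def mulOp (g f : ℂ → ℂ) : ℂ → ℂ := fun z => g z * f z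

/-- `T` is a compact operator from the weighted Dirichlet space with parameters `p, α` to the one
with parameters `q, β`: it maps the first space into the second, and the image of every sequence
that is bounded in the first has a subsequence that converges in the second. -/
def IsCompactBetween (p α q β : ℝ) (T : (ℂ → ℂ) → (ℂ → ℂ)) : Prop :=
  (∀ f, MemDirichlet p α f → MemDirichlet q β (T f)) ∧
  ∀ f : ℕ → ℂ → ℂ, (∀ n, MemDirichlet p α (f n)) →
    (∃ C : NNReal, ∀ n, dirichletNorm p α (f n) ≤ C) →
    ∃ φ : ℕ → ℕ, StrictMono φ ∧ ∃ h : ℂ → ℂ, MemDirichlet q β h ∧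
      Tendsto (fun n => dirichletNorm q β (T (f (φ n)) - h)) atTop (𝓝 0)

/-- An interval of the unit circle, given by its starting angle and its normalized length. -/
structure Arc where
  start : ℝ
  length : ℝ
  length_pos : 0 < length
  length_le_one : length ≤ 1

/-- The points of the unit circle that belong to the interval. -/
def Arc.points (I : Arc) : Set ℂ :=
  (fun θ : ℝ => Complex.exp (θ * Complex.I)) ''
    Set.Icc I.start (I.start + 2 * Real.pi * I.length)

/-- The Carleson square `S(I) = {r e^{iθ} : e^{iθ} ∈ I, 1 - |I| ≤ r < 1}`. -/
def carlesonSquare (I : Arc) : Set ℂ :=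
  {z | ∃ r : ℝ, ∃ ζ ∈ I.points, 1 - I.length ≤ r ∧ r < 1 ∧ z = r * ζ}

/-- `μ(S(I)) = o(ψ(|I|))` as `|I| → 0`. -/
def SquaresLittleO (μ : Measure ℂ) (ψ : ℝ → ℝ) : Prop :=
  ∀ ε : ℝ, 0 < ε → ∃ δ : ℝ, 0 < δ ∧ ∀ I : Arc, I.length < δ →
    μ (carlesonSquare I) ≤ ENNReal.ofReal (ε * ψ I.length)

/-- `μ` is a vanishing `s`-Carleson measure. -/
def IsVanishingCarleson (s : ℝ) (μ : Measure ℂ) : Prop :=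
  SquaresLittleO μ (fun t => t ^ s)

/-- The measure `dμ_{g,q,β}(z) = (1 - |z|^2)^β |g'(z)|^q dA(z)` on the unit disk. -/
def muMeasure (g : ℂ → ℂ) (q β : ℝ) : Measure ℂ :=
  dA.withDensity (fun z => ENNReal.ofReal ((1 - ‖z‖ ^ 2) ^ β * ‖deriv g z‖ ^ q))

/-- `|g(z)| = o((1 - |z|^2)^γ)` as `|z| → 1⁻`. -/
def BoundaryLittleO (g : ℂ → ℂ) (γ : ℝ) : Prop :=
  (fun z : ℂ => ‖g z‖) =o[comap (fun z : ℂ => ‖z‖) (𝓝[<] 1)]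
    (fun z : ℂ => (1 - ‖z‖ ^ 2) ^ γ)

end

end WeightedDirichlet

namespace WeightedDirichlet

noncomputable section

/-! Compactness is first turned into a statement about null sequences
(`isCompactBetween_iff_nullToNull`): norm-bounded sequences tending to zero locally uniformly must
be sent by multiplication by `g` to sequences tending to zero in norm. Bounded sequences are normal
families, which rests on the sub-mean value inequality for `‖h‖ ^ p`, valid for every `p > 0`. Then
`(g f)' = g f' + g' f` and the two terms are treated separately.

The term `g f'` is governed by the growth of `g` alone. The pointwise bound `‖f'‖ ≲ (1 - |z|)^(-(2 +
α)/p)` is applied to the factor `‖f'‖^(q - p)`, and the exponents match so that `‖f'‖^p (1 -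
|z|²)^α` is left with a small constant near the circle (`tendsto_lintegral_mul_deriv`).

The term `g' f` calls for an embedding of the Dirichlet space into `L^q(μ)`. The disk is cut into
Whitney boxes, which form a dyadic tree, and `‖f(z) - f(0)‖` is dominated by the sum along the
branch of `z` of the weights `2^(-m) sup |f'|`; the weighted `ℓ^p` norm of these weights is
controlled by the energy (`exists_tree_dominant`). There remains a discrete inequality on a tree.
For exponents `1 < p < q` a weak type bound follows from duality and Hölder, and Maz'ya's truncation
method upgrades it to a strong type bound (`tree_weak_type`, `tree_strong_type`); the only input is
a one-dimensional sum over generations, `ChainCondition`. The sign of `α + 2 - p` decides the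
generation weights `2^(-m(α + 2 - p))`: they decay, are constant, or grow. This gives the power
condition, the logarithmic condition, and mere finiteness of `μ`, respectively. The embedding
constant is proportional to the size of the measure on boxes, so the part of `μ` near the circle
contributes little (`nullToNull_of_conditions`).

For necessity, families of functions concentrating at a boundary point are tested; their norms are
bounded by Forelli–Rudin integrals. A function vanishing at `a` isolates `g(a) f'(a)` and yields the
growth condition. Once that is known the term `g f'` tends to zero, hence so does `g' f`, and
Chebyshev's inequality with a function that is large on a Carleson square yields the measure
condition (`squaresLittleO_of_testFamily`). The test functions are powers of the Cauchy kernel, or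
its logarithm when `p = α + 2`; when `p > α + 2` the constant function suffices. -/

/-! ### Sub-mean value inequalities for powers of the modulus -/

lemma two_pi_norm_le_lintegral_circleMap {h : ℂ → ℂ} {z : ℂ} {ρ r : ℝ} (hr : 0 < r) (hrρ : r < ρ)
    (hh : DifferentiableOn ℂ h (Metric.ball z ρ)) :
    ENNReal.ofReal (2 * Real.pi * ‖h z‖) ≤
      ∫⁻ θ in Set.Ioo (-Real.pi) Real.pi, ENNReal.ofReal ‖h (circleMap z r θ)‖ := by
  have hd : DiffContOnCl ℂ h (Metric.ball z |r|) := by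
    rw [abs_of_pos hr]
    refine DifferentiableOn.diffContOnCl (hh.mono ?_)
    rw [closure_ball z hr.ne']
    exact Metric.closedBall_subset_ball hrρ
  have h1 := hd.circleAverage
  -- The angle is shifted to `(-π, π)`, the range used by `Complex.polarCoord`.
  rw [Real.circleAverage_eq_integral_add (-Real.pi),
    intervalIntegral.integral_comp_add_right (fun θ => h (circleMap z r θ))] at h1
  have h2 : ∫ θ in (-Real.pi)..Real.pi, h (circleMap z r θ) = (2 * Real.pi) • h z := by
    rw [← h1, smul_smul, mul_inv_cancel₀ (by positivity), one_smul]
    congr 1 <;> ring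
  rw [intervalIntegral.integral_of_le (by linarith [Real.pi_pos])] at h2
  have h3 := enorm_integral_le_lintegral_enorm (μ := volume.restrict (Set.Ioc (-Real.pi) Real.pi))
    (fun θ => h (circleMap z r θ))
  rw [h2, ← ofReal_norm, norm_smul, Real.norm_of_nonneg (by positivity)] at h3
  refine h3.trans (le_of_eq ?_)
  rw [Measure.restrict_congr_set Ioo_ae_eq_Ioc]
  simp only [ofReal_norm]

lemma lintegral_Ioo_id {ρ : ℝ} (hρ : 0 < ρ) :
    ∫⁻ r in Set.Ioo 0 ρ, ENNReal.ofReal r = ENNReal.ofReal (ρ ^ 2 / 2) := by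
  rw [Measure.restrict_congr_set Ioo_ae_eq_Ioc, ← ofReal_integral_eq_lintegral_ofReal]
  · rw [← intervalIntegral.integral_of_le hρ.le, integral_id]; simp
  · exact (continuous_id.integrableOn_Icc).mono_set Set.Ioc_subset_Icc_self
  · exact (ae_restrict_iff' measurableSet_Ioc).2 (ae_of_all _ fun x hx => hx.1.le)

/-- The area sub-mean value inequality for the modulus of an analytic function. -/
lemma norm_mul_area_le_lintegral_ball {h : ℂ → ℂ} {z : ℂ} {ρ : ℝ} (hρ : 0 < ρ)
    (hh : DifferentiableOn ℂ h (Metric.ball z ρ)) :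
    ENNReal.ofReal (‖h z‖ * (Real.pi * ρ ^ 2)) ≤
      ∫⁻ w in Metric.ball z ρ, ENNReal.ofReal ‖h w‖ := by
  -- Nothing is known about `h` off the ball; cutting it off gives a globally measurable function to
  -- which polar coordinates apply.
  set φ : ℂ → ENNReal := (Metric.ball z ρ).indicator fun w => ENNReal.ofReal ‖h w‖ with hφ
  have hφm : Measurable φ := by
    classical
    rw [hφ, ← Set.piecewise_eq_indicator]
    exact ContinuousOn.measurable_piecewise
      (ENNReal.continuous_ofReal.comp_continuousOn hh.continuousOn.norm) continuousOn_const
      measurableSet_ball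
  rw [← lintegral_indicator measurableSet_ball, ← hφ, ← lintegral_add_left_eq_self φ z,
    ← Complex.lintegral_comp_polarCoord_symm, polarCoord_target, Measure.volume_eq_prod,
    ← Measure.prod_restrict]
  have hc : Continuous fun p : ℝ × ℝ => z + Complex.polarCoord.symm p := by
    simp only [Complex.polarCoord_symm_apply]
    fun_prop
  rw [lintegral_prod]
  · calc ENNReal.ofReal (‖h z‖ * (Real.pi * ρ ^ 2))
        = ∫⁻ r in Set.Ioo 0 ρ, ENNReal.ofReal r * ENNReal.ofReal (2 * Real.pi * ‖h z‖) := by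
          rw [lintegral_mul_const _ (by fun_prop), lintegral_Ioo_id hρ,
            ← ENNReal.ofReal_mul (by positivity)]
          congr 1; ring
      _ ≤ ∫⁻ r in Set.Ioo 0 ρ, ∫⁻ θ in Set.Ioo (-Real.pi) Real.pi,
            ENNReal.ofReal r • φ (z + Complex.polarCoord.symm (r, θ)) := by
          refine setLIntegral_mono_ae' measurableSet_Ioo (ae_of_all _ fun r hr => ?_)
          have hm : Measurable fun θ => φ (z + Complex.polarCoord.symm (r, θ)) :=
            hφm.comp (hc.measurable.comp (by fun_prop))
          simp only [smul_eq_mul]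
          rw [lintegral_const_mul _ hm]
          gcongr
          refine (two_pi_norm_le_lintegral_circleMap hr.1 hr.2 hh).trans (lintegral_mono fun θ => ?_)
          have e : z + Complex.polarCoord.symm (r, θ) = circleMap z r θ := by
            simp [circleMap, Complex.polarCoord_symm_apply, Complex.exp_mul_I]
          have hmem : circleMap z r θ ∈ Metric.ball z ρ := by
            simp [Metric.mem_ball, dist_eq_norm, circleMap_sub_center, abs_of_pos hr.1, hr.2]
          simp only [e, hφ, Set.indicator_of_mem hmem, le_refl]
      _ ≤ _ := lintegral_mono_set Set.Ioo_subset_Ioi_self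
  · exact ((by fun_prop : Measurable fun p : ℝ × ℝ => ENNReal.ofReal p.1).smul
      (hφm.comp hc.measurable)).aemeasurable

/-- If `t` is dominated by `c • t ^ p` along an analytic function, the area inequality for `‖h‖`
passes to `‖h‖ ^ p`. -/
lemma norm_mul_area_le_of_le_rpow {h : ℂ → ℂ} {z : ℂ} {ρ a c p J : ℝ} (hρ : 0 < ρ) (hc : 0 ≤ c)
    (ha : 0 ≤ a) (hJ : 0 ≤ J)
    (hh : DifferentiableOn ℂ h (Metric.ball z ρ))
    (hb : ∀ w ∈ Metric.ball z ρ, ‖h w‖ ≤ a + c * ‖h w‖ ^ p)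
    (hI : ∫⁻ w in Metric.ball z ρ, ENNReal.ofReal (‖h w‖ ^ p) ≤ ENNReal.ofReal J) :
    ‖h z‖ * (Real.pi * ρ ^ 2) ≤ a * (Real.pi * ρ ^ 2) + c * J := by
  have h1 := norm_mul_area_le_lintegral_ball hρ hh
  have h2 : ∫⁻ w in Metric.ball z ρ, ENNReal.ofReal ‖h w‖ ≤
      ∫⁻ w in Metric.ball z ρ, (ENNReal.ofReal a +
        ENNReal.ofReal c * ENNReal.ofReal (‖h w‖ ^ p)) := by
    refine setLIntegral_mono_ae' measurableSet_ball (ae_of_all _ fun w hw => ?_)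
    rw [← ENNReal.ofReal_mul hc, ← ENNReal.ofReal_add ha (by positivity)]
    exact ENNReal.ofReal_le_ofReal (hb w hw)
  rw [lintegral_add_left measurable_const, lintegral_const_mul' _ _ ENNReal.ofReal_ne_top,
    setLIntegral_const, Complex.volume_ball] at h2
  have h3 := h1.trans (h2.trans (add_le_add le_rfl (mul_le_mul_right hI (ENNReal.ofReal c))))
  have e : (ENNReal.ofReal ρ ^ 2 * (NNReal.pi : ENNReal)) = ENNReal.ofReal (Real.pi * ρ ^ 2) := by
    rw [mul_comm, ENNReal.ofReal_mul Real.pi_pos.le, ENNReal.ofReal_pow hρ.le]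
    congr 1
    rw [← NNReal.coe_real_pi, ENNReal.ofReal_coe_nnreal]
  rw [e, ← ENNReal.ofReal_mul ha, ← ENNReal.ofReal_mul hc,
    ← ENNReal.ofReal_add (by positivity) (by positivity)] at h3
  exact (ENNReal.ofReal_le_ofReal_iff (by positivity)).1 h3

/-- With `l = ‖h z‖ / 2`, every `t ≥ 0` satisfies `t ≤ l + l^(1 - p) t^p`: the first term suffices
below `l`, the second above. In the area inequality the term `l` absorbs only half of `‖h z‖`. This
replaces Jensen's inequality at the cost of the factor `2 ^ p`. -/
lemma rpow_mul_sq_le_of_one_le {p : ℝ} (hp : 1 ≤ p) {h : ℂ → ℂ} {z : ℂ} {ρ J : ℝ} (hρ : 0 < ρ)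
    (hJ : 0 ≤ J) (hh : DifferentiableOn ℂ h (Metric.ball z ρ))
    (hI : ∫⁻ w in Metric.ball z ρ, ENNReal.ofReal (‖h w‖ ^ p) ≤ ENNReal.ofReal J) :
    ‖h z‖ ^ p * ρ ^ 2 ≤ 2 ^ p * J := by
  rcases (norm_nonneg (h z)).eq_or_lt with h0 | h0
  · rw [← h0, Real.zero_rpow (by linarith)]; simp; positivity
  set l := ‖h z‖ / 2 with hl
  have hl0 : 0 < l := by positivity
  have hb : ∀ w ∈ Metric.ball z ρ, ‖h w‖ ≤ l + l ^ (1 - p) * ‖h w‖ ^ p := by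
    intro w _
    rcases le_total ‖h w‖ l with hw | hw
    · have : 0 ≤ l ^ (1 - p) * ‖h w‖ ^ p := by positivity
      linarith
    · have h1 : 0 < ‖h w‖ := hl0.trans_le hw
      have h2 : ‖h w‖ ^ (1 - p) ≤ l ^ (1 - p) :=
        Real.rpow_le_rpow_of_nonpos hl0 hw (by linarith)
      have h3 : ‖h w‖ = ‖h w‖ ^ (1 - p) * ‖h w‖ ^ p := by
        rw [← Real.rpow_add h1]; simp
      have h4 : ‖h w‖ ^ (1 - p) * ‖h w‖ ^ p ≤ l ^ (1 - p) * ‖h w‖ ^ p := by gcongr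
      linarith
  have h5 := norm_mul_area_le_of_le_rpow hρ (by positivity) hl0.le hJ hh hb hI
  have h6 : l * (Real.pi * ρ ^ 2) ≤ l ^ (1 - p) * J := by
    have : ‖h z‖ = 2 * l := by rw [hl]; ring
    rw [this] at h5; linarith
  have h7 : l ^ p * ρ ^ 2 ≤ J := by
    have h8 : l ^ (p - 1) * (l * (Real.pi * ρ ^ 2)) ≤ l ^ (p - 1) * (l ^ (1 - p) * J) := by gcongr
    rw [← mul_assoc (l ^ (p - 1)) l, ← mul_assoc (l ^ (p - 1)) (l ^ (1 - p)),
      ← Real.rpow_add_one hl0.ne', ← Real.rpow_add hl0, sub_add_cancel,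
      show p - 1 + (1 - p) = 0 by ring, Real.rpow_zero, one_mul] at h8
    have h9 : l ^ p * (1 * ρ ^ 2) ≤ l ^ p * (Real.pi * ρ ^ 2) := by
      gcongr; linarith [Real.pi_gt_three]
    linarith
  have h10 : ‖h z‖ ^ p = 2 ^ p * l ^ p := by
    rw [← Real.mul_rpow (by norm_num) hl0.le, hl]; congr 1; ring
  rw [h10, mul_assoc]
  gcongr

/-- A maximum point `w₀` of `‖h w‖ (ρ - |w - z|)^(2/p)` does at least as well as the centre. Near
`w₀` the modulus is at most a constant times `‖h w₀‖`, so `‖h‖ = ‖h‖^(1 - p) ‖h‖^p` is bounded by a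
constant times `‖h w₀‖^(1 - p) ‖h‖^p`, and the area inequality at `w₀` applies. -/
lemma rpow_mul_sq_le_of_le_one {p : ℝ} (hp : 0 < p) (hp1 : p ≤ 1) {h : ℂ → ℂ} {z : ℂ} {ρ J : ℝ}
    (hρ : 0 < ρ) (hJ : 0 ≤ J) (hh : DifferentiableOn ℂ h (Metric.closedBall z ρ))
    (hI : ∫⁻ w in Metric.ball z ρ, ENNReal.ofReal (‖h w‖ ^ p) ≤ ENNReal.ofReal J) :
    ‖h z‖ ^ p * ρ ^ 2 ≤ 4 * (2 ^ (2 / p)) ^ (1 - p) * J := by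
  obtain ⟨w₀, hw₀, hmax⟩ := (isCompact_closedBall z ρ).exists_isMaxOn
    (f := fun w => ‖h w‖ * (ρ - dist w z) ^ (2 / p)) ⟨z, by simp [hρ.le]⟩ (by
      refine hh.continuousOn.norm.mul (ContinuousOn.rpow_const (by fun_prop) fun x _ => ?_)
      right; positivity)
  have hd : 0 ≤ ρ - dist w₀ z := sub_nonneg.2 hw₀
  have hz := hmax (show z ∈ Metric.closedBall z ρ by simp [hρ.le])
  simp only [dist_self, sub_zero, Set.mem_ofPred_eq] at hz
  have hz' : ‖h z‖ ^ p * ρ ^ 2 ≤ ‖h w₀‖ ^ p * (ρ - dist w₀ z) ^ 2 := by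
    have := Real.rpow_le_rpow (by positivity) hz hp.le
    rw [Real.mul_rpow (by positivity) (by positivity), Real.mul_rpow (by positivity) (by positivity),
      ← Real.rpow_mul hρ.le, ← Real.rpow_mul hd, div_mul_cancel₀ _ hp.ne'] at this
    exact_mod_cast this
  refine hz'.trans ?_
  rcases hd.eq_or_lt with hd0 | hd0
  · rw [← hd0]; simp; positivity
  rcases (norm_nonneg (h w₀)).eq_or_lt with h0 | h0
  · rw [← h0, Real.zero_rpow hp.ne']; simp; positivity
  -- On the ball of this radius about `w₀` the distance to the outer sphere at most halves, which is
  -- the origin of the factor `2 ^ (2 / p)`.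
  set σ := (ρ - dist w₀ z) / 2 with hσ
  have hσ0 : 0 < σ := by positivity
  have hsub : Metric.ball w₀ σ ⊆ Metric.ball z ρ := by
    refine Metric.ball_subset_ball' ?_
    rw [hσ]; linarith
  set K : ℝ := 2 ^ (2 / p) with hK
  have hb : ∀ w ∈ Metric.ball w₀ σ, ‖h w‖ ≤ 0 + (K * ‖h w₀‖) ^ (1 - p) * ‖h w‖ ^ p := by
    intro w hw
    have h1 := hmax (Metric.ball_subset_closedBall (hsub hw))
    simp only [Set.mem_ofPred_eq] at h1
    have h2 : σ ≤ ρ - dist w z := by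
      have := dist_triangle w w₀ z
      have := Metric.mem_ball.1 hw
      rw [hσ] at *; linarith
    have h3 : ‖h w‖ * σ ^ (2 / p) ≤ ‖h w₀‖ * (2 * σ) ^ (2 / p) := by
      calc _ ≤ ‖h w‖ * (ρ - dist w z) ^ (2 / p) := by gcongr
        _ ≤ _ := h1
        _ = _ := by rw [hσ]; congr 2; ring
    rw [Real.mul_rpow (by norm_num) hσ0.le, ← mul_assoc] at h3
    have h4 : ‖h w‖ ≤ K * ‖h w₀‖ := by
      have := le_of_mul_le_mul_right h3 (by positivity)
      linarith
    rcases (norm_nonneg (h w)).eq_or_lt with h5 | h5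
    · rw [← h5, Real.zero_rpow hp.ne']; simp
    · calc ‖h w‖ = ‖h w‖ ^ (1 - p) * ‖h w‖ ^ p := by rw [← Real.rpow_add h5]; simp
        _ ≤ (K * ‖h w₀‖) ^ (1 - p) * ‖h w‖ ^ p := by
          gcongr
        _ = _ := by ring
  have h6 := norm_mul_area_le_of_le_rpow hσ0 (by positivity) le_rfl hJ
    (hh.mono (hsub.trans Metric.ball_subset_closedBall)) hb
    ((lintegral_mono_set hsub).trans hI)
  rw [zero_mul, zero_add, Real.mul_rpow (by positivity) h0.le] at h6
  have h7 : ‖h w₀‖ ^ (p - 1) * (‖h w₀‖ * (Real.pi * σ ^ 2)) ≤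
      ‖h w₀‖ ^ (p - 1) * (K ^ (1 - p) * ‖h w₀‖ ^ (1 - p) * J) := by gcongr
  have h8 : ‖h w₀‖ ^ (p - 1) * (K ^ (1 - p) * ‖h w₀‖ ^ (1 - p) * J) = K ^ (1 - p) * J := by
    have : ‖h w₀‖ ^ (p - 1) * ‖h w₀‖ ^ (1 - p) = 1 := by
      rw [← Real.rpow_add h0]; simp
    linear_combination (K ^ (1 - p) * J) * this
  rw [h8, ← mul_assoc, ← Real.rpow_add_one h0.ne', sub_add_cancel] at h7
  have h9 : ‖h w₀‖ ^ p * (1 * σ ^ 2) ≤ ‖h w₀‖ ^ p * (Real.pi * σ ^ 2) := by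
    gcongr; linarith [Real.pi_gt_three]
  have e : ρ - dist w₀ z = 2 * σ := by rw [hσ]; ring
  rw [e]
  nlinarith

/-- Sub-mean value inequality for `‖h‖ ^ p`, `h` analytic, `0 < p`. -/
lemma exists_rpow_le_lintegral_ball {p : ℝ} (hp : 0 < p) :
    ∃ C : ℝ, 0 < C ∧ ∀ (h : ℂ → ℂ) (z : ℂ) (ρ : ℝ), 0 < ρ →
      DifferentiableOn ℂ h (Metric.closedBall z ρ) →
      ENNReal.ofReal (‖h z‖ ^ p) ≤
        ENNReal.ofReal (C / ρ ^ 2) * ∫⁻ w in Metric.ball z ρ, ENNReal.ofReal (‖h w‖ ^ p) := by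
  obtain ⟨C, hC, H⟩ : ∃ C : ℝ, 0 < C ∧ ∀ (h : ℂ → ℂ) (z : ℂ) (ρ J : ℝ), 0 < ρ → 0 ≤ J →
      DifferentiableOn ℂ h (Metric.closedBall z ρ) →
      ∫⁻ w in Metric.ball z ρ, ENNReal.ofReal (‖h w‖ ^ p) ≤ ENNReal.ofReal J →
      ‖h z‖ ^ p * ρ ^ 2 ≤ C * J := by
    rcases le_total p 1 with hp1 | hp1
    · exact ⟨_, by positivity, fun h z ρ J hρ hJ hh hI => rpow_mul_sq_le_of_le_one hp hp1 hρ hJ hh hI⟩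
    · exact ⟨_, by positivity, fun h z ρ J hρ hJ hh hI =>
        rpow_mul_sq_le_of_one_le hp1 hρ hJ (hh.mono Metric.ball_subset_closedBall) hI⟩
  refine ⟨C, hC, fun h z ρ hρ hh => ?_⟩
  by_cases hT : ∫⁻ w in Metric.ball z ρ, ENNReal.ofReal (‖h w‖ ^ p) = ⊤
  · rw [hT, ENNReal.mul_top (by simp; positivity)]; exact le_top
  · have := H h z ρ _ hρ ENNReal.toReal_nonneg hh (ENNReal.ofReal_toReal hT).ge
    rw [← ENNReal.ofReal_toReal hT, ← ENNReal.ofReal_mul (by positivity)]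
    refine ENNReal.ofReal_le_ofReal ?_
    rw [div_mul_eq_mul_div, le_div_iff₀ (by positivity)]
    exact this

/-! ### The disk, its area measure and the powers of the norm -/

lemma mem_disk {z : ℂ} : z ∈ disk ↔ ‖z‖ < 1 := by simp [disk]

lemma isOpen_disk : IsOpen disk := Metric.isOpen_ball

lemma measurableSet_disk : MeasurableSet disk := isOpen_disk.measurableSet

lemma closedBall_subset_disk {r : ℝ} (hr : r < 1) : Metric.closedBall (0 : ℂ) r ⊆ disk :=
  Metric.closedBall_subset_ball hr

lemma one_sub_le_one_sub_sq {z : ℂ} (hz : z ∈ disk) : 1 - ‖z‖ ≤ 1 - ‖z‖ ^ 2 := by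
  nlinarith [norm_nonneg z, mem_disk.1 hz]

lemma one_sub_sq_le {z : ℂ} (hz : z ∈ disk) : 1 - ‖z‖ ^ 2 ≤ 2 * (1 - ‖z‖) := by
  nlinarith [norm_nonneg z, mem_disk.1 hz]

lemma one_sub_pos {z : ℂ} (hz : z ∈ disk) : 0 < 1 - ‖z‖ := sub_pos.2 (mem_disk.1 hz)

lemma one_sub_sq_pos {z : ℂ} (hz : z ∈ disk) : 0 < 1 - ‖z‖ ^ 2 :=
  (one_sub_pos hz).trans_le (one_sub_le_one_sub_sq hz)

lemma rpow_le_of_comparable {x y : ℝ} (α : ℝ) (hx : 0 < x) (hy : 0 < y) (h1 : x ≤ 4 * y)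
    (h2 : y ≤ 4 * x) : x ^ α ≤ 4 ^ |α| * y ^ α := by
  rcases le_total 0 α with h | h
  · rw [abs_of_nonneg h, ← Real.mul_rpow (by norm_num) hy.le]
    exact Real.rpow_le_rpow hx.le h1 h
  · rw [abs_of_nonpos h, Real.rpow_neg (by norm_num), ← Real.inv_rpow (by norm_num),
      ← Real.mul_rpow (by norm_num) hy.le]
    exact Real.rpow_le_rpow_of_nonpos (by positivity) (by linarith) h

lemma differentiableOn_deriv_disk {f : ℂ → ℂ} (hf : DifferentiableOn ℂ f disk) :
    DifferentiableOn ℂ (deriv f) disk := hf.deriv isOpen_disk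

lemma differentiableAt_of_mem_disk {f : ℂ → ℂ} (hf : DifferentiableOn ℂ f disk) {z : ℂ}
    (hz : z ∈ disk) : DifferentiableAt ℂ f z := hf.differentiableAt (isOpen_disk.mem_nhds hz)

lemma setLIntegral_dA {s : Set ℂ} (hs : s ⊆ disk) (hm : MeasurableSet s) (φ : ℂ → ENNReal) :
    ∫⁻ z in s, φ z ∂dA = ENNReal.ofReal (1 / Real.pi) * ∫⁻ z in s, φ z := by
  rw [dA, Measure.restrict_smul, Measure.restrict_restrict hm, Set.inter_eq_left.2 hs,
    lintegral_smul_measure, smul_eq_mul]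

lemma ae_dA_mem_disk : ∀ᵐ z ∂dA, z ∈ disk :=
  Measure.ae_smul_measure (ae_restrict_mem measurableSet_disk) _

lemma lintegral_dA_mono {φ ψ : ℂ → ENNReal} (h : ∀ z ∈ disk, φ z ≤ ψ z) :
    ∫⁻ z, φ z ∂dA ≤ ∫⁻ z, ψ z ∂dA :=
  lintegral_mono_ae (ae_dA_mem_disk.mono h)

lemma setLIntegral_dA_mono {φ ψ : ℂ → ENNReal} {s : Set ℂ} (hs : MeasurableSet s)
    (h : ∀ z ∈ disk, z ∈ s → φ z ≤ ψ z) : ∫⁻ z in s, φ z ∂dA ≤ ∫⁻ z in s, ψ z ∂dA :=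
  setLIntegral_mono_ae' hs (ae_dA_mem_disk.mono h)

instance : IsFiniteMeasure dA := by
  refine ⟨?_⟩
  rw [dA, Measure.smul_apply, Measure.restrict_apply_univ, smul_eq_mul]
  exact ENNReal.mul_lt_top ENNReal.ofReal_lt_top (by simp [disk])

/-- The energy integral of a weighted Dirichlet space. -/
def energy (p α : ℝ) (f : ℂ → ℂ) : ENNReal :=
  ∫⁻ z, ENNReal.ofReal (‖deriv f z‖ ^ p * (1 - ‖z‖ ^ 2) ^ α) ∂dA

/-- The `p`-th power of the norm of a weighted Dirichlet space. -/
def powNorm (p α : ℝ) (f : ℂ → ℂ) : ENNReal := ENNReal.ofReal (‖f 0‖ ^ p) + energy p α f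

lemma dirichletNorm_eq (p α : ℝ) (f : ℂ → ℂ) : dirichletNorm p α f = powNorm p α f ^ (1 / p) := rfl

lemma powNorm_eq {p : ℝ} (hp : 0 < p) (α : ℝ) (f : ℂ → ℂ) :
    powNorm p α f = dirichletNorm p α f ^ p := by
  rw [dirichletNorm_eq, ← ENNReal.rpow_mul, one_div_mul_cancel hp.ne', ENNReal.rpow_one]

lemma dirichletNorm_lt_top_iff {p : ℝ} (hp : 0 < p) {α : ℝ} {f : ℂ → ℂ} :
    dirichletNorm p α f < ⊤ ↔ powNorm p α f < ⊤ := by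
  rw [dirichletNorm_eq, ENNReal.rpow_lt_top_iff_of_pos (by positivity)]

lemma tendsto_dirichletNorm_iff {p : ℝ} (hp : 0 < p) {α : ℝ} {f : ℕ → ℂ → ℂ} :
    Tendsto (fun n => dirichletNorm p α (f n)) atTop (𝓝 0) ↔
      Tendsto (fun n => powNorm p α (f n)) atTop (𝓝 0) := by
  constructor
  · intro h
    have := (ENNReal.continuous_rpow_const (y := p)).tendsto 0 |>.comp h
    rw [ENNReal.zero_rpow_of_pos hp] at this
    exact this.congr fun n => (powNorm_eq hp α (f n)).symm
  · intro h
    have := (ENNReal.continuous_rpow_const (y := 1 / p)).tendsto 0 |>.comp h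
    rw [ENNReal.zero_rpow_of_pos (by positivity)] at this
    exact this

lemma energy_le_powNorm (p α : ℝ) (f : ℂ → ℂ) : energy p α f ≤ powNorm p α f := le_add_self

lemma norm_zero_le_of_powNorm_le {p α : ℝ} (hp : 0 < p) {f : ℂ → ℂ} {J : ℝ} (hJ : 0 ≤ J)
    (h : powNorm p α f ≤ ENNReal.ofReal J) : ‖f 0‖ ≤ J ^ (1 / p) := by
  have h1 : ‖f 0‖ ^ p ≤ J := (ENNReal.ofReal_le_ofReal_iff hJ).1 (le_self_add.trans h)
  rw [one_div]
  exact (Real.le_rpow_inv_iff_of_pos (norm_nonneg _) hJ hp).2 h1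

/-! ### Pointwise bounds and normal families -/

lemma ball_subset_disk_of_le {z : ℂ} {ρ : ℝ} (hz : z ∈ disk) (hρ : ρ ≤ (1 - ‖z‖) / 2) :
    Metric.closedBall z ρ ⊆ disk := by
  intro w hw
  have h1 := mem_closedBall_iff_norm.1 hw
  have h2 := norm_sub_norm_le w z
  have := one_sub_pos hz
  rw [mem_disk]; linarith

lemma weight_comparable {z w : ℂ} {ρ : ℝ} (α : ℝ) (hz : z ∈ disk) (hρ : ρ ≤ (1 - ‖z‖) / 2)
    (hw : w ∈ Metric.closedBall z ρ) :
    (1 - ‖z‖ ^ 2) ^ α ≤ 4 ^ |α| * (1 - ‖w‖ ^ 2) ^ α := by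
  have hwd := ball_subset_disk_of_le hz hρ hw
  have h1 := mem_closedBall_iff_norm.1 hw
  have h2 := norm_sub_norm_le w z
  have h2' := norm_sub_norm_le z w
  rw [norm_sub_rev] at h2'
  have := one_sub_pos hz
  have := one_sub_le_one_sub_sq hz
  have := one_sub_sq_le hz
  have := one_sub_le_one_sub_sq hwd
  have := one_sub_sq_le hwd
  exact rpow_le_of_comparable α (one_sub_sq_pos hz) (one_sub_sq_pos hwd) (by linarith) (by linarith)

/-- On a ball of radius at most half the distance to the circle the weight varies by a bounded
factor only, so it can be moved under the integral of the unweighted inequality. -/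
lemma exists_weighted_rpow_le_lintegral_ball {p : ℝ} (hp : 0 < p) (α : ℝ) :
    ∃ C : ℝ, 0 < C ∧ ∀ (h : ℂ → ℂ), DifferentiableOn ℂ h disk → ∀ z ∈ disk, ∀ ρ : ℝ, 0 < ρ →
      ρ ≤ (1 - ‖z‖) / 2 →
      ENNReal.ofReal (‖h z‖ ^ p * (1 - ‖z‖ ^ 2) ^ α) ≤ ENNReal.ofReal (C / ρ ^ 2) *
        ∫⁻ w in Metric.ball z ρ, ENNReal.ofReal (‖h w‖ ^ p * (1 - ‖w‖ ^ 2) ^ α) ∂dA := by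
  obtain ⟨C, hC, H⟩ := exists_rpow_le_lintegral_ball hp
  refine ⟨C * 4 ^ |α| * Real.pi, by positivity, fun h hh z hz ρ hρ hρz => ?_⟩
  have hsub := ball_subset_disk_of_le hz hρz
  have h1 := H h z ρ hρ (hh.mono hsub)
  have hw0 : 0 ≤ (1 - ‖z‖ ^ 2) ^ α := (Real.rpow_pos_of_pos (one_sub_sq_pos hz) _).le
  rw [setLIntegral_dA (Metric.ball_subset_closedBall.trans hsub) measurableSet_ball, mul_comm (_ ^ p),
    ENNReal.ofReal_mul hw0]
  calc ENNReal.ofReal ((1 - ‖z‖ ^ 2) ^ α) * ENNReal.ofReal (‖h z‖ ^ p)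
      ≤ ENNReal.ofReal ((1 - ‖z‖ ^ 2) ^ α) * (ENNReal.ofReal (C / ρ ^ 2) *
          ∫⁻ w in Metric.ball z ρ, ENNReal.ofReal (‖h w‖ ^ p)) := by gcongr
    _ = ENNReal.ofReal (C / ρ ^ 2) * ∫⁻ w in Metric.ball z ρ,
          ENNReal.ofReal ((1 - ‖z‖ ^ 2) ^ α) * ENNReal.ofReal (‖h w‖ ^ p) := by
        rw [lintegral_const_mul' _ _ ENNReal.ofReal_ne_top]; ring
    _ ≤ ENNReal.ofReal (C / ρ ^ 2) * ∫⁻ w in Metric.ball z ρ,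
          ENNReal.ofReal (4 ^ |α|) * ENNReal.ofReal (‖h w‖ ^ p * (1 - ‖w‖ ^ 2) ^ α) := by
        refine mul_le_mul_right ?_ _
        refine setLIntegral_mono_ae' measurableSet_ball (ae_of_all _ fun w hw => ?_)
        rw [← ENNReal.ofReal_mul hw0, ← ENNReal.ofReal_mul (by positivity)]
        refine ENNReal.ofReal_le_ofReal ?_
        have := weight_comparable α hz hρz (Metric.ball_subset_closedBall hw)
        calc _ ≤ 4 ^ |α| * (1 - ‖w‖ ^ 2) ^ α * ‖h w‖ ^ p := by gcongr
          _ = _ := by ring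
    _ = _ := by
        rw [lintegral_const_mul' _ _ ENNReal.ofReal_ne_top, ← mul_assoc, ← mul_assoc,
          ← ENNReal.ofReal_mul (by positivity), ← ENNReal.ofReal_mul (by positivity)]
        congr 2
        field_simp

/-- The weighted sub-mean value inequality for `f'` at the largest admissible radius `(1 - ‖z‖) /
2`: the area contributes the exponent `2` and the weight the exponent `α`. -/
lemma exists_norm_deriv_le {p : ℝ} (hp : 0 < p) (α : ℝ) :
    ∃ C : ℝ, 0 < C ∧ ∀ f : ℂ → ℂ, DifferentiableOn ℂ f disk → ∀ J : ℝ, 0 ≤ J →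
      energy p α f ≤ ENNReal.ofReal J → ∀ z ∈ disk,
      ‖deriv f z‖ ≤ C * (1 - ‖z‖) ^ (-((2 + α) / p)) * J ^ (1 / p) := by
  obtain ⟨C, hC, H⟩ := exists_weighted_rpow_le_lintegral_ball hp α
  refine ⟨(4 ^ |α| * (4 * C)) ^ (1 / p), by positivity, fun f hf J hJ hE z hz => ?_⟩
  have hd := one_sub_pos hz
  have h1 := H (deriv f) (differentiableOn_deriv_disk hf) z hz ((1 - ‖z‖) / 2) (by positivity) le_rfl
  have h2 := h1.trans (mul_le_mul_right ((setLIntegral_le_lintegral _ _).trans hE) _)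
  rw [← ENNReal.ofReal_mul (by positivity), ENNReal.ofReal_le_ofReal_iff (by positivity)] at h2
  have h3 : (1 - ‖z‖) ^ α ≤ 4 ^ |α| * (1 - ‖z‖ ^ 2) ^ α :=
    rpow_le_of_comparable α hd (one_sub_sq_pos hz)
      (by linarith [one_sub_le_one_sub_sq hz]) (by linarith [one_sub_sq_le hz])
  have h4 : ‖deriv f z‖ ^ p * (1 - ‖z‖) ^ α ≤ 4 ^ |α| * (C / ((1 - ‖z‖) / 2) ^ 2 * J) := by
    calc _ ≤ ‖deriv f z‖ ^ p * (4 ^ |α| * (1 - ‖z‖ ^ 2) ^ α) := by gcongr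
      _ = 4 ^ |α| * (‖deriv f z‖ ^ p * (1 - ‖z‖ ^ 2) ^ α) := by ring
      _ ≤ _ := by gcongr
  have h5 : ‖deriv f z‖ ^ p ≤ 4 ^ |α| * (4 * C) * (1 - ‖z‖) ^ (-(2 + α)) * J := by
    have e : (1 - ‖z‖) ^ (-(2 + α)) = ((1 - ‖z‖) ^ 2)⁻¹ * ((1 - ‖z‖) ^ α)⁻¹ := by
      rw [Real.rpow_neg hd.le, Real.rpow_add hd, mul_inv]; norm_cast
    have hp' := Real.rpow_pos_of_pos hd α
    rw [← le_div_iff₀ hp'] at h4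
    refine h4.trans (le_of_eq ?_)
    rw [e]; field_simp; ring
  have h6 := Real.rpow_le_rpow (by positivity) h5 (show 0 ≤ 1 / p by positivity)
  rw [← Real.rpow_mul (norm_nonneg _), mul_one_div_cancel hp.ne', Real.rpow_one,
    Real.mul_rpow (by positivity) hJ, Real.mul_rpow (by positivity) (by positivity),
    ← Real.rpow_mul hd.le] at h6
  convert h6 using 3
  ring_nf

/-- On compact subsets of the disk a function and its derivative are controlled by the norm. -/
lemma exists_local_bound {p α : ℝ} (hp : 0 < p) (hα : -2 < α) {r : ℝ} (hr : r < 1) :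
    ∃ C : ℝ, 0 < C ∧ ∀ f : ℂ → ℂ, DifferentiableOn ℂ f disk → ∀ J : ℝ, 0 ≤ J →
      powNorm p α f ≤ ENNReal.ofReal J → ∀ z ∈ Metric.closedBall (0 : ℂ) r,
      ‖f z‖ ≤ C * J ^ (1 / p) ∧ ‖deriv f z‖ ≤ C * J ^ (1 / p) := by
  obtain ⟨C, hC, H⟩ := exists_norm_deriv_le hp α
  have h1r : 0 < 1 - r := by linarith
  set B := C * (1 - r) ^ (-((2 + α) / p)) with hB
  have hB0 : 0 < B := by positivity
  refine ⟨1 + B, by positivity, fun f hf J hJ hN z hz => ?_⟩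
  have hder : ∀ w ∈ Metric.closedBall (0 : ℂ) r, ‖deriv f w‖ ≤ B * J ^ (1 / p) := by
    intro w hw
    refine (H f hf J hJ ((energy_le_powNorm _ _ _).trans hN) w
      (closedBall_subset_disk hr hw)).trans ?_
    rw [hB]
    gcongr ?_ * ?_ * _
    refine Real.rpow_le_rpow_of_nonpos h1r (by linarith [mem_closedBall_zero_iff.1 hw]) ?_
    have : 0 ≤ (2 + α) / p := div_nonneg (by linarith) hp.le
    linarith
  have hJ' : 0 ≤ J ^ (1 / p) := by positivity
  have hr0 : 0 ≤ r := (norm_nonneg z).trans (mem_closedBall_zero_iff.1 hz)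
  constructor
  · have h1 := (convex_closedBall (0 : ℂ) r).norm_image_sub_le_of_norm_deriv_le
      (fun w hw => differentiableAt_of_mem_disk hf (closedBall_subset_disk hr hw)) hder
      (Metric.mem_closedBall_self hr0) hz
    have h2 : ‖z - 0‖ ≤ 1 := by
      rw [sub_zero]; linarith [mem_closedBall_zero_iff.1 hz]
    have h3 := norm_zero_le_of_powNorm_le hp hJ hN
    have h4 := norm_sub_norm_le (f z) (f 0)
    nlinarith [mul_nonneg hB0.le hJ']
  · refine (hder z hz).trans ?_
    gcongr
    linarith

lemma exists_subset_closedBall_of_isCompact {K : Set ℂ} (hK : IsCompact K) (hd : K ⊆ disk) :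
    ∃ r : ℝ, 0 < r ∧ r < 1 ∧ K ⊆ Metric.closedBall 0 r := by
  rcases K.eq_empty_or_nonempty with rfl | hne
  · exact ⟨1 / 2, by norm_num, by norm_num, Set.empty_subset _⟩
  obtain ⟨z, hz, hmax⟩ := hK.exists_isMaxOn hne continuous_norm.continuousOn
  refine ⟨max ‖z‖ (1 / 2), by positivity, max_lt (mem_disk.1 (hd hz)) (by norm_num), fun w hw => ?_⟩
  rw [mem_closedBall_zero_iff]
  exact (hmax hw).trans (le_max_left _ _)

lemma tendstoLocallyUniformlyOn_disk_zero {h : ℕ → ℂ → ℂ}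
    (H : ∀ r : ℝ, 0 < r → r < 1 → ∃ b : ℕ → ℝ, Tendsto b atTop (𝓝 0) ∧
      ∀ n, ∀ z ∈ Metric.closedBall (0 : ℂ) r, ‖h n z‖ ≤ b n) :
    TendstoLocallyUniformlyOn h 0 atTop disk := by
  rw [tendstoLocallyUniformlyOn_iff_forall_isCompact isOpen_disk]
  intro K hK hKc
  obtain ⟨r, hr0, hr1, hKr⟩ := exists_subset_closedBall_of_isCompact hKc hK
  obtain ⟨b, hb, hle⟩ := H r hr0 hr1
  rw [Metric.tendstoUniformlyOn_iff]
  intro ε hε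
  filter_upwards [hb.eventually (gt_mem_nhds hε)] with n hn z hz
  simpa [dist_eq_norm] using (hle n z (hKr hz)).trans_lt hn

/-- A version of Montel's theorem on the disk: local bounds for functions and derivatives give a
locally uniformly convergent subsequence. -/
lemma exists_subseq_tendstoLocallyUniformlyOn {f : ℕ → ℂ → ℂ}
    (hf : ∀ n, DifferentiableOn ℂ (f n) disk)
    (hB : ∀ r : ℝ, r < 1 → ∃ B : ℝ, 0 < B ∧ ∀ n, ∀ z ∈ Metric.closedBall (0 : ℂ) r,
      ‖f n z‖ ≤ B ∧ ‖deriv (f n) z‖ ≤ B) :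
    ∃ φ : ℕ → ℕ, StrictMono φ ∧ ∃ h : ℂ → ℂ,
      TendstoLocallyUniformlyOn (fun n => f (φ n)) h atTop disk := by
  have hne : Nonempty disk := ⟨⟨0, by simp [disk]⟩⟩
  set x : ℕ → disk := TopologicalSpace.denseSeq disk with hx
  have hxd : DenseRange x := TopologicalSpace.denseRange_denseSeq disk
  choose! B hB0 hBb using hB
  -- Sequential compactness of this countable product replaces the diagonal argument over the dense
  -- points.
  have hcpt : IsCompact (Set.pi Set.univ fun k : ℕ => Metric.closedBall (0 : ℂ) (B ‖(x k : ℂ)‖)) :=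
    isCompact_univ_pi fun k => isCompact_closedBall _ _
  obtain ⟨c, -, φ, hφ, hc⟩ := hcpt.tendsto_subseq (x := fun n k => f n (x k)) (by
    intro n k _
    rw [mem_closedBall_zero_iff]
    exact (hBb _ (mem_disk.1 (x k).2) n _ (by simp)).1)
  rw [tendsto_pi_nhds] at hc
  have hlip : ∀ r : ℝ, r < 1 → ∀ n,
      LipschitzOnWith (B r).toNNReal (f n) (Metric.closedBall (0 : ℂ) r) := by
    intro r hr n
    refine (convex_closedBall (0 : ℂ) r).lipschitzOnWith_of_nnnorm_deriv_le
      (fun w hw => differentiableAt_of_mem_disk (hf n) (closedBall_subset_disk hr hw))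
      fun w hw => ?_
    rw [← NNReal.coe_le_coe, coe_nnnorm, Real.coe_toNNReal _ (hB0 r hr).le]
    exact (hBb r hr n w hw).2
  have hpt : ∀ z : disk, ∃ l : ℂ, Tendsto (fun n => f (φ n) z) atTop (𝓝 l) := by
    intro z
    refine cauchySeq_tendsto_of_complete (Metric.cauchySeq_iff'.2 fun ε hε => ?_)
    set r := (1 + ‖(z : ℂ)‖) / 2 with hr
    have hz := mem_disk.1 z.2
    have hr1 : r < 1 := by rw [hr]; linarith
    have hB := hB0 r hr1
    obtain ⟨k, hk⟩ := hxd.exists_dist_lt z (ε := min (ε / (3 * B r)) ((1 - ‖(z : ℂ)‖) / 2))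
      (lt_min (by positivity) (by linarith))
    rw [Subtype.dist_eq] at hk
    have hzr : (z : ℂ) ∈ Metric.closedBall (0 : ℂ) r := by
      rw [mem_closedBall_zero_iff, hr]; linarith
    have hkr : (x k : ℂ) ∈ Metric.closedBall (0 : ℂ) r := by
      rw [mem_closedBall_zero_iff]
      have h1 := hk.trans_le (min_le_right _ _)
      rw [dist_comm, dist_eq_norm] at h1
      have h2 := norm_sub_norm_le (x k : ℂ) z
      rw [hr]; linarith
    have hd : ∀ n, dist (f n z) (f n (x k)) < ε / 3 := by
      intro n
      have h1 := (hlip r hr1 n).dist_le_mul _ hzr _ hkr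
      rw [Real.coe_toNNReal _ hB.le] at h1
      refine h1.trans_lt ?_
      have := hk.trans_le (min_le_left _ _)
      rw [lt_div_iff₀ (by positivity)] at this
      linarith
    obtain ⟨N, hN⟩ := Metric.cauchySeq_iff'.1 (hc k).cauchySeq (ε / 3) (by positivity)
    refine ⟨N, fun n hn => ?_⟩
    have h1 := hN n hn
    have h2 := hd (φ n)
    have h3 := hd (φ N)
    rw [dist_comm] at h3
    have h4 := dist_triangle4 (f (φ n) z) (f (φ n) (x k)) (f (φ N) (x k)) (f (φ N) z)
    simp only [Function.comp_apply] at h1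
    linarith
  choose l hl using hpt
  classical
  set h : ℂ → ℂ := fun z => if hz : z ∈ disk then l ⟨z, hz⟩ else 0 with hh
  refine ⟨φ, hφ, h, ?_⟩
  rw [tendstoLocallyUniformlyOn_iff_forall_isCompact isOpen_disk]
  intro K hK hKc
  obtain ⟨r, hr0, hr1, hKr⟩ := exists_subset_closedBall_of_isCompact hKc hK
  -- Pointwise convergence is uniform on compact sets for an equicontinuous sequence; the common
  -- Lipschitz constant comes from the derivative bound.
  have heq : EquicontinuousOn (fun n => f (φ n)) K :=
    (LipschitzOnWith.uniformEquicontinuousOn _ _ fun n =>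
      (hlip r hr1 (φ n)).mono hKr).equicontinuousOn
  have key := (EquicontinuousOn.tendsto_uniformOnFun_iff_pi' (𝔖 := {K}) (by simpa using hKc)
    (by simpa using heq) atTop h).2 (by
      rw [tendsto_pi_nhds]
      rintro ⟨z, hz⟩
      simp only [Set.sUnion_singleton] at hz
      have hzd := hK hz
      simpa [hh, hzd] using hl ⟨z, hzd⟩)
  exact (UniformOnFun.tendsto_iff_tendstoUniformlyOn.1 key) K rfl

/-! ### Compactness and null sequences -/

lemma measurable_energy_integrand (p α : ℝ) (f : ℂ → ℂ) :
    Measurable fun z : ℂ => ENNReal.ofReal (‖deriv f z‖ ^ p * (1 - ‖z‖ ^ 2) ^ α) := by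
  have := measurable_deriv f
  fun_prop

/-- Fatou's lemma for the weighted Dirichlet norm. -/
lemma powNorm_le_of_tendsto {p α : ℝ} (hp : 0 < p) {f : ℕ → ℂ → ℂ} {h : ℂ → ℂ}
    (hf : ∀ n, DifferentiableOn ℂ (f n) disk)
    (hl : TendstoLocallyUniformlyOn f h atTop disk) {J : ENNReal}
    (hJ : ∀ n, powNorm p α (f n) ≤ J) : powNorm p α h ≤ 2 * J := by
  have hd := hl.deriv (Eventually.of_forall hf) isOpen_disk
  have h0 : ENNReal.ofReal (‖h 0‖ ^ p) ≤ J := by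
    have h1 := (hl.tendsto_at (show (0 : ℂ) ∈ disk by simp [disk])).norm.rpow_const (p := p)
      (Or.inr hp.le)
    refine le_of_tendsto (ENNReal.tendsto_ofReal h1) (Eventually.of_forall fun n => ?_)
    exact le_self_add.trans (hJ n)
  have h1 : energy p α h ≤ J := by
    calc energy p α h ≤ ∫⁻ z, liminf (fun n => ENNReal.ofReal
          (‖deriv (f n) z‖ ^ p * (1 - ‖z‖ ^ 2) ^ α)) atTop ∂dA := by
          refine lintegral_dA_mono fun z hz => le_of_eq ?_
          refine (Tendsto.liminf_eq ?_).symm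
          exact ENNReal.tendsto_ofReal
            (((hd.tendsto_at hz).norm.rpow_const (Or.inr hp.le)).mul_const _)
      _ ≤ liminf (fun n => energy p α (f n)) atTop :=
          lintegral_liminf_le fun n => measurable_energy_integrand p α (f n)
      _ ≤ J := liminf_le_of_le (by isBoundedDefault) fun b hb => by
          obtain ⟨n, hn⟩ := hb.exists
          exact hn.trans ((energy_le_powNorm _ _ _).trans (hJ n))
  rw [two_mul]
  exact add_le_add h0 h1

lemma norm_add_rpow_le {p : ℝ} (hp : 0 < p) (a b : ℂ) :
    ‖a + b‖ ^ p ≤ 2 ^ p * (‖a‖ ^ p + ‖b‖ ^ p) := by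
  have ha := Real.rpow_nonneg (norm_nonneg a) p
  have hb := Real.rpow_nonneg (norm_nonneg b) p
  have h2 : (0 : ℝ) ≤ 2 ^ p := by positivity
  rcases le_total ‖a‖ ‖b‖ with h | h
  · calc ‖a + b‖ ^ p ≤ (2 * ‖b‖) ^ p := by
          refine Real.rpow_le_rpow (norm_nonneg _) ?_ hp.le
          linarith [norm_add_le a b]
      _ = 2 ^ p * ‖b‖ ^ p := Real.mul_rpow (by norm_num) (norm_nonneg _)
      _ ≤ _ := by gcongr; linarith
  · calc ‖a + b‖ ^ p ≤ (2 * ‖a‖) ^ p := by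
          refine Real.rpow_le_rpow (norm_nonneg _) ?_ hp.le
          linarith [norm_add_le a b]
      _ = 2 ^ p * ‖a‖ ^ p := Real.mul_rpow (by norm_num) (norm_nonneg _)
      _ ≤ _ := by gcongr; linarith

/-- A quasi-triangle inequality that serves `p < 1` and `p ≥ 1` alike, so no case distinction is
needed later. -/
lemma powNorm_sub_le {p : ℝ} (hp : 0 < p) (α : ℝ) {f h : ℂ → ℂ} (hf : DifferentiableOn ℂ f disk)
    (hh : DifferentiableOn ℂ h disk) :
    powNorm p α (f - h) ≤ ENNReal.ofReal (2 ^ p) * (powNorm p α f + powNorm p α h) := by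
  have key : ∀ a b : ℂ, ENNReal.ofReal (‖a - b‖ ^ p) ≤
      ENNReal.ofReal (2 ^ p) * (ENNReal.ofReal (‖a‖ ^ p) + ENNReal.ofReal (‖b‖ ^ p)) := by
    intro a b
    rw [← ENNReal.ofReal_add (by positivity) (by positivity), ← ENNReal.ofReal_mul (by positivity)]
    refine ENNReal.ofReal_le_ofReal ?_
    simpa [sub_eq_add_neg] using norm_add_rpow_le hp a (-b)
  have hE : energy p α (f - h) ≤ ENNReal.ofReal (2 ^ p) * (energy p α f + energy p α h) := by
    rw [energy, energy, energy, ← lintegral_add_left (measurable_energy_integrand p α f),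
      ← lintegral_const_mul' _ _ ENNReal.ofReal_ne_top]
    refine lintegral_dA_mono fun z hz => ?_
    rw [deriv_sub (differentiableAt_of_mem_disk hf hz) (differentiableAt_of_mem_disk hh hz),
      ENNReal.ofReal_mul (by positivity), ENNReal.ofReal_mul (by positivity),
      ENNReal.ofReal_mul (by positivity), ← add_mul, ← mul_assoc]
    gcongr
    exact key _ _
  calc powNorm p α (f - h) ≤ ENNReal.ofReal (2 ^ p) *
        (ENNReal.ofReal (‖f 0‖ ^ p) + ENNReal.ofReal (‖h 0‖ ^ p)) +
        ENNReal.ofReal (2 ^ p) * (energy p α f + energy p α h) := add_le_add (key _ _) hE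
    _ = _ := by rw [powNorm, powNorm]; ring

lemma powNorm_const_mul {p : ℝ} (α : ℝ) (c : ℂ) (f : ℂ → ℂ) :
    powNorm p α (fun z => c * f z) = ENNReal.ofReal (‖c‖ ^ p) * powNorm p α f := by
  simp only [powNorm, energy, deriv_const_mul_field, norm_mul,
    Real.mul_rpow (norm_nonneg _) (norm_nonneg _)]
  rw [mul_add, ← lintegral_const_mul' _ _ ENNReal.ofReal_ne_top,
    ENNReal.ofReal_mul (by positivity)]
  congr 1
  refine lintegral_congr fun z => ?_
  rw [mul_assoc, ENNReal.ofReal_mul (by positivity)]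

lemma powNorm_congr {p α : ℝ} {f h : ℂ → ℂ} (H : Set.EqOn f h disk) :
    powNorm p α f = powNorm p α h := by
  rw [powNorm, powNorm, H (show (0 : ℂ) ∈ disk by simp [disk])]
  congr 1
  refine lintegral_congr_ae (ae_dA_mem_disk.mono fun z hz => ?_)
  have : deriv f z = deriv h z :=
    (H.eventuallyEq_of_mem (isOpen_disk.mem_nhds hz)).deriv_eq
  simp only [this]

/-- Multiplication by `g` maps bounded sequences that tend to zero locally uniformly to sequences
that tend to zero in norm. -/
def NullToNull (p α q β : ℝ) (g : ℂ → ℂ) : Prop :=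
  ∀ h : ℕ → ℂ → ℂ, (∀ n, DifferentiableOn ℂ (h n) disk) →
    (∃ J : ℝ, 0 ≤ J ∧ ∀ n, powNorm p α (h n) ≤ ENNReal.ofReal J) →
    TendstoLocallyUniformlyOn h 0 atTop disk →
    Tendsto (fun n => powNorm q β (mulOp g (h n))) atTop (𝓝 0)

lemma differentiableOn_mulOp {g f : ℂ → ℂ} (hg : DifferentiableOn ℂ g disk)
    (hf : DifferentiableOn ℂ f disk) : DifferentiableOn ℂ (mulOp g f) disk := hg.mul hf

/-- The multiples `f / (n + 1)` form an admissible null sequence. If `g f` had infinite norm, so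
would every `g f / (n + 1)`, and these norms could not tend to zero. -/
lemma NullToNull.memDirichlet {p α q β : ℝ} {g : ℂ → ℂ} (hp : 0 < p) (hq : 0 < q) (hα : -2 < α)
    (hg : DifferentiableOn ℂ g disk) (H : NullToNull p α q β g) {f : ℂ → ℂ}
    (hf : MemDirichlet p α f) : MemDirichlet q β (mulOp g f) := by
  refine ⟨differentiableOn_mulOp hg hf.1, (dirichletNorm_lt_top_iff hq).2 ?_⟩
  have hfN := (dirichletNorm_lt_top_iff hp).1 hf.2
  set J := (powNorm p α f).toReal with hJ
  have hJe : powNorm p α f = ENNReal.ofReal J := (ENNReal.ofReal_toReal hfN.ne).symm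
  have hJ0 : 0 ≤ J := ENNReal.toReal_nonneg
  set c : ℕ → ℂ := fun n => 1 / ((n : ℂ) + 1) with hc
  have hcn : ∀ n, ‖c n‖ = 1 / ((n : ℝ) + 1) := by
    intro n
    rw [hc]
    have : ((n : ℂ) + 1) = ((n + 1 : ℝ) : ℂ) := by push_cast; rfl
    simp only [this, norm_div, norm_one, Complex.norm_real]
    rw [Real.norm_of_nonneg (by positivity)]
  have hc1 : ∀ n, ‖c n‖ ≤ 1 := by
    intro n
    rw [hcn, div_le_one (by positivity)]
    have : (0 : ℝ) ≤ n := n.cast_nonneg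
    linarith
  have hlim := H (fun n z => c n * f z) (fun n => hf.1.const_mul _) ⟨J, hJ0, fun n => by
      rw [powNorm_const_mul, hJe]
      refine mul_le_of_le_one_left' ?_
      rw [ENNReal.ofReal_le_one]
      exact Real.rpow_le_one (norm_nonneg _) (hc1 n) hp.le⟩ (by
    refine tendstoLocallyUniformlyOn_disk_zero fun r hr0 hr1 => ?_
    obtain ⟨C, hC, HC⟩ := exists_local_bound (p := p) (α := α) hp hα hr1
    refine ⟨fun n => 1 / ((n : ℝ) + 1) * (C * J ^ (1 / p)), ?_, fun n z hz => ?_⟩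
    · simpa using (tendsto_one_div_add_atTop_nhds_zero_nat (𝕜 := ℝ)).mul_const (C * J ^ (1 / p))
    · rw [norm_mul, hcn]
      exact mul_le_mul_of_nonneg_left (HC f hf.1 J hJ0 hJe.le z hz).1 (by positivity))
  obtain ⟨n, hn⟩ := (hlim.eventually (gt_mem_nhds ENNReal.zero_lt_top)).exists
  have he : mulOp g (fun z => c n * f z) = fun z => c n * mulOp g f z := by
    funext z; simp only [mulOp]; ring
  rw [he, powNorm_const_mul] at hn
  by_contra htop
  rw [not_lt, top_le_iff] at htop
  rw [htop, ENNReal.mul_top] at hn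
  · exact lt_irrefl _ hn
  · have : 0 < ‖c n‖ := by rw [hcn]; positivity
    simp only [ne_eq, ENNReal.ofReal_eq_zero, not_le]
    positivity

/-- From compactness: any norm limit of `g hₙ` along a subsequence is also a pointwise limit, hence
zero on the disk. Conversely, a bounded sequence has a locally uniform limit along a subsequence;
Fatou puts it in the space, and the differences form a null sequence. -/
lemma isCompactBetween_iff_nullToNull {p α q β : ℝ} {g : ℂ → ℂ} (hp : 0 < p) (hq : 0 < q)
    (hα : -2 < α) (hβ : -2 < β) (hg : DifferentiableOn ℂ g disk) :
    IsCompactBetween p α q β (mulOp g) ↔ NullToNull p α q β g := by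
  constructor
  · rintro ⟨hmem, hcomp⟩ h hd ⟨J, hJ0, hJ⟩ hl
    have hX : ∀ n, MemDirichlet p α (h n) := fun n =>
      ⟨hd n, (dirichletNorm_lt_top_iff hp).2 ((hJ n).trans_lt ENNReal.ofReal_lt_top)⟩
    -- Compactness only provides subsequences, so convergence is checked by refining an arbitrary
    -- one.
    refine tendsto_of_subseq_tendsto fun ns hns => ?_
    obtain ⟨φ, hφ, k, hk, hlim⟩ := hcomp (fun n => h (ns n)) (fun n => hX _)
      ⟨(J ^ (1 / p)).toNNReal, fun n => by
        rw [dirichletNorm_eq]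
        refine (ENNReal.rpow_le_rpow (hJ (ns n)) (by positivity)).trans (le_of_eq ?_)
        rw [ENNReal.ofReal_rpow_of_nonneg hJ0 (by positivity)]; rfl⟩
    refine ⟨φ, ?_⟩
    have hk0 : Set.EqOn k 0 disk := by
      intro z hz
      obtain ⟨C, hC, HC⟩ := exists_local_bound (p := q) (α := β) hq hβ (mem_disk.1 hz)
      rw [tendsto_dirichletNorm_iff hq] at hlim
      have h1 : Tendsto (fun n => mulOp g (h (ns (φ n))) z - k z) atTop (𝓝 0) := by
        rw [tendsto_zero_iff_norm_tendsto_zero]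
        have h2 : Tendsto (fun n => C *
            (powNorm q β (mulOp g (h (ns (φ n))) - k)).toReal ^ (1 / q)) atTop (𝓝 0) := by
          have h3 := ((ENNReal.tendsto_toReal ENNReal.zero_ne_top).comp hlim).rpow_const
            (p := 1 / q) (Or.inr (by positivity))
          simp only [ENNReal.toReal_zero] at h3
          rw [Real.zero_rpow (by positivity)] at h3
          simpa using h3.const_mul C
        refine squeeze_zero' (Eventually.of_forall fun n => norm_nonneg _) ?_ h2
        filter_upwards [hlim.eventually (gt_mem_nhds ENNReal.zero_lt_top)] with n hn
        exact (HC _ ((differentiableOn_mulOp hg (hd _)).sub hk.1) _ ENNReal.toReal_nonneg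
          (ENNReal.ofReal_toReal hn.ne).ge z (by simp)).1
      have h4 : Tendsto (fun n => mulOp g (h (ns (φ n))) z - k z) atTop (𝓝 (g z * 0 - k z)) := by
        refine Tendsto.sub_const (Tendsto.const_mul _ ?_) _
        exact (hl.tendsto_at hz).comp (hns.comp hφ.tendsto_atTop)
      have := tendsto_nhds_unique h1 h4
      simpa using this.symm
    rw [tendsto_dirichletNorm_iff hq] at hlim
    refine hlim.congr fun n => powNorm_congr fun z hz => ?_
    simp [hk0 hz]
  · intro H
    refine ⟨fun f hf => H.memDirichlet hp hq hα hg hf, fun f hf hbdd => ?_⟩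
    obtain ⟨C, hC⟩ := hbdd
    have hJ : ∀ n, powNorm p α (f n) ≤ ENNReal.ofReal ((C : ℝ) ^ p) := by
      intro n
      rw [powNorm_eq hp, ← ENNReal.ofReal_rpow_of_nonneg (NNReal.coe_nonneg C) hp.le]
      refine ENNReal.rpow_le_rpow ((hC n).trans (le_of_eq ?_)) hp.le
      simp
    have hJ0 : (0 : ℝ) ≤ (C : ℝ) ^ p := by positivity
    obtain ⟨φ, hφ, k, hk⟩ := exists_subseq_tendstoLocallyUniformlyOn (fun n => (hf n).1)
      (fun r hr => by
        obtain ⟨D, hD, HD⟩ := exists_local_bound (p := p) (α := α) hp hα hr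
        refine ⟨D * (((C : ℝ) ^ p) ^ (1 / p)) + 1, by positivity, fun n z hz => ?_⟩
        have := HD (f n) (hf n).1 _ hJ0 (hJ n) z hz
        exact ⟨by linarith [this.1], by linarith [this.2]⟩)
    have hkd : DifferentiableOn ℂ k disk :=
      hk.differentiableOn (Eventually.of_forall fun n => (hf _).1) isOpen_disk
    have hkN := powNorm_le_of_tendsto hp (fun n => (hf (φ n)).1) hk (fun n => hJ (φ n))
    have hkmem : MemDirichlet p α k :=
      ⟨hkd, (dirichletNorm_lt_top_iff hp).2 (hkN.trans_lt
        (ENNReal.mul_lt_top (by simp) ENNReal.ofReal_lt_top))⟩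
    refine ⟨φ, hφ, mulOp g k, H.memDirichlet hp hq hα hg hkmem, ?_⟩
    rw [tendsto_dirichletNorm_iff hq]
    have hlim := H (fun n => f (φ n) - k) (fun n => (hf _).1.sub hkd)
      ⟨2 ^ p * ((C : ℝ) ^ p + 2 * (C : ℝ) ^ p), by positivity, fun n => by
        refine (powNorm_sub_le hp α (hf _).1 hkd).trans ?_
        rw [ENNReal.ofReal_mul (by positivity), ENNReal.ofReal_add (by positivity) (by positivity),
          ENNReal.ofReal_mul (by norm_num : (0 : ℝ) ≤ 2)]
        gcongr
        · exact hJ _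
        · simpa using hkN⟩ (by
      rw [Metric.tendstoLocallyUniformlyOn_iff] at hk ⊢
      intro ε hε x hx
      obtain ⟨t, ht, h⟩ := hk ε hε x hx
      refine ⟨t, ht, h.mono fun n hn y hy => ?_⟩
      have := hn y hy
      rw [dist_eq_norm] at this
      simpa [dist_eq_norm] using this)
    refine hlim.congr fun n => ?_
    congr 1
    funext z
    simp [mulOp, mul_sub]

/-! ### Weak and strong type inequalities on a dyadic tree -/

/-- In `x ^ e = x * x ^ (e - 1)` the second factor is at most the same power of the whole sum. -/
lemma tsum_rpow_le_rpow_tsum {ι : Type*} (x : ι → ENNReal) {e : ℝ} (he : 1 ≤ e) :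
    ∑' k, x k ^ e ≤ (∑' k, x k) ^ e := by
  have h : ∀ y : ENNReal, y ^ e = y * y ^ (e - 1) := by
    intro y
    nth_rw 2 [← ENNReal.rpow_one y]
    rw [← ENNReal.rpow_add_of_nonneg _ _ zero_le_one (by linarith)]
    congr 1; ring
  rw [h (∑' k, x k), ← ENNReal.tsum_mul_right]
  refine ENNReal.tsum_le_tsum fun k => ?_
  rw [h]
  gcongr
  exact ENNReal.le_tsum k

lemma tsum_mul_le_Lp_mul_Lq {ι : Type*} {p q : ℝ} (hpq : p.HolderConjugate q) (f g : ι → ENNReal) :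
    ∑' i, f i * g i ≤ (∑' i, f i ^ p) ^ (1 / p) * (∑' i, g i ^ q) ^ (1 / q) := by
  let _ : MeasurableSpace ι := ⊤
  have := ENNReal.lintegral_mul_le_Lp_mul_Lq (Measure.count : Measure ι) hpq
    (f := f) (g := g) measurable_from_top.aemeasurable measurable_from_top.aemeasurable
  simpa [lintegral_count] using this

section Tree

variable {Ω : Type*}

/-- The sum of the node weights `a` along the branch of `z`, up to the generation `N z`. -/
def treeSum (κ : ℕ → Ω → ℕ) (N : Ω → ℕ) (a : ℕ → ℕ → ENNReal) (z : Ω) : ENNReal :=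
  ∑ m ∈ Finset.range (N z + 1), a m (κ m z)

/-- The points whose branch passes through the node `(m, i)`. -/
def treeBox (κ : ℕ → Ω → ℕ) (N : Ω → ℕ) (m i : ℕ) : Set Ω := {z | m ≤ N z ∧ κ m z = i}

lemma treeSum_eq_tsum (κ : ℕ → Ω → ℕ) (N : Ω → ℕ) (a : ℕ → ℕ → ENNReal) (z : Ω) :
    treeSum κ N a z = ∑' m, ∑' i, a m i * (treeBox κ N m i).indicator 1 z := by
  have h : ∀ m, ∑' i, a m i * (treeBox κ N m i).indicator 1 z =
      if m ∈ Finset.range (N z + 1) then a m (κ m z) else 0 := by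
    intro m
    rw [tsum_eq_single (κ m z)]
    · by_cases hm : m ≤ N z
      · simp [treeBox, hm]
      · simp [treeBox, hm]
    · intro i hi
      simp [treeBox, hi.symm]
  simp only [h]
  rw [tsum_eq_sum (s := Finset.range (N z + 1)) (fun m hm => by simp only [hm, if_false]), treeSum]
  exact Finset.sum_congr rfl fun m hm => by simp only [hm, if_true]

/-- The accumulated weight strictly above a node. -/
def nodePrev (a : ℕ → ℕ → NNReal) : ℕ → ℕ → ℝ
  | 0, _ => 0
  | m + 1, i => nodePrev a m (i / 2) + a m (i / 2)

/-- The part of the node weight that falls into the dyadic range `(2 ^ (k - 1), 2 ^ k]` of the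
accumulated weight. -/
def truncNode (a : ℕ → ℕ → NNReal) (k : ℤ) (m i : ℕ) : ENNReal :=
  volume (Set.Ioc (nodePrev a m i) (nodePrev a m i + a m i) ∩ Set.Ioc ((2 : ℝ) ^ (k - 1)) (2 ^ k))

lemma nodePrev_nonneg (a : ℕ → ℕ → NNReal) (m i : ℕ) : 0 ≤ nodePrev a m i := by
  induction m generalizing i with
  | zero => simp [nodePrev]
  | succ m ih => exact add_nonneg (ih _) (NNReal.coe_nonneg _)

lemma sum_eq_nodePrev_add {κ : ℕ → Ω → ℕ} (hκ : ∀ m z, κ m z = κ (m + 1) z / 2)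
    (a : ℕ → ℕ → NNReal) (z : Ω) (n : ℕ) :
    ∑ m ∈ Finset.range (n + 1), (a m (κ m z) : ENNReal) =
      ENNReal.ofReal (nodePrev a n (κ n z) + a n (κ n z)) := by
  induction n with
  | zero => simp [nodePrev]
  | succ n ih =>
    rw [Finset.sum_range_succ, ih, nodePrev, ← hκ,
      ENNReal.ofReal_add (add_nonneg (nodePrev_nonneg _ _ _) (NNReal.coe_nonneg _))
        (NNReal.coe_nonneg _), ENNReal.ofReal_coe_nnreal]

/-- Along a branch the intervals from the weight accumulated before a node to the weight accumulated
after it tile `(0, total]`. Truncated node weights therefore add up to the length of the dyadic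
range that the branch has covered. -/
lemma sum_truncNode {κ : ℕ → Ω → ℕ} (hκ : ∀ m z, κ m z = κ (m + 1) z / 2)
    (a : ℕ → ℕ → NNReal) (k : ℤ) (z : Ω) (n : ℕ) :
    ∑ m ∈ Finset.range (n + 1), truncNode a k m (κ m z) =
      volume (Set.Ioc 0 (nodePrev a n (κ n z) + a n (κ n z)) ∩
        Set.Ioc ((2 : ℝ) ^ (k - 1)) (2 ^ k)) := by
  induction n with
  | zero => simp [truncNode, nodePrev]
  | succ n ih =>
    rw [Finset.sum_range_succ, ih, truncNode, nodePrev, ← hκ, ← measure_union, ← Set.union_inter_distrib_right,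
      Set.Ioc_union_Ioc_eq_Ioc]
    · exact add_nonneg (nodePrev_nonneg _ _ _) (NNReal.coe_nonneg _)
    · exact le_add_of_nonneg_right (NNReal.coe_nonneg _)
    · refine Disjoint.inter_left _ (Disjoint.inter_right _ ?_)
      exact Set.disjoint_left.2 fun x hx hx' => (hx'.1.trans_le hx.2).false
    · exact measurableSet_Ioc.inter measurableSet_Ioc

lemma tsum_truncNode_le (a : ℕ → ℕ → NNReal) (m i : ℕ) :
    ∑' k : ℤ, truncNode a k m i ≤ a m i := by
  simp only [truncNode]
  rw [← measure_iUnion]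
  · refine (measure_mono (Set.iUnion_subset fun k => Set.inter_subset_left)).trans ?_
    rw [Real.volume_Ioc]; simp
  · intro k j hkj
    refine Disjoint.inter_left' _ (Disjoint.inter_right' _ ?_)
    have key : ∀ k j : ℤ, k < j → Disjoint (Set.Ioc ((2 : ℝ) ^ (k - 1)) (2 ^ k))
        (Set.Ioc ((2 : ℝ) ^ (j - 1)) (2 ^ j)) := fun k j h => by
      refine Set.disjoint_left.2 fun x hx hx' => (hx'.1.trans_le (hx.2.trans ?_)).false
      exact zpow_le_zpow_right₀ (by norm_num) (by omega)
    rcases lt_or_gt_of_ne hkj with h | h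
    · exact key k j h
    · exact (key j k h).symm
  · exact fun k => measurableSet_Ioc.inter measurableSet_Ioc

variable [MeasurableSpace Ω]

lemma measurableSet_treeBox {κ : ℕ → Ω → ℕ} {N : Ω → ℕ} (hκ : ∀ m, Measurable (κ m))
    (hN : Measurable N) (m i : ℕ) : MeasurableSet (treeBox κ N m i) :=
  (hN (measurableSet_Ici (a := m))).inter (hκ m (measurableSet_singleton i))

lemma measurable_treeSum {κ : ℕ → Ω → ℕ} {N : Ω → ℕ} (hκ : ∀ m, Measurable (κ m))
    (hN : Measurable N) (a : ℕ → ℕ → ENNReal) : Measurable (treeSum κ N a) := by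
  have : treeSum κ N a = fun z => ∑' m, ∑' i, a m i * (treeBox κ N m i).indicator 1 z :=
    funext fun z => treeSum_eq_tsum κ N a z
  rw [this]
  refine Measurable.tsum fun m => Measurable.tsum fun i => Measurable.const_mul ?_ _
  exact measurable_one.indicator (measurableSet_treeBox hκ hN m i)

lemma lintegral_treeSum {κ : ℕ → Ω → ℕ} {N : Ω → ℕ} (hκ : ∀ m, Measurable (κ m))
    (hN : Measurable N) (a : ℕ → ℕ → ENNReal) (ν : Measure Ω) :
    ∫⁻ z, treeSum κ N a z ∂ν = ∑' m, ∑' i, a m i * ν (treeBox κ N m i) := by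
  have hm : ∀ m i, Measurable fun z => a m i * (treeBox κ N m i).indicator 1 z := fun m i =>
    (measurable_one.indicator (measurableSet_treeBox hκ hN m i)).const_mul _
  simp only [treeSum_eq_tsum]
  rw [lintegral_tsum fun m => (Measurable.tsum (hm m)).aemeasurable]
  congr 1; funext m
  rw [lintegral_tsum fun i => (hm m i).aemeasurable]
  congr 1; funext i
  rw [lintegral_const_mul _ (measurable_one.indicator (measurableSet_treeBox hκ hN m i)),
    lintegral_indicator_one (measurableSet_treeBox hκ hN m i)]

lemma tsum_measure_treeBox_le {κ : ℕ → Ω → ℕ} {N : Ω → ℕ} (hκ : ∀ m, Measurable (κ m))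
    (hN : Measurable N) (ν : Measure Ω) (m : ℕ) : ∑' i, ν (treeBox κ N m i) ≤ ν Set.univ := by
  rw [← measure_iUnion _ (measurableSet_treeBox hκ hN m)]
  · exact measure_mono (Set.subset_univ _)
  · intro i j hij
    exact Set.disjoint_left.2 fun z hz hz' => hij (hz.2.symm.trans hz'.2)

/-- The condition on the box weights `u` and the node weights `w` that makes the tree embedding
from exponent `p` to exponent `q` work. -/
def ChainCondition (p q : ℝ) (u w : ℕ → ENNReal) : Prop :=
  ∃ K : NNReal, ∀ M : ENNReal, M ≠ 0 → M ≠ ⊤ →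
    ∑' m, (min (u m) M / w m) ^ (1 / (p - 1)) ≤ K * M ^ ((1 - p / q) * (1 / (p - 1)))

/-- Integrating the tree sum gives `l * M ≤ ∑ a * ν(box)`, where `M` is the total mass. Hölder
separates the node weights from the box masses, and each box has mass at most both `u m` and `M`,
which is the situation `ChainCondition` describes. In use, `ν` is the restriction of a measure to a
level set. -/
lemma tree_weak_type {κ : ℕ → Ω → ℕ} {N : Ω → ℕ} (hκ : ∀ m, Measurable (κ m))
    (hN : Measurable N) {p q : ℝ} (hp : 1 < p) (hpq : p < q) {u w : ℕ → ENNReal} {K : NNReal}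
    (hw : ∀ m, w m ≠ 0) (hw' : ∀ m, w m ≠ ⊤)
    (hK : ∀ M : ENNReal, M ≠ 0 → M ≠ ⊤ →
      ∑' m, (min (u m) M / w m) ^ (1 / (p - 1)) ≤ K * M ^ ((1 - p / q) * (1 / (p - 1))))
    (ν : Measure Ω) [IsFiniteMeasure ν] (hu : ∀ m i, ν (treeBox κ N m i) ≤ u m)
    (a : ℕ → ℕ → ENNReal) (l : ENNReal) (hl : ∀ᵐ z ∂ν, l ≤ treeSum κ N a z) :
    l ^ q * ν Set.univ ≤
      (K : ENNReal) ^ (q * (p - 1) / p) * (∑' m, ∑' i, a m i ^ p * w m) ^ (q / p) := by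
  set M := ν Set.univ with hM
  set A := ∑' m, ∑' i, a m i ^ p * w m with hA
  set r := 1 / (p - 1) with hr
  have hp1 : 0 < p - 1 := by linarith
  have hr0 : 0 < r := by positivity
  have hp0 : 0 < p := by linarith
  have hq0 : 0 < q := by linarith
  rcases eq_or_ne M 0 with hM0 | hM0
  · rw [hM0, mul_zero]; exact zero_le
  have hMt : M ≠ ⊤ := measure_ne_top _ _
  have hconj : p.HolderConjugate (1 + r) := by
    rw [Real.holderConjugate_iff]
    refine ⟨hp, ?_⟩
    rw [hr]; field_simp; ring
  have h1 : l * M ≤ ∑' x : ℕ × ℕ, a x.1 x.2 * ν (treeBox κ N x.1 x.2) := by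
    calc l * M = ∫⁻ _, l ∂ν := by rw [lintegral_const]
      _ ≤ ∫⁻ z, treeSum κ N a z ∂ν := lintegral_mono_ae hl
      _ = _ := by rw [lintegral_treeSum hκ hN, ENNReal.tsum_prod']
  have h2 : ∑' x : ℕ × ℕ, a x.1 x.2 * ν (treeBox κ N x.1 x.2) ≤ A ^ (1 / p) *
      (∑' x : ℕ × ℕ, (ν (treeBox κ N x.1 x.2) * (w x.1 ^ (1 / p))⁻¹) ^ (1 + r)) ^ (1 / (1 + r)) := by
    have h3 := tsum_mul_le_Lp_mul_Lq hconj (fun x : ℕ × ℕ => a x.1 x.2 * w x.1 ^ (1 / p))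
      (fun x : ℕ × ℕ => ν (treeBox κ N x.1 x.2) * (w x.1 ^ (1 / p))⁻¹)
    have e1 : ∀ x : ℕ × ℕ, a x.1 x.2 * w x.1 ^ (1 / p) *
        (ν (treeBox κ N x.1 x.2) * (w x.1 ^ (1 / p))⁻¹) = a x.1 x.2 * ν (treeBox κ N x.1 x.2) := by
      intro x
      have h0 : w x.1 ^ (1 / p) ≠ 0 := by simp [ENNReal.rpow_eq_zero_iff, hw, hw']
      have ht : w x.1 ^ (1 / p) ≠ ⊤ := by simp [ENNReal.rpow_eq_top_iff, hw, hw']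
      calc _ = a x.1 x.2 * ν (treeBox κ N x.1 x.2) * (w x.1 ^ (1 / p) * (w x.1 ^ (1 / p))⁻¹) := by
            ring
        _ = _ := by rw [ENNReal.mul_inv_cancel h0 ht, mul_one]
    have e2 : ∑' x : ℕ × ℕ, (a x.1 x.2 * w x.1 ^ (1 / p)) ^ p = A := by
      rw [hA, ENNReal.tsum_prod']
      refine tsum_congr fun m => tsum_congr fun i => ?_
      rw [ENNReal.mul_rpow_of_nonneg _ _ hp0.le, ← ENNReal.rpow_mul, one_div_mul_cancel hp0.ne',
        ENNReal.rpow_one]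
    simp only [e1, e2] at h3
    exact h3
  -- Of the power `1 + r` of the box mass, `r` factors are estimated by the minimum; the remaining
  -- one is summed over the disjoint boxes of a generation and gives at most `M`.
  have h4 : ∑' x : ℕ × ℕ, (ν (treeBox κ N x.1 x.2) * (w x.1 ^ (1 / p))⁻¹) ^ (1 + r) ≤
      K * M ^ ((1 - p / q) * r + 1) := by
    rw [ENNReal.tsum_prod']
    calc ∑' m, ∑' i, (ν (treeBox κ N m i) * (w m ^ (1 / p))⁻¹) ^ (1 + r)
        ≤ ∑' m, ∑' i, (min (u m) M / w m) ^ r * ν (treeBox κ N m i) := by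
          refine ENNReal.tsum_le_tsum fun m => ENNReal.tsum_le_tsum fun i => ?_
          rw [ENNReal.mul_rpow_of_nonneg _ _ (by positivity),
            ENNReal.rpow_add_of_nonneg _ _ zero_le_one hr0.le, ENNReal.rpow_one,
            ← ENNReal.inv_rpow, ← ENNReal.rpow_mul]
          have e : 1 / p * (1 + r) = r := by rw [hr]; field_simp; ring
          rw [e, mul_assoc, ← ENNReal.mul_rpow_of_nonneg _ _ hr0.le, mul_comm, div_eq_mul_inv]
          gcongr
          exact le_min (hu m i) (measure_mono (Set.subset_univ _))
      _ ≤ ∑' m, (min (u m) M / w m) ^ r * M := by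
          refine ENNReal.tsum_le_tsum fun m => ?_
          rw [ENNReal.tsum_mul_left]
          gcongr
          exact tsum_measure_treeBox_le hκ hN ν m
      _ ≤ _ := by
          rw [ENNReal.tsum_mul_right, ENNReal.rpow_add _ _ hM0 hMt, ENNReal.rpow_one, ← mul_assoc]
          gcongr
          exact hK M hM0 hMt
  have h5 : (l * M) ^ q ≤ (A ^ (1 / p) * (K * M ^ ((1 - p / q) * r + 1)) ^ (1 / (1 + r))) ^ q := by
    refine ENNReal.rpow_le_rpow (h1.trans (h2.trans ?_)) hq0.le
    gcongr
  have hM1 : M ^ (q - 1) ≠ 0 := by simp [ENNReal.rpow_eq_zero_iff, hM0, hMt]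
  have hM2 : M ^ (q - 1) ≠ ⊤ := by simp [ENNReal.rpow_eq_top_iff, hM0, hMt]
  rw [ENNReal.mul_rpow_of_nonneg _ _ hq0.le, ENNReal.mul_rpow_of_nonneg _ _ hq0.le,
    ENNReal.mul_rpow_of_nonneg _ _ (by positivity), ENNReal.mul_rpow_of_nonneg _ _ hq0.le,
    ← ENNReal.rpow_mul, ← ENNReal.rpow_mul, ← ENNReal.rpow_mul, ← ENNReal.rpow_mul] at h5
  -- The exponent in `ChainCondition` is chosen so that exactly one power of `M` survives on the
  -- left.
  have e1 : ((1 - p / q) * r + 1) * (q * (p - 1) / p) = q - 1 := by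
    rw [hr]; field_simp; ring
  have e2 : 1 / (1 + r) * q = q * (p - 1) / p := by
    rw [hr]; field_simp; ring
  have e3 : 1 / p * q = q / p := by ring
  have e4 : M ^ q = M * M ^ (q - 1) := by
    nth_rw 2 [← ENNReal.rpow_one M]
    rw [← ENNReal.rpow_add _ _ hM0 hMt]; congr 1; ring
  rw [e2, e3, e1, e4, ← mul_assoc, ← mul_assoc] at h5
  have h6 := (ENNReal.mul_le_mul_iff_left hM1 hM2).1 h5
  rwa [mul_comm (A ^ (q / p))] at h6

/-- Maz'ya's truncation: on the level set where the tree sum lies in `(2^k, 2^(k+1)]`, the weights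
truncated to `(2^(k-1), 2^k]` already sum to `2^(k-1)`, so the weak type bound applies there with
those weights alone. The truncations at different `k` share out each node weight, and since `p ≥ 1`
and `q / p ≥ 1` their contributions add up. -/
lemma tree_strong_type {κ : ℕ → Ω → ℕ} {N : Ω → ℕ} (hκ : ∀ m, Measurable (κ m))
    (hκ' : ∀ m z, κ m z = κ (m + 1) z / 2)
    (hN : Measurable N) {p q : ℝ} (hp : 1 < p) (hpq : p < q) {u w : ℕ → ENNReal}
    (hw : ∀ m, w m ≠ 0) (hw' : ∀ m, w m ≠ ⊤) (hc : ChainCondition p q u w) :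
    ∃ C : NNReal, ∀ (ν : Measure Ω) [IsFiniteMeasure ν], (∀ m i, ν (treeBox κ N m i) ≤ u m) →
      ∀ a : ℕ → ℕ → NNReal, ∫⁻ z, treeSum κ N (fun m i => (a m i : ENNReal)) z ^ q ∂ν ≤
        C * (∑' m, ∑' i, (a m i : ENNReal) ^ p * w m) ^ (q / p) := by
  obtain ⟨K, hK⟩ := hc
  have hp0 : 0 < p := by linarith
  have hq0 : 0 < q := by linarith
  have hKe : 0 ≤ q * (p - 1) / p := by
    have : 0 < p - 1 := by linarith
    positivity
  refine ⟨4 ^ q * K ^ (q * (p - 1) / p), fun ν _ hu a => ?_⟩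
  set S := treeSum κ N (fun m i => (a m i : ENNReal)) with hS
  have hSm : Measurable S := measurable_treeSum hκ hN _
  have hSe : ∀ z, S z = ENNReal.ofReal (nodePrev a (N z) (κ (N z) z) + a (N z) (κ (N z) z)) :=
    fun z => sum_eq_nodePrev_add hκ' a z (N z)
  set E : ℤ → Set Ω := fun k => {z | ENNReal.ofReal (2 ^ k) < S z ∧ S z ≤ ENNReal.ofReal (2 ^ (k + 1))}
    with hE
  have hEm : ∀ k, MeasurableSet (E k) := fun k =>
    (measurableSet_lt measurable_const hSm).inter (measurableSet_le hSm measurable_const)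
  set A : ℤ → ENNReal := fun k => ∑' m, ∑' i, truncNode a k m i ^ p * w m with hA
  have h1 : ∀ z, S z ^ q ≤ ∑' k : ℤ, (E k).indicator (fun _ => ENNReal.ofReal (2 ^ (k + 1)) ^ q) z := by
    intro z
    set x := nodePrev a (N z) (κ (N z) z) + a (N z) (κ (N z) z) with hx
    have hx0 : 0 ≤ x := add_nonneg (nodePrev_nonneg _ _ _) (NNReal.coe_nonneg _)
    rcases hx0.eq_or_lt with h0 | h0
    · rw [hSe, ← hx, ← h0]; simp [hq0]
    · obtain ⟨k, hk⟩ := exists_mem_Ioc_zpow (y := (2 : ℝ)) h0 (by norm_num)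
      have hz : z ∈ E k := by
        simp only [hE, Set.mem_ofPred_eq, hSe, ← hx]
        exact ⟨(ENNReal.ofReal_lt_ofReal_iff h0).2 hk.1, ENNReal.ofReal_le_ofReal hk.2⟩
      refine le_trans ?_ (ENNReal.le_tsum k)
      rw [Set.indicator_of_mem hz]
      exact ENNReal.rpow_le_rpow hz.2 hq0.le
  have h2 : ∀ k, ENNReal.ofReal (2 ^ (k - 1)) ^ q * ν (E k) ≤
      (K : ENNReal) ^ (q * (p - 1) / p) * A k ^ (q / p) := by
    intro k
    have := tree_weak_type hκ hN hp hpq hw hw' hK (ν.restrict (E k))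
      (fun m i => (Measure.restrict_apply_le _ _).trans (hu m i)) (truncNode a k)
      (ENNReal.ofReal (2 ^ (k - 1))) ((ae_restrict_iff' (hEm k)).2 (ae_of_all _ fun z hz => by
        rw [treeSum, sum_truncNode hκ']
        have h3 := hz.1
        rw [hSe, ENNReal.ofReal_lt_ofReal_iff_of_nonneg (by positivity)] at h3
        rw [Set.inter_eq_right.2 (Set.Ioc_subset_Ioc (by positivity) h3.le), Real.volume_Ioc]
        refine ENNReal.ofReal_le_ofReal (le_of_eq ?_)
        rw [zpow_sub_one₀ (by norm_num)]; ring))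
    rwa [Measure.restrict_apply_univ] at this
  have h4 : ∑' k, A k ≤ ∑' m, ∑' i, (a m i : ENNReal) ^ p * w m := by
    simp only [hA]
    rw [ENNReal.tsum_comm]
    refine ENNReal.tsum_le_tsum fun m => ?_
    rw [ENNReal.tsum_comm]
    refine ENNReal.tsum_le_tsum fun i => ?_
    rw [ENNReal.tsum_mul_right]
    gcongr
    exact (tsum_rpow_le_rpow_tsum _ hp.le).trans
      (ENNReal.rpow_le_rpow (tsum_truncNode_le a m i) hp0.le)
  calc ∫⁻ z, S z ^ q ∂ν
      ≤ ∫⁻ z, ∑' k : ℤ, (E k).indicator (fun _ => ENNReal.ofReal (2 ^ (k + 1)) ^ q) z ∂ν :=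
        lintegral_mono h1
    _ = ∑' k : ℤ, ENNReal.ofReal (2 ^ (k + 1)) ^ q * ν (E k) := by
        rw [lintegral_tsum fun k => (measurable_const.indicator (hEm k)).aemeasurable]
        refine tsum_congr fun k => ?_
        rw [lintegral_indicator_const (hEm k)]
    _ = ∑' k : ℤ, 4 ^ q * (ENNReal.ofReal (2 ^ (k - 1)) ^ q * ν (E k)) := by
        refine tsum_congr fun k => ?_
        have : (2 : ℝ) ^ (k + 1) = 4 * 2 ^ (k - 1) := by
          rw [zpow_sub_one₀ (by norm_num), zpow_add_one₀ (by norm_num)]; ring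
        rw [this, ENNReal.ofReal_mul (by norm_num), ENNReal.mul_rpow_of_nonneg _ _ hq0.le, mul_assoc]
        simp
    _ ≤ ∑' k : ℤ, 4 ^ q * ((K : ENNReal) ^ (q * (p - 1) / p) * A k ^ (q / p)) :=
        ENNReal.tsum_le_tsum fun k => mul_le_mul_right (h2 k) _
    _ = 4 ^ q * (K : ENNReal) ^ (q * (p - 1) / p) * ∑' k : ℤ, A k ^ (q / p) := by
        simp only [← mul_assoc, ENNReal.tsum_mul_left]
    _ ≤ 4 ^ q * (K : ENNReal) ^ (q * (p - 1) / p) *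
          (∑' m, ∑' i, (a m i : ENNReal) ^ p * w m) ^ (q / p) := by
        gcongr
        exact (tsum_rpow_le_rpow_tsum _ ((one_le_div hp0).2 hpq.le)).trans
          (ENNReal.rpow_le_rpow h4 (by positivity))
    _ = _ := by
        rw [ENNReal.coe_mul, ENNReal.coe_rpow_of_nonneg _ hq0.le, ENNReal.coe_rpow_of_nonneg _ hKe]
        simp

end Tree

/-! ### The sums over generations -/

lemma exists_tsum_geometric_abs_sub_le {η : ℝ} (h0 : 0 < η) (h1 : η < 1) :
    ∃ K : NNReal, ∀ n : ℤ, ∑' m : ℕ, ENNReal.ofReal (η ^ |(m : ℝ) - n|) ≤ K := by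
  have hs : Summable fun j : ℤ => η ^ |(j : ℝ)| := by
    have hg : Summable fun n : ℕ => η ^ n := summable_geometric_of_lt_one h0.le h1
    refine Summable.of_nat_of_neg ?_ ?_
    · simpa using hg
    · simpa using hg
  refine ⟨(∑' j : ℤ, η ^ |(j : ℝ)|).toNNReal, fun n => ?_⟩
  have hinj : Function.Injective fun m : ℕ => (m : ℤ) - n := fun a b h => by
    simpa using h
  calc ∑' m : ℕ, ENNReal.ofReal (η ^ |(m : ℝ) - n|)
      = ∑' m : ℕ, (fun j : ℤ => ENNReal.ofReal (η ^ |(j : ℝ)|)) ((m : ℤ) - n) := by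
        refine tsum_congr fun m => ?_
        push_cast; rfl
    _ ≤ ∑' j : ℤ, ENNReal.ofReal (η ^ |(j : ℝ)|) :=
        ENNReal.tsum_comp_le_tsum_of_injective hinj _
    _ = _ := by
        rw [← ENNReal.ofReal_tsum_of_nonneg (fun j => by positivity) hs]; rfl

lemma ofReal_div_rpow {a b r : ℝ} (ha : 0 ≤ a) (hb : 0 < b) (hr : 0 ≤ r) :
    (ENNReal.ofReal a / ENNReal.ofReal b) ^ r = ENNReal.ofReal ((a / b) ^ r) := by
  rw [← ENNReal.ofReal_div_of_pos hb, ENNReal.ofReal_rpow_of_nonneg (by positivity) hr]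

lemma half_pow_rpow (m : ℕ) (x : ℝ) : ((1 / 2 : ℝ) ^ m) ^ x = 2 ^ (-((m : ℝ) * x)) := by
  rw [← Real.rpow_natCast, ← Real.rpow_mul (by norm_num), one_div, Real.inv_rpow (by norm_num),
    Real.rpow_neg (by norm_num)]

/-- The two entries of the minimum balance at the generation `τ` where `u = M`. Beyond it `u / w`
decays geometrically, before it `M / w` does so backwards, and the value at `τ` is the required
power of `M`. -/
lemma chainCondition_geometric {p q s : ℝ} (hp : 1 < p) (hpq : p < q) (hs : 0 < s) :
    ChainCondition p q (fun m => ENNReal.ofReal (((1 / 2 : ℝ) ^ m) ^ (q * s)))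
      (fun m => ENNReal.ofReal (((1 / 2 : ℝ) ^ m) ^ (p * s))) := by
  set r := 1 / (p - 1) with hr
  have hp1 : 0 < p - 1 := by linarith
  have hr0 : 0 < r := by positivity
  have hq0 : 0 < q := by linarith
  have hqp : 0 < q - p := by linarith
  set c := s * r * min (q - p) p with hc
  have hc0 : 0 < c := by
    have : 0 < min (q - p) p := lt_min hqp (by linarith)
    positivity
  have hc1 : c ≤ s * r * (q - p) := by
    have := min_le_left (q - p) p
    rw [hc]; gcongr
  have hc2 : c ≤ s * r * p := by
    have := min_le_right (q - p) p
    rw [hc]; gcongr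
  set η : ℝ := 2 ^ (-c) with hη
  have hη0 : 0 < η := by positivity
  have hη1 : η < 1 := Real.rpow_lt_one_of_one_lt_of_neg (by norm_num) (by linarith)
  obtain ⟨K, hK⟩ := exists_tsum_geometric_abs_sub_le hη0 hη1
  refine ⟨K * (2 ^ c : NNReal), fun M hM0 hMt => ?_⟩
  have hx : 0 < M.toReal := ENNReal.toReal_pos hM0 hMt
  set x := M.toReal with hxd
  have hM : M = ENNReal.ofReal x := (ENNReal.ofReal_toReal hMt).symm
  -- `τ` is real, while the two-sided geometric sum is centred at an integer; passing to `⌊τ⌋` costs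
  -- the factor `2 ^ c`.
  set τ := -(Real.logb 2 x) / (s * q) with hτ
  have hxτ : x = 2 ^ (-(s * q * τ)) := by
    have : -(s * q * τ) = Real.logb 2 x := by rw [hτ]; field_simp
    rw [this, Real.rpow_logb (by norm_num) (by norm_num) hx]
  have hn1 := Int.floor_le τ
  have hn2 := Int.lt_floor_add_one τ
  have key : ∀ m : ℕ, (min (ENNReal.ofReal (((1 / 2 : ℝ) ^ m) ^ (q * s))) M /
      ENNReal.ofReal (((1 / 2 : ℝ) ^ m) ^ (p * s))) ^ r ≤
      ENNReal.ofReal (2 ^ (c + -(s * r * (q - p) * τ))) *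
        ENNReal.ofReal (η ^ |(m : ℝ) - (⌊τ⌋ : ℤ)|) := by
    intro m
    rw [← ENNReal.ofReal_mul (by positivity), hη, ← Real.rpow_mul (by norm_num),
      ← Real.rpow_add (by norm_num)]
    rcases le_total τ m with h | h
    · refine (ENNReal.rpow_le_rpow (ENNReal.div_le_div_right (min_le_left _ _) _) hr0.le).trans ?_
      rw [ofReal_div_rpow (by positivity) (by positivity) hr0.le, half_pow_rpow, half_pow_rpow,
        ← Real.rpow_sub (by norm_num), ← Real.rpow_mul (by norm_num)]
      refine ENNReal.ofReal_le_ofReal (Real.rpow_le_rpow_of_exponent_le (by norm_num) ?_)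
      rw [abs_of_nonneg (by linarith)]
      have h1 : c * ((m : ℝ) - ⌊τ⌋) ≤ c * ((m : ℝ) - τ + 1) := by gcongr; linarith
      have h2 : c * ((m : ℝ) - τ) ≤ s * r * (q - p) * ((m : ℝ) - τ) := by
        have : 0 ≤ (m : ℝ) - τ := by linarith
        gcongr
      linarith
    · refine (ENNReal.rpow_le_rpow (ENNReal.div_le_div_right (min_le_right _ _) _) hr0.le).trans ?_
      rw [hM, ofReal_div_rpow hx.le (by positivity) hr0.le, half_pow_rpow, hxτ,
        ← Real.rpow_sub (by norm_num), ← Real.rpow_mul (by norm_num)]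
      refine ENNReal.ofReal_le_ofReal (Real.rpow_le_rpow_of_exponent_le (by norm_num) ?_)
      have hm : (m : ℤ) ≤ ⌊τ⌋ := Int.le_floor.2 (by exact_mod_cast h)
      have hm' : (m : ℝ) ≤ (⌊τ⌋ : ℤ) := by exact_mod_cast hm
      rw [abs_of_nonpos (by linarith)]
      have h1 : c * -((m : ℝ) - ⌊τ⌋) ≤ c * (τ - m) := by gcongr; linarith
      have h2 : c * (τ - m) ≤ s * r * p * (τ - m) := by
        have : 0 ≤ τ - (m : ℝ) := by linarith
        gcongr
      linarith
  refine (ENNReal.tsum_le_tsum key).trans ?_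
  rw [ENNReal.tsum_mul_left]
  have e1 : M ^ ((1 - p / q) * r) = ENNReal.ofReal (2 ^ (-(s * r * (q - p) * τ))) := by
    rw [hM, ENNReal.ofReal_rpow_of_pos hx, hxτ, ← Real.rpow_mul (by norm_num)]
    congr 2; field_simp
  have e2 : ((K * 2 ^ c : NNReal) : ENNReal) = K * ENNReal.ofReal (2 ^ c) := by
    rw [ENNReal.coe_mul, ← ENNReal.ofReal_rpow_of_pos (by norm_num),
      ENNReal.coe_rpow_of_nonneg _ hc0.le]
    simp
  rw [e1, e2, Real.rpow_add (by norm_num), ENNReal.ofReal_mul (by positivity)]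
  calc _ ≤ ENNReal.ofReal (2 ^ c) * ENNReal.ofReal (2 ^ (-(s * r * (q - p) * τ))) * K := by
        gcongr
        exact hK _
    _ = _ := by ring

/-- Comparison with the integral of `max x T ^ (-e)` over the half-line: the part up to `T` gives `T
^ (1 - e)`, the tail gives the same divided by `e - 1`. -/
lemma tsum_min_rpow_le {e : ℝ} (he : 1 < e) {T : ℝ} (hT : 0 < T) :
    ∑' m : ℕ, ENNReal.ofReal (max ((m : ℝ) + 1) T ^ (-e)) ≤
      ENNReal.ofReal ((1 + 1 / (e - 1)) * T ^ (1 - e)) := by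
  have he1 : 0 < e - 1 := by linarith
  set φ : ℝ → ENNReal := fun x => ENNReal.ofReal (max x T ^ (-e)) with hφ
  calc ∑' m : ℕ, ENNReal.ofReal (max ((m : ℝ) + 1) T ^ (-e))
      ≤ ∑' m : ℕ, ∫⁻ x in Set.Ioc (m : ℝ) (m + 1), φ x := by
        refine ENNReal.tsum_le_tsum fun m => ?_
        calc ENNReal.ofReal (max ((m : ℝ) + 1) T ^ (-e))
            = ∫⁻ x in Set.Ioc (m : ℝ) (m + 1), ENNReal.ofReal (max ((m : ℝ) + 1) T ^ (-e)) := by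
              rw [setLIntegral_const, Real.volume_Ioc]; simp
          _ ≤ _ := by
              refine setLIntegral_mono_ae' measurableSet_Ioc (ae_of_all _ fun x hx => ?_)
              refine ENNReal.ofReal_le_ofReal ?_
              refine Real.rpow_le_rpow_of_nonpos (lt_max_of_lt_right hT) ?_ (by linarith)
              exact max_le_max hx.2 le_rfl
    _ = ∫⁻ x in ⋃ m : ℕ, Set.Ioc (m : ℝ) (m + 1), φ x := by
        refine (lintegral_iUnion (fun m => measurableSet_Ioc) ?_ _).symm
        intro i j hij
        refine Set.disjoint_left.2 fun x hx hx' => hij ?_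
        have h1 : (i : ℝ) < j + 1 := hx.1.trans_le hx'.2
        have h2 : (j : ℝ) < i + 1 := hx'.1.trans_le hx.2
        have h1' : i < j + 1 := by exact_mod_cast h1
        have h2' : j < i + 1 := by exact_mod_cast h2
        omega
    _ ≤ ∫⁻ x in Set.Ioc 0 T ∪ Set.Ioi T, φ x := by
        refine lintegral_mono_set (Set.iUnion_subset fun m x hx => ?_)
        have : 0 < x := (Nat.cast_nonneg m).trans_lt hx.1
        rcases le_or_gt x T with h | h
        · exact Or.inl ⟨this, h⟩
        · exact Or.inr h
    _ ≤ (∫⁻ x in Set.Ioc 0 T, φ x) + ∫⁻ x in Set.Ioi T, φ x := lintegral_union_le _ _ _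
    _ = ENNReal.ofReal (T ^ (1 - e)) + ENNReal.ofReal (1 / (e - 1) * T ^ (1 - e)) := by
        congr 1
        · calc ∫⁻ x in Set.Ioc 0 T, φ x = ∫⁻ x in Set.Ioc 0 T, ENNReal.ofReal (T ^ (-e)) := by
                refine setLIntegral_congr_fun measurableSet_Ioc fun x hx => ?_
                simp only [hφ, max_eq_right hx.2]
            _ = _ := by
                rw [setLIntegral_const, Real.volume_Ioc, ← ENNReal.ofReal_mul (by positivity), sub_zero,
                  ← Real.rpow_add_one hT.ne']
                congr 2; ring
        · calc ∫⁻ x in Set.Ioi T, φ x = ∫⁻ x in Set.Ioi T, ENNReal.ofReal (x ^ (-e)) := by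
                refine setLIntegral_congr_fun measurableSet_Ioi fun x hx => ?_
                simp only [hφ, max_eq_left (le_of_lt (Set.mem_Ioi.1 hx))]
            _ = _ := by
                rw [← ofReal_integral_eq_lintegral_ofReal
                  (integrableOn_Ioi_rpow_of_lt (by linarith) hT)
                  ((ae_restrict_iff' measurableSet_Ioi).2 (ae_of_all _ fun x hx => by
                    have : 0 < x := hT.trans hx
                    simp only [Pi.zero_apply]; positivity)),
                  integral_Ioi_rpow_of_lt (by linarith) hT]
                congr 1
                rw [show -e + 1 = -(e - 1) by ring, show (1 : ℝ) - e = -(e - 1) by ring]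
                field_simp
    _ = _ := by
        rw [← ENNReal.ofReal_add (by positivity) (by positivity)]; congr 1; ring

/-- After raising to the power `1 / (p - 1)` the box weights become `(m + 1)^(-q/p)`, a convergent
series because `q > p`; the cap by `M` freezes it below the generation `T`. -/
lemma chainCondition_harmonic {p q : ℝ} (hp : 1 < p) (hpq : p < q) :
    ChainCondition p q (fun m => ENNReal.ofReal (((m : ℝ) + 1) ^ (-(q * (p - 1) / p))))
      (fun _ => 1) := by
  have hp1 : 0 < p - 1 := by linarith
  have hp0 : 0 < p := by linarith
  have hq0 : 0 < q := by linarith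
  set e := q / p with he
  have he1 : 1 < e := (one_lt_div hp0).2 hpq
  refine ⟨(1 + 1 / (e - 1)).toNNReal, fun M hM0 hMt => ?_⟩
  have hMr : 0 < M.toReal := ENNReal.toReal_pos hM0 hMt
  set T := M.toReal ^ (-(1 / (p - 1) / e)) with hT
  have hT0 : 0 < T := by positivity
  have he' : 0 < 1 + 1 / (e - 1) := by
    have : 0 < e - 1 := by linarith
    positivity
  calc ∑' m : ℕ, (min (ENNReal.ofReal (((m : ℝ) + 1) ^ (-(q * (p - 1) / p)))) M / 1) ^ (1 / (p - 1))
      ≤ ∑' m : ℕ, ENNReal.ofReal (max ((m : ℝ) + 1) T ^ (-e)) := by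
        refine ENNReal.tsum_le_tsum fun m => ?_
        rw [div_one]
        rcases le_total ((m : ℝ) + 1) T with h | h
        · rw [max_eq_right h]
          refine (ENNReal.rpow_le_rpow (min_le_right _ _) (by positivity)).trans (le_of_eq ?_)
          rw [← ENNReal.ofReal_toReal hMt, ENNReal.ofReal_rpow_of_nonneg hMr.le (by positivity), hT,
            ← Real.rpow_mul hMr.le]
          congr 2; field_simp
        · rw [max_eq_left h]
          refine (ENNReal.rpow_le_rpow (min_le_left _ _) (by positivity)).trans (le_of_eq ?_)
          rw [ENNReal.ofReal_rpow_of_nonneg (by positivity) (by positivity),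
            ← Real.rpow_mul (by positivity)]
          congr 2; rw [he]; field_simp
    _ ≤ ENNReal.ofReal ((1 + 1 / (e - 1)) * T ^ (1 - e)) := tsum_min_rpow_le he1 hT0
    _ = _ := by
        rw [ENNReal.ofReal_mul he'.le]
        congr 1
        rw [← ENNReal.ofReal_toReal hMt]
        rw [ENNReal.ofReal_rpow_of_pos hMr, hT, ← Real.rpow_mul hMr.le]
        congr 2
        rw [he]; field_simp; ring

/-! ### The three tree embeddings -/

section Embedding

variable {Ω : Type*} [MeasurableSpace Ω]

/-- The embedding inequality on a tree, with node weights `w` and box weights `u`. -/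
def TreeEmbedding (κ : ℕ → Ω → ℕ) (N : Ω → ℕ) (p q : ℝ) (u w : ℕ → ENNReal) : Prop :=
  ∃ C : NNReal, ∀ (ν : Measure Ω) [IsFiniteMeasure ν], (∀ m i, ν (treeBox κ N m i) ≤ u m) →
    ∀ a : ℕ → ℕ → NNReal, ∫⁻ z, treeSum κ N (fun m i => (a m i : ENNReal)) z ^ q ∂ν ≤
      C * (∑' m, ∑' i, (a m i : ENNReal) ^ p * w m) ^ (q / p)

/-- Both sides respond linearly to `ν`, so the embedding is applied to `ε⁻¹ • ν`. The gain of `ε` is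
what turns a boundedness statement into a compactness statement. -/
lemma TreeEmbedding.scaled {κ : ℕ → Ω → ℕ} {N : Ω → ℕ} {p q : ℝ} {u w : ℕ → ENNReal}
    (h : TreeEmbedding κ N p q u w) : ∃ C : NNReal, ∀ (ν : Measure Ω) [IsFiniteMeasure ν]
    (ε : NNReal), ε ≠ 0 → (∀ m i, ν (treeBox κ N m i) ≤ ε * u m) →
    ∀ a : ℕ → ℕ → NNReal, ∫⁻ z, treeSum κ N (fun m i => (a m i : ENNReal)) z ^ q ∂ν ≤
      ε * C * (∑' m, ∑' i, (a m i : ENNReal) ^ p * w m) ^ (q / p) := by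
  obtain ⟨C, hC⟩ := h
  refine ⟨C, fun ν _ ε hε hν a => ?_⟩
  have hε' : (ε : ENNReal) ≠ 0 := by simpa using hε
  have := hC (ε⁻¹ • ν) (fun m i => by
    rw [Measure.smul_apply, ENNReal.smul_def, smul_eq_mul, ENNReal.coe_inv hε]
    refine (mul_le_mul_right (hν m i) _).trans (le_of_eq ?_)
    rw [← mul_assoc, ENNReal.inv_mul_cancel hε' ENNReal.coe_ne_top, one_mul]) a
  rw [lintegral_smul_measure, ENNReal.smul_def, smul_eq_mul, ENNReal.coe_inv hε] at this
  rw [mul_assoc]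
  refine le_trans (le_of_eq ?_) (mul_le_mul_right this _)
  rw [← mul_assoc, ENNReal.mul_inv_cancel hε' ENNReal.coe_ne_top, one_mul]

variable {κ : ℕ → Ω → ℕ} {N : Ω → ℕ}

/-- The truncation argument requires an exponent above one. With geometric weights the `ℓ^y` sums
decrease in strength as `y` grows, so `p` may be raised. If `q ≤ 1`, the power `q` of the tree sum
is subadditive and `p` can be raised to `q` itself. -/
lemma treeEmbedding_of_pos (hκ : ∀ m, Measurable (κ m))
    (hκ' : ∀ m z, κ m z = κ (m + 1) z / 2) (hN : Measurable N) {p q s : ℝ} (hp : 0 < p)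
    (hpq : p < q) (hs : 0 < s) :
    TreeEmbedding κ N p q (fun m => ENNReal.ofReal (((1 / 2 : ℝ) ^ m) ^ (q * s)))
      (fun m => ENNReal.ofReal (((1 / 2 : ℝ) ^ m) ^ (p * s))) := by
  have hq : 0 < q := hp.trans hpq
  have hpow : ∀ (m : ℕ) (x y : ℝ), 0 < x → 0 < y →
      ENNReal.ofReal (((1 / 2 : ℝ) ^ m) ^ (x * s)) ^ (y / x) =
        ENNReal.ofReal (((1 / 2 : ℝ) ^ m) ^ (y * s)) := by
    intro m x y hx hy
    rw [ENNReal.ofReal_rpow_of_nonneg (by positivity) (by positivity), ← Real.rpow_mul (by positivity)]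
    congr 2; field_simp
  have hterm : ∀ (m i : ℕ) (a : ℕ → ℕ → NNReal) (y : ℝ), 0 < y →
      (a m i : ENNReal) ^ y * ENNReal.ofReal (((1 / 2 : ℝ) ^ m) ^ (y * s)) =
      ((a m i : ENNReal) ^ p * ENNReal.ofReal (((1 / 2 : ℝ) ^ m) ^ (p * s))) ^ (y / p) := by
    intro m i a y hy
    rw [ENNReal.mul_rpow_of_nonneg _ _ (by positivity), hpow m p y hp hy, ← ENNReal.rpow_mul]
    congr 2; field_simp
  have hsum : ∀ (a : ℕ → ℕ → NNReal) (y : ℝ), p ≤ y →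
      ∑' m, ∑' i, (a m i : ENNReal) ^ y * ENNReal.ofReal (((1 / 2 : ℝ) ^ m) ^ (y * s)) ≤
      (∑' m, ∑' i, (a m i : ENNReal) ^ p * ENNReal.ofReal (((1 / 2 : ℝ) ^ m) ^ (p * s))) ^ (y / p) := by
    intro a y hy
    simp only [hterm _ _ a y (hp.trans_le hy)]
    rw [← ENNReal.tsum_prod (f := fun m i => ((a m i : ENNReal) ^ p *
      ENNReal.ofReal (((1 / 2 : ℝ) ^ m) ^ (p * s))) ^ (y / p)),
      ← ENNReal.tsum_prod (f := fun m i => ((a m i : ENNReal) ^ p *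
      ENNReal.ofReal (((1 / 2 : ℝ) ^ m) ^ (p * s))))]
    exact tsum_rpow_le_rpow_tsum _ ((one_le_div hp).2 hy)
  rcases le_or_gt q 1 with hq1 | hq1
  · refine ⟨1, fun ν _ hν a => ?_⟩
    have h1 : ∀ z, treeSum κ N (fun m i => (a m i : ENNReal)) z ^ q ≤
        treeSum κ N (fun m i => (a m i : ENNReal) ^ q) z := by
      intro z
      have h2 := tsum_rpow_le_rpow_tsum
        (fun m : Finset.range (N z + 1) => (a m (κ m z) : ENNReal) ^ q) (e := 1 / q)
        ((one_le_div hq).2 hq1)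
      simp only [← ENNReal.rpow_mul, mul_one_div_cancel hq.ne', ENNReal.rpow_one] at h2
      rw [tsum_fintype, tsum_fintype,
        Finset.sum_coe_sort (Finset.range (N z + 1)) (fun m => (a m (κ m z) : ENNReal)),
        Finset.sum_coe_sort (Finset.range (N z + 1)) (fun m => (a m (κ m z) : ENNReal) ^ q)] at h2
      have h3 := ENNReal.rpow_le_rpow h2 hq.le
      rwa [← ENNReal.rpow_mul, one_div_mul_cancel hq.ne', ENNReal.rpow_one] at h3
    refine (lintegral_mono h1).trans ?_
    rw [lintegral_treeSum hκ hN, ENNReal.coe_one, one_mul]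
    refine le_trans ?_ (hsum a q hpq.le)
    exact ENNReal.tsum_le_tsum fun m => ENNReal.tsum_le_tsum fun i => mul_le_mul_right (hν m i) _
  -- Any exponent with `p ≤ y`, `1 < y < q` would do.
  · set y := max p ((1 + q) / 2) with hy
    have hy1 : 1 < y := lt_max_of_lt_right (by linarith)
    have hyq : y < q := max_lt hpq (by linarith)
    have hpy : p ≤ y := le_max_left _ _
    obtain ⟨C, hC⟩ := tree_strong_type hκ hκ' hN hy1 hyq
      (fun m => by simp only [ne_eq, ENNReal.ofReal_eq_zero, not_le]; positivity)
      (fun m => ENNReal.ofReal_ne_top) (chainCondition_geometric hy1 hyq hs)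
    refine ⟨C, fun ν _ hν a => (hC ν hν a).trans ?_⟩
    gcongr
    refine (ENNReal.rpow_le_rpow (hsum a y hpy) (by positivity)).trans (le_of_eq ?_)
    rw [← ENNReal.rpow_mul]
    congr 1
    have : 0 < y := hp.trans_le hpy
    field_simp

lemma treeEmbedding_critical (hκ : ∀ m, Measurable (κ m))
    (hκ' : ∀ m z, κ m z = κ (m + 1) z / 2) (hN : Measurable N) {p q : ℝ} (hp : 1 < p)
    (hpq : p < q) :
    TreeEmbedding κ N p q (fun m => ENNReal.ofReal (((m : ℝ) + 1) ^ (-(q * (p - 1) / p))))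
      (fun _ => 1) :=
  tree_strong_type hκ hκ' hN hp hpq (fun _ => one_ne_zero) (fun _ => ENNReal.one_ne_top)
    (chainCondition_harmonic hp hpq)

/-- Growing weights force the node values to decay geometrically, so the tree sum is uniformly
bounded and only the total mass of `ν`, the mass of the root box, matters. -/
lemma treeEmbedding_of_neg (hκ0 : ∀ z, κ 0 z = 0) {p q σ : ℝ} (hp : 0 < p) (hq : 0 < q)
    (hσ : 0 < σ) :
    TreeEmbedding κ N p q (fun _ => 1)
      (fun m => ENNReal.ofReal (((1 / 2 : ℝ) ^ m) ^ (-(p * σ)))) := by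
  set ρ : ℝ := (1 / 2) ^ σ with hρ
  have hρ0 : 0 < ρ := by positivity
  have hρ1 : ρ < 1 := Real.rpow_lt_one (by norm_num) (by norm_num) hσ
  have hρm : ∀ m : ℕ, ((1 / 2 : ℝ) ^ m) ^ σ = ρ ^ m := by
    intro m
    rw [hρ, ← Real.rpow_natCast, ← Real.rpow_natCast, ← Real.rpow_mul (by norm_num),
      ← Real.rpow_mul (by norm_num), mul_comm]
  have hsum : Summable fun m : ℕ => ρ ^ m := summable_geometric_of_lt_one hρ0.le hρ1
  set D := ∑' m : ℕ, ρ ^ m with hD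
  refine ⟨D.toNNReal ^ q, fun ν _ hν a => ?_⟩
  set A := ∑' m, ∑' i, (a m i : ENNReal) ^ p *
    ENNReal.ofReal (((1 / 2 : ℝ) ^ m) ^ (-(p * σ))) with hA
  have hnode : ∀ m i, (a m i : ENNReal) ≤ A ^ (1 / p) * ENNReal.ofReal (ρ ^ m) := by
    intro m i
    have h1 : (a m i : ENNReal) ^ p * ENNReal.ofReal (((1 / 2 : ℝ) ^ m) ^ (-(p * σ))) ≤ A :=
      (ENNReal.le_tsum (f := fun i => (a m i : ENNReal) ^ p *
        ENNReal.ofReal (((1 / 2 : ℝ) ^ m) ^ (-(p * σ)))) i).trans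
        (ENNReal.le_tsum (f := fun m => ∑' i, (a m i : ENNReal) ^ p *
          ENNReal.ofReal (((1 / 2 : ℝ) ^ m) ^ (-(p * σ)))) m)
    have h2 := ENNReal.rpow_le_rpow h1 (show 0 ≤ 1 / p by positivity)
    rw [ENNReal.mul_rpow_of_nonneg _ _ (by positivity), ← ENNReal.rpow_mul,
      mul_one_div_cancel hp.ne', ENNReal.rpow_one,
      ENNReal.ofReal_rpow_of_nonneg (by positivity) (by positivity),
      ← Real.rpow_mul (by positivity), show -(p * σ) * (1 / p) = -σ by field_simp,
      Real.rpow_neg (by positivity), hρm] at h2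
    calc (a m i : ENNReal) = a m i * (ENNReal.ofReal (ρ ^ m)⁻¹ * ENNReal.ofReal (ρ ^ m)) := by
          rw [← ENNReal.ofReal_mul (by positivity), inv_mul_cancel₀ (by positivity)]; simp
      _ = a m i * ENNReal.ofReal (ρ ^ m)⁻¹ * ENNReal.ofReal (ρ ^ m) := by ring
      _ ≤ _ := by gcongr
  have htree : ∀ z, treeSum κ N (fun m i => (a m i : ENNReal)) z ≤ A ^ (1 / p) * D.toNNReal := by
    intro z
    calc treeSum κ N (fun m i => (a m i : ENNReal)) z
        ≤ ∑ m ∈ Finset.range (N z + 1), A ^ (1 / p) * ENNReal.ofReal (ρ ^ m) :=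
          Finset.sum_le_sum fun m _ => hnode m _
      _ ≤ ∑' m, A ^ (1 / p) * ENNReal.ofReal (ρ ^ m) := ENNReal.sum_le_tsum _
      _ = _ := by
        rw [ENNReal.tsum_mul_left, ← ENNReal.ofReal_tsum_of_nonneg (fun _ => by positivity) hsum]
        rfl
  have huniv : ν Set.univ ≤ 1 := by
    refine (measure_mono fun z _ => ?_).trans (hν 0 0)
    exact ⟨Nat.zero_le _, hκ0 z⟩
  calc ∫⁻ z, treeSum κ N (fun m i => (a m i : ENNReal)) z ^ q ∂ν
      ≤ ∫⁻ _, (A ^ (1 / p) * D.toNNReal) ^ q ∂ν :=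
        lintegral_mono fun z => ENNReal.rpow_le_rpow (htree z) hq.le
    _ ≤ (A ^ (1 / p) * D.toNNReal) ^ q * 1 := by
        rw [lintegral_const]; gcongr
    _ = _ := by
        rw [mul_one, ENNReal.mul_rpow_of_nonneg _ _ hq.le, ← ENNReal.rpow_mul,
          ENNReal.coe_rpow_of_nonneg _ hq.le, mul_comm]
        congr 2; ring

end Embedding

/-! ### Dyadic geometry of the disk and Whitney boxes -/

/-- The argument of `z`, normalized to `[0, 1)`. -/
def angleFrac (z : ℂ) : ℝ := Int.fract (z.arg / (2 * Real.pi))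

/-- The index of the dyadic arc of generation `m` that contains `z / |z|`. -/
def branch (m : ℕ) (z : ℂ) : ℕ := ⌊2 ^ m * angleFrac z⌋₊

/-- The generation of the Whitney box that contains `z`. -/
def level (z : ℂ) : ℕ := ⌊-Real.logb 2 (1 - ‖z‖)⌋₊

lemma angleFrac_nonneg (z : ℂ) : 0 ≤ angleFrac z := Int.fract_nonneg _

lemma angleFrac_lt_one (z : ℂ) : angleFrac z < 1 := Int.fract_lt_one _

lemma measurable_angleFrac : Measurable angleFrac :=
  measurable_fract.comp (Complex.measurable_arg.div_const _)

lemma measurable_branch (m : ℕ) : Measurable (branch m) :=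
  Nat.measurable_floor.comp (measurable_angleFrac.const_mul _)

lemma measurable_level : Measurable level := by
  refine Nat.measurable_floor.comp (Measurable.neg ?_)
  unfold Real.logb
  exact (Real.measurable_log.comp (by fun_prop)).div_const _

lemma branch_succ (m : ℕ) (z : ℂ) : branch m z = branch (m + 1) z / 2 := by
  have := Nat.floor_div_natCast (2 ^ (m + 1) * angleFrac z) 2
  rw [branch, branch, ← this]
  congr 1
  push_cast
  ring

lemma branch_zero (z : ℂ) : branch 0 z = 0 := by
  simp [branch, angleFrac_lt_one]

lemma branch_le (m : ℕ) (z : ℂ) : (branch m z : ℝ) * (1 / 2) ^ m ≤ angleFrac z := by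
  have h := Nat.floor_le (show 0 ≤ 2 ^ m * angleFrac z by
    have := angleFrac_nonneg z; positivity)
  rw [one_div, inv_pow, ← div_eq_mul_inv, div_le_iff₀ (by positivity), mul_comm (angleFrac z)]
  exact h

lemma lt_branch (m : ℕ) (z : ℂ) : angleFrac z < ((branch m z : ℝ) + 1) * (1 / 2) ^ m := by
  have h := Nat.lt_floor_add_one (2 ^ m * angleFrac z)
  rw [one_div, inv_pow, ← div_eq_mul_inv, lt_div_iff₀ (by positivity), mul_comm (angleFrac z)]
  exact h

lemma branch_lt (m : ℕ) (z : ℂ) : branch m z < 2 ^ m := by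
  rw [branch, Nat.floor_lt (by have := angleFrac_nonneg z; positivity)]
  have := angleFrac_lt_one z
  push_cast
  exact mul_lt_of_lt_one_right (by positivity) this

lemma angleFrac_real_mul {t : ℝ} (ht : 0 < t) (z : ℂ) : angleFrac (t * z) = angleFrac z := by
  rw [angleFrac, angleFrac, Complex.arg_real_mul _ ht]

lemma norm_mul_exp_angleFrac (z : ℂ) :
    (‖z‖ : ℂ) * Complex.exp ((2 * Real.pi * angleFrac z : ℝ) * Complex.I) = z := by
  nth_rw 3 [← Complex.norm_mul_exp_arg_mul_I z]
  congr 1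
  rw [angleFrac, Int.fract]
  have h : ((2 * Real.pi * (z.arg / (2 * Real.pi) - ⌊z.arg / (2 * Real.pi)⌋) : ℝ) : ℂ) * Complex.I =
      (z.arg : ℂ) * Complex.I - (⌊z.arg / (2 * Real.pi)⌋ : ℂ) * (2 * Real.pi * Complex.I) := by
    rw [mul_sub, mul_div_cancel₀ _ (by positivity)]
    push_cast
    ring
  rw [h, Complex.exp_sub, Complex.exp_int_mul_two_pi_mul_I, div_one]

lemma le_level_iff {z : ℂ} (hz : z ∈ disk) (m : ℕ) : m ≤ level z ↔ 1 - ‖z‖ ≤ (1 / 2) ^ m := by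
  have h0 := one_sub_pos hz
  have h1 : 0 ≤ -Real.logb 2 (1 - ‖z‖) := by
    have := Real.logb_nonpos (b := 2) (by norm_num) h0.le (by linarith [norm_nonneg z])
    linarith
  rw [level, Nat.le_floor_iff h1, le_neg, Real.logb_le_iff_le_rpow (by norm_num) h0,
    Real.rpow_neg (by norm_num), Real.rpow_natCast, one_div, inv_pow]

lemma lt_of_level {z : ℂ} (hz : z ∈ disk) : (1 / 2) ^ (level z + 1) < 1 - ‖z‖ := by
  by_contra h
  rw [not_lt, ← le_level_iff hz] at h
  omega

/-- Links the combinatorial tree with the Carleson squares: the box of a node is contained in the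
square over the corresponding dyadic arc. -/
lemma mem_carlesonSquare_of_mem_treeBox {m i : ℕ} {z : ℂ} (hz : z ∈ disk)
    (h : z ∈ treeBox branch level m i) (I : Arc)
    (hI : I.start = 2 * Real.pi * (i * (1 / 2) ^ m)) (hl : I.length = (1 / 2) ^ m) :
    z ∈ carlesonSquare I := by
  obtain ⟨h1, rfl⟩ := h
  refine ⟨‖z‖, _, ⟨2 * Real.pi * angleFrac z, ⟨?_, ?_⟩, rfl⟩, ?_, mem_disk.1 hz,
    (norm_mul_exp_angleFrac z).symm⟩
  · rw [hI]
    have := branch_le m z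
    gcongr
  · rw [hI, hl, ← mul_add]
    have := lt_branch m z
    have : angleFrac z ≤ branch m z * (1 / 2) ^ m + (1 / 2) ^ m := by linarith
    gcongr
  · rw [hl]
    have := (le_level_iff hz m).1 h1
    linarith

/-- The Whitney box of the node `(m, i)`. -/
def whitneyBox (m i : ℕ) : Set ℂ :=
  {w | w ∈ disk ∧ (1 / 2) ^ (m + 1) ≤ 1 - ‖w‖ ∧ 1 - ‖w‖ ≤ (1 / 2) ^ m ∧ branch m w = i}

/-- Jordan's inequality, applied on `[0, 1/2]` and, after reflection, on `[1/2, 1]`. -/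
lemma two_mul_le_sin {t y : ℝ} (h0 : 0 ≤ t) (h1 : t ≤ y) (h2 : y ≤ 1 - t) :
    2 * t ≤ Real.sin (Real.pi * y) := by
  have hpi := Real.pi_pos
  rcases le_total y (1 / 2) with h | h
  · have := Real.mul_le_sin (x := Real.pi * y) (by nlinarith) (by nlinarith)
    have e : 2 / Real.pi * (Real.pi * y) = 2 * y := by field_simp
    linarith
  · have := Real.mul_le_sin (x := Real.pi * (1 - y)) (by nlinarith) (by nlinarith)
    have e : 2 / Real.pi * (Real.pi * (1 - y)) = 2 * (1 - y) := by field_simp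
    have e2 : Real.sin (Real.pi * (1 - y)) = Real.sin (Real.pi * y) := by
      rw [mul_sub, mul_one, Real.sin_pi_sub]
    linarith

lemma norm_sub_sq_polar (r s x y : ℝ) :
    ‖(r : ℂ) * Complex.exp ((2 * Real.pi * x : ℝ) * Complex.I) -
      s * Complex.exp ((2 * Real.pi * y : ℝ) * Complex.I)‖ ^ 2 =
    (r - s) ^ 2 + 4 * r * s * Real.sin (Real.pi * (x - y)) ^ 2 := by
  have hc : Real.cos (2 * Real.pi * x - 2 * Real.pi * y) =
      1 - 2 * Real.sin (Real.pi * (x - y)) ^ 2 := by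
    rw [show 2 * Real.pi * x - 2 * Real.pi * y = 2 * (Real.pi * (x - y)) by ring,
      Real.cos_two_mul, Real.cos_sq']
    ring
  rw [Real.cos_sub] at hc
  rw [← Complex.normSq_eq_norm_sq, Complex.normSq_apply]
  simp only [Complex.sub_re, Complex.sub_im, Complex.re_ofReal_mul, Complex.im_ofReal_mul,
    Complex.exp_ofReal_mul_I_re, Complex.exp_ofReal_mul_I_im]
  linear_combination r ^ 2 * Real.sin_sq_add_cos_sq (2 * Real.pi * x) +
    s ^ 2 * Real.sin_sq_add_cos_sq (2 * Real.pi * y) - 2 * r * s * hc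

/-- Indices of equal parity leave a whole arc between the boxes, and the chord formula turns this
angular gap into a distance. -/
lemma dist_whitneyBox {m i j : ℕ} {w v : ℂ} (hw : w ∈ whitneyBox m i) (hv : v ∈ whitneyBox m j)
    (hij : i ≠ j) (hpar : i % 2 = j % 2) : (1 / 2 : ℝ) ^ m ≤ dist w v := by
  rcases Nat.eq_zero_or_pos m with rfl | hm
  · exact absurd (hw.2.2.2.symm.trans ((branch_zero w).trans ((branch_zero v).symm.trans hv.2.2.2))) hij
  wlog hlt : j < i generalizing i j w v
  · rw [dist_comm]
    exact this hv hw hij.symm hpar.symm (by omega)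
  obtain ⟨-, -, hw2, rfl⟩ := hw
  obtain ⟨-, -, hv2, rfl⟩ := hv
  set t : ℝ := (1 / 2) ^ m with ht
  have ht0 : 0 < t := by positivity
  have ht1 : t ≤ 1 / 2 := by
    rw [ht]
    calc (1 / 2 : ℝ) ^ m ≤ (1 / 2) ^ 1 := pow_le_pow_of_le_one (by norm_num) (by norm_num) hm
      _ = _ := by norm_num
  have h2t : (2 : ℝ) ^ m * t = 1 := by
    rw [ht, ← mul_pow]; norm_num
  have hwl := branch_lt m w
  -- Since the number of arcs is even, the gap also exists across the angle zero, where the last arc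
  -- meets the first.
  have hev : 2 ^ m % 2 = 0 := by
    obtain ⟨k, rfl⟩ := Nat.exists_eq_add_of_lt hm
    simp [pow_succ]
  have hn1 : branch m v + 2 ≤ branch m w := by omega
  have hn2 : branch m w + 2 ≤ branch m v + 2 ^ m := by omega
  have hr1 : (branch m v : ℝ) + 2 ≤ branch m w := by exact_mod_cast hn1
  have hr2 : (branch m w : ℝ) + 2 ≤ branch m v + 2 ^ m := by exact_mod_cast hn2
  have a1 := branch_le m w
  have a2 := lt_branch m w
  have a3 := branch_le m v
  have a4 := lt_branch m v
  rw [← ht] at a1 a2 a3 a4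
  have hs := two_mul_le_sin (t := t) (y := angleFrac w - angleFrac v) ht0.le
    (by nlinarith) (by nlinarith)
  have key := norm_sub_sq_polar ‖w‖ ‖v‖ (angleFrac w) (angleFrac v)
  rw [norm_mul_exp_angleFrac, norm_mul_exp_angleFrac] at key
  rw [dist_eq_norm]
  refine le_of_sq_le_sq ?_ (norm_nonneg _)
  rw [key]
  have h1 : 1 / 2 ≤ ‖w‖ := by linarith
  have h2 : 1 / 2 ≤ ‖v‖ := by linarith
  have h3 : 1 / 4 ≤ ‖w‖ * ‖v‖ := by nlinarith
  have h4 : (2 * t) ^ 2 ≤ Real.sin (Real.pi * (angleFrac w - angleFrac v)) ^ 2 := by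
    gcongr
  have h5 := sq_nonneg (‖w‖ - ‖v‖)
  nlinarith [mul_le_mul h3 h4 (by positivity) (by positivity)]

/-- Node weights that dominate the increments of `f` along radii. -/
def whitneyWeight (f : ℂ → ℂ) (m i : ℕ) : NNReal :=
  (1 / 2) ^ m * ⨆ w : whitneyBox m i, ‖deriv f w‖₊

lemma bddAbove_whitney {f : ℂ → ℂ} (hf : DifferentiableOn ℂ f disk) (m i : ℕ) :
    BddAbove (Set.range fun w : whitneyBox m i => ‖deriv f w‖₊) := by
  have hlt : 1 - (1 / 2 : ℝ) ^ (m + 1) < 1 := by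
    have : (0 : ℝ) < (1 / 2) ^ (m + 1) := by positivity
    linarith
  have hc : ContinuousOn (fun w => ‖deriv f w‖₊) (Metric.closedBall (0 : ℂ) (1 - (1 / 2) ^ (m + 1))) :=
    ((differentiableOn_deriv_disk hf).continuousOn.mono (closedBall_subset_disk hlt)).nnnorm
  refine ((isCompact_closedBall _ _).bddAbove_image hc).mono ?_
  rintro _ ⟨w, rfl⟩
  refine ⟨w, ?_, rfl⟩
  rw [mem_closedBall_zero_iff]
  linarith [w.2.2.1]

lemma norm_sub_le_whitneyWeight {f : ℂ → ℂ} (hf : DifferentiableOn ℂ f disk) {m i : ℕ} {e : ℂ}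
    (he : ‖e‖ = 1) {s t : ℝ} (hst : s ≤ t) (hts : t - s ≤ (1 / 2) ^ m)
    (H : ∀ x ∈ Set.Icc s t, (x : ℂ) * e ∈ whitneyBox m i) :
    ‖f (t * e) - f (s * e)‖ ≤ whitneyWeight f m i := by
  have hseg : ∀ w ∈ segment ℝ ((s : ℂ) * e) (t * e), w ∈ whitneyBox m i := by
    rintro w ⟨a, b, ha, hb, hab, rfl⟩
    have : a • ((s : ℂ) * e) + b • ((t : ℂ) * e) = ((a * s + b * t : ℝ) : ℂ) * e := by
      simp only [Complex.real_smul]; push_cast; ring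
    rw [this]
    obtain rfl : a = 1 - b := by linarith
    refine H _ ⟨?_, ?_⟩
    · nlinarith [mul_nonneg hb (sub_nonneg.2 hst)]
    · nlinarith [mul_nonneg ha (sub_nonneg.2 hst)]
  have h1 := (convex_segment (𝕜 := ℝ) ((s : ℂ) * e) (t * e)).norm_image_sub_le_of_norm_deriv_le
    (f := f) (C := ((⨆ w : whitneyBox m i, ‖deriv f w‖₊ : NNReal) : ℝ))
    (fun w hw => differentiableAt_of_mem_disk hf (hseg w hw).1)
    (fun w hw => by
      rw [← coe_nnnorm, NNReal.coe_le_coe]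
      exact le_ciSup (bddAbove_whitney hf m i) ⟨w, hseg w hw⟩)
    (left_mem_segment _ _ _) (right_mem_segment _ _ _)
  refine h1.trans ?_
  rw [← sub_mul, norm_mul, he, mul_one, ← Complex.ofReal_sub, Complex.norm_real,
    Real.norm_of_nonneg (by linarith), whitneyWeight, NNReal.coe_mul, mul_comm]
  gcongr
  simpa using hts

/-- The radius from `0` to `z` is cut at the points of modulus `1 - 2^(-m)`. Each piece stays in one
Whitney box on the branch of `z`, so the mean value inequality bounds the increment of `f` on it by
that box's weight. -/
lemma enorm_sub_le_treeSum {f : ℂ → ℂ} (hf : DifferentiableOn ℂ f disk) {z : ℂ} (hz : z ∈ disk) :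
    ENNReal.ofReal ‖f z - f 0‖ ≤
      treeSum branch level (fun m i => (whitneyWeight f m i : ENNReal)) z := by
  rcases eq_or_ne z 0 with rfl | hz0
  · simp
  have hzn : 0 < ‖z‖ := norm_pos_iff.2 hz0
  set e : ℂ := (‖z‖⁻¹ : ℝ) * z with he
  have he1 : ‖e‖ = 1 := by
    rw [he, norm_mul, Complex.norm_real, Real.norm_of_nonneg (by positivity),
      inv_mul_cancel₀ hzn.ne']
  have hze : ((‖z‖ : ℝ) : ℂ) * e = z := by
    rw [he, ← mul_assoc, ← Complex.ofReal_mul, mul_inv_cancel₀ hzn.ne']; simp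
  have hbox : ∀ m : ℕ, ∀ x : ℝ, 1 - (1 / 2) ^ m ≤ x → x ≤ 1 - (1 / 2) ^ (m + 1) →
      (x : ℂ) * e ∈ whitneyBox m (branch m z) := by
    intro m x h1 h2
    have hp : (0 : ℝ) < (1 / 2) ^ (m + 1) := by positivity
    have hp' : (1 / 2 : ℝ) ^ m ≤ 1 := pow_le_one₀ (by norm_num) (by norm_num)
    have hx0 : 0 ≤ x := by linarith
    have hn : ‖(x : ℂ) * e‖ = x := by
      rw [norm_mul, he1, mul_one, Complex.norm_real, Real.norm_of_nonneg hx0]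
    refine ⟨by rw [mem_disk, hn]; linarith, by rw [hn]; linarith, by rw [hn]; linarith, ?_⟩
    -- For `m = 0` the point may be the origin, whose argument has nothing to do with `z`; but there
    -- is only one arc then.
    rcases Nat.eq_zero_or_pos m with rfl | hm
    · rw [branch_zero, branch_zero]
    · have hx : 0 < x := by
        have : (1 / 2 : ℝ) ^ m < 1 := pow_lt_one₀ (by norm_num) (by norm_num) hm.ne'
        linarith
      rw [branch, branch, he, angleFrac_real_mul hx, angleFrac_real_mul (by positivity)]
  have hhalf : ∀ m : ℕ, (1 / 2 : ℝ) ^ (m + 1) = (1 / 2) ^ m / 2 := fun m => by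
    rw [pow_succ]; ring
  have hpos : ∀ m : ℕ, (0 : ℝ) < (1 / 2) ^ m := fun m => by positivity
  have hstep : ∀ n : ℕ, ‖f (((1 - (1 / 2) ^ n : ℝ) : ℂ) * e) - f 0‖ ≤
      ∑ m ∈ Finset.range n, (whitneyWeight f m (branch m z) : ℝ) := by
    intro n
    induction n with
    | zero => simp
    | succ n ih =>
      rw [Finset.sum_range_succ]
      have h1 := norm_sub_le_whitneyWeight hf he1 (m := n) (i := branch n z)
        (s := 1 - (1 / 2) ^ n) (t := 1 - (1 / 2) ^ (n + 1))
        (by linarith [hhalf n, hpos n]) (by linarith [hhalf n, hpos n])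
        (fun x hx => hbox n x hx.1 hx.2)
      have h2 := norm_sub_le_norm_sub_add_norm_sub (f (((1 - (1 / 2) ^ (n + 1) : ℝ) : ℂ) * e))
        (f (((1 - (1 / 2) ^ n : ℝ) : ℂ) * e)) (f 0)
      linarith
  have hlev := (le_level_iff hz (level z)).1 le_rfl
  have hlev2 := lt_of_level hz
  have hlast := norm_sub_le_whitneyWeight hf he1 (m := level z) (i := branch (level z) z)
    (s := 1 - (1 / 2) ^ level z) (t := ‖z‖)
    (by linarith) (by linarith [hpos (level z), mem_disk.1 hz])
    (fun x hx => hbox _ x hx.1 (hx.2.trans (by linarith)))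
  rw [hze] at hlast
  have h3 := norm_sub_le_norm_sub_add_norm_sub (f z)
        (f (((1 - (1 / 2) ^ level z : ℝ) : ℂ) * e)) (f 0)
  have h4 := hstep (level z)
  have h5 : ‖f z - f 0‖ ≤ ∑ m ∈ Finset.range (level z + 1), (whitneyWeight f m (branch m z) : ℝ) := by
    rw [Finset.sum_range_succ]; linarith
  refine (ENNReal.ofReal_le_ofReal h5).trans (le_of_eq ?_)
  rw [ENNReal.ofReal_sum_of_nonneg fun _ _ => NNReal.coe_nonneg _, treeSum]
  simp only [ENNReal.ofReal_coe_nnreal]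

/-- The annulus that contains the neighbourhoods of the Whitney boxes of generation `m`. -/
def whitneyAnnulus (m : ℕ) : Set ℂ :=
  {v | (1 / 2 : ℝ) ^ m / 4 ≤ 1 - ‖v‖ ∧ 1 - ‖v‖ ≤ 5 / 4 * (1 / 2) ^ m}

lemma measurableSet_whitneyAnnulus (m : ℕ) : MeasurableSet (whitneyAnnulus m) :=
  (show Measurable fun v : ℂ => 1 - ‖v‖ by fun_prop) measurableSet_Icc

/-- Annuli three or more generations apart are disjoint, because `(5/4) / 8 < 1/4`. -/
lemma tsum_indicator_whitneyAnnulus_le (c : ENNReal) (v : ℂ) :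
    ∑' m, (whitneyAnnulus m).indicator (fun _ => c) v ≤ 3 * c := by
  classical
  by_cases hex : ∃ m, v ∈ whitneyAnnulus m
  · set m₁ := Nat.find hex with hm
    have h1 := Nat.find_spec hex
    have hz : ∀ m ∉ Finset.Icc m₁ (m₁ + 2), (whitneyAnnulus m).indicator (fun _ => c) v = 0 := by
      intro m hmem
      refine Set.indicator_of_notMem (fun hv => hmem ?_) _
      rw [Finset.mem_Icc]
      refine ⟨Nat.find_min' hex hv, ?_⟩
      by_contra hlt
      have h2 : m₁ + 3 ≤ m := by omega
      have h3 : (1 / 2 : ℝ) ^ m ≤ (1 / 2) ^ (m₁ + 3) :=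
        pow_le_pow_of_le_one (by norm_num) (by norm_num) h2
      have h4 := h1.1
      rw [← hm] at h4
      have h5 := hv.2
      have h6 : (1 / 2 : ℝ) ^ (m₁ + 3) = (1 / 2) ^ m₁ / 8 := by rw [pow_add]; norm_num; ring
      have h7 : (0 : ℝ) < (1 / 2) ^ m₁ := by positivity
      linarith
    rw [tsum_eq_sum hz]
    refine (Finset.sum_le_sum fun m _ => Set.indicator_le_self' (fun _ _ => zero_le) v).trans ?_
    rw [Finset.sum_const, Nat.card_Icc, show m₁ + 2 + 1 - m₁ = 3 by omega]
    simp
  · push Not at hex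
    simp [hex]

/-- A ball around a point of the Whitney box where the derivative is nearly maximal. -/
lemma exists_whitney_ball {p : ℝ} (hp : 0 < p) (α : ℝ) :
    ∃ C : NNReal, ∀ f : ℂ → ℂ, DifferentiableOn ℂ f disk → ∀ m i : ℕ, ∃ B : Set ℂ,
      MeasurableSet B ∧ B ⊆ whitneyAnnulus m ∧
      (∀ v ∈ B, ∃ w ∈ whitneyBox m i, dist v w < (1 / 2 : ℝ) ^ m / 4) ∧
      (whitneyWeight f m i : ENNReal) ^ p * ENNReal.ofReal (((1 / 2 : ℝ) ^ m) ^ (α + 2 - p)) ≤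
        C * ∫⁻ z in B, ENNReal.ofReal (‖deriv f z‖ ^ p * (1 - ‖z‖ ^ 2) ^ α) ∂dA := by
  obtain ⟨C, hC, H⟩ := exists_weighted_rpow_le_lintegral_ball hp α
  refine ⟨(2 ^ p * 4 ^ |α| * (16 * C)).toNNReal, fun f hf m i => ?_⟩
  set t : ℝ := (1 / 2) ^ m with ht
  have ht0 : 0 < t := by positivity
  rcases (whitneyBox m i).eq_empty_or_nonempty with he | hne
  · refine ⟨∅, MeasurableSet.empty, Set.empty_subset _, by simp, ?_⟩
    have : IsEmpty (whitneyBox m i) := by rw [he]; infer_instance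
    simp [whitneyWeight, hp]
  have hne' : Nonempty (whitneyBox m i) := hne.to_subtype
  -- The box is not closed and the supremum may not be attained, so a point within a factor `2` is
  -- used.
  obtain ⟨w, hw, hsup⟩ : ∃ w ∈ whitneyBox m i,
      (⨆ w : whitneyBox m i, ‖deriv f w‖₊) ≤ 2 * ‖deriv f w‖₊ := by
    rcases eq_or_ne (⨆ w : whitneyBox m i, ‖deriv f w‖₊) 0 with h0 | h0
    · obtain ⟨w, hw⟩ := hne
      exact ⟨w, hw, by rw [h0]; exact zero_le⟩
    · obtain ⟨w, hw⟩ := exists_lt_of_lt_ciSup (NNReal.half_lt_self h0)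
      refine ⟨w, w.2, ?_⟩
      have := mul_le_mul_right hw.le 2
      rwa [mul_div_cancel₀ _ two_ne_zero] at this
  have hw1 : t / 2 ≤ 1 - ‖w‖ := by
    have := hw.2.1
    rw [pow_succ] at this; linarith
  have hw2 : 1 - ‖w‖ ≤ t := hw.2.2.1
  refine ⟨Metric.ball w (t / 4), measurableSet_ball, ?_, fun v hv => ⟨w, hw, hv⟩, ?_⟩
  · intro v hv
    have h1 := mem_ball_iff_norm.1 hv
    have h2 := norm_sub_norm_le v w
    have h3 := norm_sub_norm_le w v
    rw [norm_sub_rev] at h3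
    exact ⟨by linarith, by linarith⟩
  have hball := H (deriv f) (differentiableOn_deriv_disk hf) w hw.1 (t / 4) (by positivity)
    (by linarith)
  have hwt : (whitneyWeight f m i : ℝ) ≤ t * (2 * ‖deriv f w‖) := by
    rw [whitneyWeight, NNReal.coe_mul]
    have : ((⨆ w : whitneyBox m i, ‖deriv f w‖₊ : NNReal) : ℝ) ≤ 2 * ‖deriv f w‖ := by
      exact_mod_cast hsup
    have e : (((1 / 2 : NNReal) ^ m : NNReal) : ℝ) = t := by push_cast; rfl
    rw [e]
    gcongr
  have hcomp : t ^ α ≤ 4 ^ |α| * (1 - ‖w‖ ^ 2) ^ α :=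
    rpow_le_of_comparable α ht0 (one_sub_sq_pos hw.1)
      (by linarith [one_sub_le_one_sub_sq hw.1]) (by linarith [one_sub_sq_le hw.1])
  have hreal : (whitneyWeight f m i : ℝ) ^ p * t ^ (α + 2 - p) ≤
      2 ^ p * 4 ^ |α| * t ^ 2 * (‖deriv f w‖ ^ p * (1 - ‖w‖ ^ 2) ^ α) := by
    calc (whitneyWeight f m i : ℝ) ^ p * t ^ (α + 2 - p)
        ≤ (t * (2 * ‖deriv f w‖)) ^ p * t ^ (α + 2 - p) := by gcongr
      _ = 2 ^ p * ‖deriv f w‖ ^ p * (t ^ p * t ^ (α + 2 - p)) := by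
          rw [Real.mul_rpow ht0.le (by positivity), Real.mul_rpow (by norm_num) (norm_nonneg _)]
          ring
      _ = 2 ^ p * ‖deriv f w‖ ^ p * (t ^ 2 * t ^ α) := by
          rw [← Real.rpow_add ht0, ← Real.rpow_natCast, ← Real.rpow_add ht0]
          congr 2; push_cast; ring
      _ ≤ 2 ^ p * ‖deriv f w‖ ^ p * (t ^ 2 * (4 ^ |α| * (1 - ‖w‖ ^ 2) ^ α)) := by gcongr
      _ = _ := by ring
  calc (whitneyWeight f m i : ENNReal) ^ p * ENNReal.ofReal (t ^ (α + 2 - p))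
      = ENNReal.ofReal ((whitneyWeight f m i : ℝ) ^ p * t ^ (α + 2 - p)) := by
        rw [ENNReal.ofReal_mul (by positivity), ← ENNReal.ofReal_rpow_of_nonneg
          (NNReal.coe_nonneg _) hp.le, ENNReal.ofReal_coe_nnreal]
    _ ≤ ENNReal.ofReal (2 ^ p * 4 ^ |α| * t ^ 2) *
          ENNReal.ofReal (‖deriv f w‖ ^ p * (1 - ‖w‖ ^ 2) ^ α) := by
        rw [← ENNReal.ofReal_mul (by positivity)]
        exact ENNReal.ofReal_le_ofReal hreal
    _ ≤ ENNReal.ofReal (2 ^ p * 4 ^ |α| * t ^ 2) * (ENNReal.ofReal (C / (t / 4) ^ 2) *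
          ∫⁻ z in Metric.ball w (t / 4),
            ENNReal.ofReal (‖deriv f z‖ ^ p * (1 - ‖z‖ ^ 2) ^ α) ∂dA) := by gcongr
    _ = _ := by
        rw [← mul_assoc, ← ENNReal.ofReal_mul (by positivity)]
        congr 1
        change _ = ENNReal.ofReal _
        congr 1
        field_simp
        norm_num

/-- Every analytic function on the disk is dominated by a tree sum whose weights are controlled by
its energy. -/
lemma exists_tree_dominant {p : ℝ} (hp : 0 < p) (α : ℝ) :
    ∃ C : NNReal, ∀ f : ℂ → ℂ, DifferentiableOn ℂ f disk → ∃ a : ℕ → ℕ → NNReal,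
      (∀ z ∈ disk, ENNReal.ofReal ‖f z - f 0‖ ≤
        treeSum branch level (fun m i => (a m i : ENNReal)) z) ∧
      ∑' m, ∑' i, (a m i : ENNReal) ^ p * ENNReal.ofReal (((1 / 2 : ℝ) ^ m) ^ (α + 2 - p)) ≤
        C * energy p α f := by
  obtain ⟨C, H⟩ := exists_whitney_ball hp α
  refine ⟨C * 2 * 3, fun f hf => ⟨whitneyWeight f, fun z hz => enorm_sub_le_treeSum hf hz, ?_⟩⟩
  choose B hBm hBs hBw hB using H f hf
  set ψ : ℂ → ENNReal := fun z => ENNReal.ofReal (‖deriv f z‖ ^ p * (1 - ‖z‖ ^ 2) ^ α) with hψ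
  have hψm : Measurable ψ := measurable_energy_integrand p α f
  -- Points of the two sets lie within `2^(-m) / 4` of boxes that are at least `2^(-m)` apart.
  have hdisj : ∀ m i j : ℕ, i ≠ j → i % 2 = j % 2 → Disjoint (B m i) (B m j) := by
    intro m i j hij hpar
    refine Set.disjoint_left.2 fun v hv hv' => ?_
    obtain ⟨w, hw, hvw⟩ := hBw m i v hv
    obtain ⟨w', hw', hvw'⟩ := hBw m j v hv'
    have h1 := dist_whitneyBox hw hw' hij hpar
    have h2 := dist_triangle_left w w' v
    have h3 : (0 : ℝ) < (1 / 2) ^ m := by positivity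
    linarith
  have hclass : ∀ m (φ : ℕ → ℕ), Function.Injective φ → (∀ i j, φ i % 2 = φ j % 2) →
      ∑' j, ∫⁻ z in B m (φ j), ψ z ∂dA ≤ ∫⁻ z in whitneyAnnulus m, ψ z ∂dA := by
    intro m φ hφ hpar
    rw [← lintegral_iUnion (fun j => hBm m (φ j))
      (fun i j hij => hdisj m _ _ (fun h => hij (hφ h)) (hpar i j))]
    exact lintegral_mono_set (Set.iUnion_subset fun j => hBs m _)
  -- Even and odd indices each give a disjoint family, hence the factor `2`.
  have hrow : ∀ m, ∑' i, ∫⁻ z in B m i, ψ z ∂dA ≤ 2 * ∫⁻ z in whitneyAnnulus m, ψ z ∂dA := by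
    intro m
    rw [← tsum_even_add_odd ENNReal.summable ENNReal.summable, two_mul]
    exact add_le_add
      (hclass m (fun k => 2 * k) (fun a b h => by simpa using h) (fun i j => by omega))
      (hclass m (fun k => 2 * k + 1) (fun a b h => by simpa using h) (fun i j => by omega))
  have hall : ∑' m, ∫⁻ z in whitneyAnnulus m, ψ z ∂dA ≤ 3 * energy p α f := by
    calc ∑' m, ∫⁻ z in whitneyAnnulus m, ψ z ∂dA
        = ∑' m, ∫⁻ z, (whitneyAnnulus m).indicator ψ z ∂dA :=
          tsum_congr fun m => (lintegral_indicator (measurableSet_whitneyAnnulus m) _).symm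
      _ = ∫⁻ z, ∑' m, (whitneyAnnulus m).indicator ψ z ∂dA :=
          (lintegral_tsum fun m =>
            (hψm.indicator (measurableSet_whitneyAnnulus m)).aemeasurable).symm
      _ ≤ ∫⁻ z, 3 * ψ z ∂dA :=
          lintegral_mono fun z => tsum_indicator_whitneyAnnulus_le (ψ z) z
      _ = _ := lintegral_const_mul _ hψm
  calc ∑' m, ∑' i, (whitneyWeight f m i : ENNReal) ^ p *
        ENNReal.ofReal (((1 / 2 : ℝ) ^ m) ^ (α + 2 - p))
      ≤ ∑' m, ∑' i, C * ∫⁻ z in B m i, ψ z ∂dA :=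
        ENNReal.tsum_le_tsum fun m => ENNReal.tsum_le_tsum fun i => hB m i
    _ = C * ∑' m, ∑' i, ∫⁻ z in B m i, ψ z ∂dA := by simp only [ENNReal.tsum_mul_left]
    _ ≤ C * ∑' m, 2 * ∫⁻ z in whitneyAnnulus m, ψ z ∂dA := by
        gcongr with m
        exact hrow m
    _ = C * 2 * ∑' m, ∫⁻ z in whitneyAnnulus m, ψ z ∂dA := by
        rw [ENNReal.tsum_mul_left, mul_assoc]
    _ ≤ C * 2 * (3 * energy p α f) := by gcongr
    _ = _ := by push_cast; ring

/-! ### Sufficiency of the conditions -/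

lemma boundaryLittleO_iff {g : ℂ → ℂ} {γ : ℝ} : BoundaryLittleO g γ ↔
    ∀ c : ℝ, 0 < c → ∃ r : ℝ, 0 < r ∧ r < 1 ∧ ∀ z ∈ disk, r < ‖z‖ →
      ‖g z‖ ≤ c * (1 - ‖z‖ ^ 2) ^ γ := by
  rw [BoundaryLittleO, isLittleO_iff]
  constructor
  · intro H c hc
    have h1 := H hc
    rw [eventually_comap] at h1
    obtain ⟨l, hl, hs⟩ := (mem_nhdsLT_iff_exists_Ioo_subset' (show (0 : ℝ) < 1 by norm_num)).1 h1
    refine ⟨max l (1 / 2), by positivity, max_lt hl (by norm_num), fun z hz hrz => ?_⟩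
    have h2 := hs ⟨(le_max_left _ _).trans_lt hrz, mem_disk.1 hz⟩ z rfl
    rwa [norm_norm, Real.norm_of_nonneg (Real.rpow_nonneg (one_sub_sq_pos hz).le _)] at h2
  · intro H c hc
    obtain ⟨r, hr0, hr1, h⟩ := H c hc
    rw [eventually_comap]
    filter_upwards [Ioo_mem_nhdsLT hr1] with x hx z hz
    subst hz
    have hzd : z ∈ disk := mem_disk.2 hx.2
    rw [norm_norm, Real.norm_of_nonneg (Real.rpow_nonneg (one_sub_sq_pos hzd).le _)]
    exact h z hzd hx.1

lemma exists_pos_mul_rpow_le {q B : ℝ} (hq : 0 < q) {ε : ENNReal} (hε : ε ≠ 0) :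
    ∃ c : ℝ, 0 < c ∧ ENNReal.ofReal (c ^ q * B) ≤ ε := by
  have h1 : Tendsto (fun c : ℝ => ENNReal.ofReal (c ^ q * B)) (𝓝[>] 0) (𝓝 0) := by
    have h2 : Tendsto (fun c : ℝ => ENNReal.ofReal (c ^ q * B)) (𝓝 0)
        (𝓝 (ENNReal.ofReal ((0 : ℝ) ^ q * B))) :=
      ENNReal.tendsto_ofReal ((tendsto_id.rpow_const (Or.inr hq.le)).mul_const B)
    rw [Real.zero_rpow hq.ne', zero_mul, ENNReal.ofReal_zero] at h2
    exact h2.mono_left nhdsWithin_le_nhds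
  obtain ⟨c, hc, hc0⟩ := ((h1.eventually (gt_mem_nhds (pos_iff_ne_zero.2 hε))).and
    self_mem_nhdsWithin).exists
  exact ⟨c, hc0, hc.le⟩

lemma tendsto_setLIntegral_closedBall {φ : ℕ → ℂ → ℂ} {ψ : ℂ → ℝ} {q r : ℝ} (hq : 0 < q)
    (hr : r < 1) (hφ : TendstoLocallyUniformlyOn φ 0 atTop disk) (hψ : ContinuousOn ψ disk)
    (hψ0 : ∀ z ∈ disk, 0 ≤ ψ z) :
    Tendsto (fun n => ∫⁻ z in Metric.closedBall 0 r, ENNReal.ofReal (‖φ n z‖ ^ q * ψ z) ∂dA)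
      atTop (𝓝 0) := by
  have hsub := closedBall_subset_disk hr
  obtain ⟨B, hB⟩ := (isCompact_closedBall (0 : ℂ) r).exists_bound_of_continuousOn (hψ.mono hsub)
  have hu := (tendstoLocallyUniformlyOn_iff_forall_isCompact isOpen_disk).1 hφ _ hsub
    (isCompact_closedBall _ _)
  rw [Metric.tendstoUniformlyOn_iff] at hu
  rw [ENNReal.tendsto_nhds_zero]
  intro ε hε
  set D := (dA Set.univ).toReal with hD
  obtain ⟨c, hc, hcε⟩ := exists_pos_mul_rpow_le hq (B := |B| * D) hε.ne'
  filter_upwards [hu c hc] with n hn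
  calc ∫⁻ z in Metric.closedBall 0 r, ENNReal.ofReal (‖φ n z‖ ^ q * ψ z) ∂dA
      ≤ ∫⁻ z in Metric.closedBall 0 r, ENNReal.ofReal (c ^ q * |B|) ∂dA := by
        refine setLIntegral_mono_ae' measurableSet_closedBall (ae_of_all _ fun z hz => ?_)
        refine ENNReal.ofReal_le_ofReal ?_
        have h1 := hn z hz
        simp only [Pi.zero_apply, dist_zero_left] at h1
        have h2' : ψ z ≤ |B| := (Real.le_norm_self _).trans ((hB z hz).trans (le_abs_self B))
        exact mul_le_mul (Real.rpow_le_rpow (norm_nonneg _) h1.le hq.le) h2' (hψ0 z (hsub hz))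
          (by positivity)
    _ ≤ ∫⁻ z, ENNReal.ofReal (c ^ q * |B|) ∂dA := setLIntegral_le_lintegral _ _
    _ = ENNReal.ofReal (c ^ q * (|B| * D)) := by
        rw [lintegral_const, ← ENNReal.ofReal_toReal (measure_ne_top dA Set.univ),
          ← ENNReal.ofReal_mul (by positivity), mul_assoc]
    _ ≤ ε := hcε

/-- Locally uniform convergence settles compact subdisks, while the hypotheses on `g` settle the
outer region uniformly in `n`. -/
lemma tendsto_lintegral_of_inner_outer {Φ : ℕ → ℂ → ENNReal}
    (hin : ∀ r : ℝ, r < 1 →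
      Tendsto (fun n => ∫⁻ z in Metric.closedBall 0 r, Φ n z ∂dA) atTop (𝓝 0))
    (hout : ∀ ε : ENNReal, ε ≠ 0 → ∃ r : ℝ, r < 1 ∧
      ∀ n, ∫⁻ z in (Metric.closedBall 0 r)ᶜ, Φ n z ∂dA ≤ ε) :
    Tendsto (fun n => ∫⁻ z, Φ n z ∂dA) atTop (𝓝 0) := by
  rw [ENNReal.tendsto_nhds_zero]
  intro ε hε
  obtain ⟨r, hr, h⟩ := hout (ε / 2) (ENNReal.half_pos hε.ne').ne'
  filter_upwards [ENNReal.tendsto_nhds_zero.1 (hin r hr) (ε / 2) (ENNReal.half_pos hε.ne')] with n hn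
  rw [← lintegral_add_compl _ (measurableSet_closedBall (x := (0 : ℂ)) (ε := r)),
    ← ENNReal.add_halves ε]
  exact add_le_add hn (h n)

/-- The weighted integral of `‖φ‖ ^ q` over the disk. -/
def weightedIntegral (q β : ℝ) (φ : ℂ → ℂ) : ENNReal :=
  ∫⁻ z, ENNReal.ofReal (‖φ z‖ ^ q * (1 - ‖z‖ ^ 2) ^ β) ∂dA

lemma continuousOn_weight (β : ℝ) : ContinuousOn (fun z : ℂ => (1 - ‖z‖ ^ 2) ^ β) disk :=
  ContinuousOn.rpow_const (by fun_prop) fun z hz => Or.inl (one_sub_sq_pos hz).ne'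

/-- The part `g f'` of the derivative of `g f` under the boundary condition on `g`. -/
lemma tendsto_lintegral_mul_deriv {p q α β : ℝ} (hp : 0 < p) (hpq : p < q) (hα : -2 < α)
    {g : ℂ → ℂ} (hg : DifferentiableOn ℂ g disk)
    (hgo : BoundaryLittleO g ((2 + α) / p - (2 + β) / q)) {h : ℕ → ℂ → ℂ}
    (hh : ∀ n, DifferentiableOn ℂ (h n) disk) {J : ℝ} (hJ0 : 0 ≤ J)
    (hJ : ∀ n, powNorm p α (h n) ≤ ENNReal.ofReal J)
    (hl : TendstoLocallyUniformlyOn h 0 atTop disk) :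
    Tendsto (fun n => weightedIntegral q β fun z => g z * deriv (h n) z) atTop (𝓝 0) := by
  have hq : 0 < q := hp.trans hpq
  have e : ∀ n, weightedIntegral q β (fun z => g z * deriv (h n) z) = ∫⁻ z, ENNReal.ofReal
      (‖deriv (h n) z‖ ^ q * (‖g z‖ ^ q * (1 - ‖z‖ ^ 2) ^ β)) ∂dA := fun n => by
    refine lintegral_congr fun z => ?_
    rw [norm_mul, Real.mul_rpow (norm_nonneg _) (norm_nonneg _)]
    ring_nf
  simp only [e]
  refine tendsto_lintegral_of_inner_outer (fun r hr => ?_) fun ε hε => ?_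
  · refine tendsto_setLIntegral_closedBall hq hr ?_ ?_ fun z hz => ?_
    · have := hl.deriv (Eventually.of_forall hh) isOpen_disk
      refine this.congr_right fun z _ => ?_
      simp
    · exact (hg.continuousOn.norm.rpow_const fun _ _ => Or.inr hq.le).mul (continuousOn_weight β)
    · have := one_sub_sq_pos hz
      positivity
  · obtain ⟨C, hC, H⟩ := exists_norm_deriv_le hp α
    set τ := (2 + α) / p with hτ
    have hτ0 : 0 < τ := div_pos (by linarith) hp
    set C₂ := C * 2 ^ τ * J ^ (1 / p) with hC₂
    obtain ⟨c, hc, hcε⟩ := exists_pos_mul_rpow_le hq (B := C₂ ^ (q - p) * J) hε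
    obtain ⟨r, hr0, hr1, hgr⟩ := boundaryLittleO_iff.1 hgo c hc
    refine ⟨r, hr1, fun n => ?_⟩
    have hE := (energy_le_powNorm p α (h n)).trans (hJ n)
    calc ∫⁻ z in (Metric.closedBall 0 r)ᶜ, ENNReal.ofReal
          (‖deriv (h n) z‖ ^ q * (‖g z‖ ^ q * (1 - ‖z‖ ^ 2) ^ β)) ∂dA
        ≤ ∫⁻ z in (Metric.closedBall 0 r)ᶜ, ENNReal.ofReal (c ^ q * C₂ ^ (q - p)) *
            ENNReal.ofReal (‖deriv (h n) z‖ ^ p * (1 - ‖z‖ ^ 2) ^ α) ∂dA := by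
          refine setLIntegral_dA_mono measurableSet_closedBall.compl fun z hz hzr => ?_
          rw [← ENNReal.ofReal_mul (by positivity)]
          refine ENNReal.ofReal_le_ofReal ?_
          set D := 1 - ‖z‖ ^ 2 with hD
          have hD0 : 0 < D := one_sub_sq_pos hz
          have hd0 := one_sub_pos hz
          rw [Set.mem_compl_iff, mem_closedBall_zero_iff, not_le] at hzr
          have h1 := hgr z hz hzr
          have h2 : ‖deriv (h n) z‖ ≤ C₂ * D ^ (-τ) := by
            refine (H (h n) (hh n) J hJ0 hE z hz).trans ?_
            have h3 : (1 - ‖z‖) ^ (-τ) ≤ 2 ^ τ * D ^ (-τ) := by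
              have : (1 - ‖z‖) ^ (-τ) ≤ (D / 2) ^ (-τ) :=
                Real.rpow_le_rpow_of_nonpos (by positivity)
                  (by linarith [one_sub_sq_le hz]) (by linarith)
              refine this.trans (le_of_eq ?_)
              rw [Real.div_rpow hD0.le (by norm_num), Real.rpow_neg (by norm_num : (0 : ℝ) ≤ 2)]
              field_simp
            calc C * (1 - ‖z‖) ^ (-τ) * J ^ (1 / p)
                ≤ C * (2 ^ τ * D ^ (-τ)) * J ^ (1 / p) := by gcongr
              _ = _ := by rw [hC₂]; ring
          -- The first factor is kept for the energy; the second takes the pointwise bound, which is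
          -- where `p < q` enters.
          have h4 : ‖deriv (h n) z‖ ^ q = ‖deriv (h n) z‖ ^ p * ‖deriv (h n) z‖ ^ (q - p) := by
            rw [← Real.rpow_add_of_nonneg (norm_nonneg _) hp.le (by linarith)]
            congr 1; ring
          have h5 : ‖deriv (h n) z‖ ^ (q - p) ≤ (C₂ * D ^ (-τ)) ^ (q - p) :=
            Real.rpow_le_rpow (norm_nonneg _) h2 (by linarith)
          have h6 : ‖g z‖ ^ q ≤ (c * D ^ (τ - (2 + β) / q)) ^ q :=
            Real.rpow_le_rpow (norm_nonneg _) h1 hq.le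
          have h7 : D ^ (-τ * (q - p)) * (D ^ ((τ - (2 + β) / q) * q) * D ^ β) = D ^ α := by
            rw [← Real.rpow_add hD0, ← Real.rpow_add hD0]
            congr 1
            rw [hτ]; field_simp; ring
          calc ‖deriv (h n) z‖ ^ q * (‖g z‖ ^ q * D ^ β)
              ≤ ‖deriv (h n) z‖ ^ p * (C₂ * D ^ (-τ)) ^ (q - p) *
                  ((c * D ^ (τ - (2 + β) / q)) ^ q * D ^ β) := by
                rw [h4]; gcongr
            _ = c ^ q * C₂ ^ (q - p) * (‖deriv (h n) z‖ ^ p *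
                  (D ^ (-τ * (q - p)) * (D ^ ((τ - (2 + β) / q) * q) * D ^ β))) := by
                rw [Real.mul_rpow (x := C₂) (by positivity) (by positivity),
                  Real.mul_rpow (x := c) (by positivity) (by positivity), ← Real.rpow_mul hD0.le,
                  ← Real.rpow_mul hD0.le]
                ring
            _ = _ := by rw [h7]
      _ ≤ ENNReal.ofReal (c ^ q * C₂ ^ (q - p)) * energy p α (h n) := by
          rw [lintegral_const_mul' _ _ ENNReal.ofReal_ne_top]
          gcongr
          exact setLIntegral_le_lintegral _ _
      _ ≤ ENNReal.ofReal (c ^ q * C₂ ^ (q - p)) * ENNReal.ofReal J := by gcongr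
      _ = ENNReal.ofReal (c ^ q * (C₂ ^ (q - p) * J)) := by
          rw [← ENNReal.ofReal_mul (by positivity), mul_assoc]
      _ ≤ ε := hcε

lemma measurable_muMeasure_density (g : ℂ → ℂ) (q β : ℝ) : Measurable fun z : ℂ =>
    ENNReal.ofReal ((1 - ‖z‖ ^ 2) ^ β * ‖deriv g z‖ ^ q) := by
  have := measurable_deriv g
  fun_prop

lemma ae_muMeasure_mem_disk (g : ℂ → ℂ) (q β : ℝ) : ∀ᵐ z ∂muMeasure g q β, z ∈ disk :=
  (withDensity_absolutelyContinuous _ _).ae_le ae_dA_mem_disk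

lemma setLIntegral_muMeasure (g : ℂ → ℂ) (q β : ℝ) (φ : ℂ → ENNReal) {s : Set ℂ}
    (hs : MeasurableSet s) : ∫⁻ z in s, φ z ∂muMeasure g q β =
      ∫⁻ z in s, ENNReal.ofReal ((1 - ‖z‖ ^ 2) ^ β * ‖deriv g z‖ ^ q) * φ z ∂dA :=
  setLIntegral_withDensity_eq_setLIntegral_mul_non_measurable _ (measurable_muMeasure_density g q β)
    φ hs (ae_of_all _ fun _ => ENNReal.ofReal_lt_top)

/-- The Carleson-type smallness of `μ` near the boundary, on the boxes of the dyadic tree. -/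
def TailSmall (μ : Measure ℂ) (u : ℕ → ENNReal) : Prop :=
  ∀ ε : NNReal, ε ≠ 0 → ∃ r : ℝ, r < 1 ∧
    ∀ m i, μ.restrict (Metric.closedBall 0 r)ᶜ (treeBox branch level m i) ≤ ε * u m

/-- The part `g' f` of the derivative of `g f` under the Carleson condition on `μ`. -/
lemma tendsto_lintegral_deriv_mul {p q α β : ℝ} (hp : 0 < p) (hpq : p < q)
    {g : ℂ → ℂ} (hg : DifferentiableOn ℂ g disk) {u : ℕ → ENNReal} (hu : u 0 ≠ ⊤)
    [IsFiniteMeasure (muMeasure g q β)]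
    (hT : TreeEmbedding branch level p q u
      (fun m => ENNReal.ofReal (((1 / 2 : ℝ) ^ m) ^ (α + 2 - p))))
    (hμ : TailSmall (muMeasure g q β) u) {h : ℕ → ℂ → ℂ}
    (hh : ∀ n, DifferentiableOn ℂ (h n) disk) {J : ℝ} (hJ0 : 0 ≤ J)
    (hJ : ∀ n, powNorm p α (h n) ≤ ENNReal.ofReal J)
    (hl : TendstoLocallyUniformlyOn h 0 atTop disk) :
    Tendsto (fun n => weightedIntegral q β fun z => deriv g z * h n z) atTop (𝓝 0) := by
  have hq : 0 < q := hp.trans hpq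
  have e : ∀ n, weightedIntegral q β (fun z => deriv g z * h n z) = ∫⁻ z, ENNReal.ofReal
      (‖h n z‖ ^ q * ((1 - ‖z‖ ^ 2) ^ β * ‖deriv g z‖ ^ q)) ∂dA := fun n => by
    refine lintegral_congr fun z => ?_
    rw [norm_mul, Real.mul_rpow (norm_nonneg _) (norm_nonneg _)]
    ring_nf
  simp only [e]
  refine tendsto_lintegral_of_inner_outer (fun r hr => ?_) fun ε hε => ?_
  · refine tendsto_setLIntegral_closedBall hq hr hl ((continuousOn_weight β).mul ?_) fun z hz => ?_
    · exact (differentiableOn_deriv_disk hg).continuousOn.norm.rpow_const fun _ _ => Or.inr hq.le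
    · have := one_sub_sq_pos hz
      positivity
  · obtain ⟨C, hC⟩ := hT.scaled
    obtain ⟨C', hC'⟩ := exists_tree_dominant hp α
    -- The first summand accounts for the values at the origin, with `u 0` controlling the mass of
    -- the root box, which is everything; the second accounts for the tree sum.
    set K : ENNReal := ENNReal.ofReal (2 ^ q) * (ENNReal.ofReal (J ^ (1 / p)) ^ q * u 0 +
      C * (C' * ENNReal.ofReal J) ^ (q / p)) with hK
    have hKt : K ≠ ⊤ := by
      refine ENNReal.mul_ne_top ENNReal.ofReal_ne_top (ENNReal.add_ne_top.2 ⟨?_, ?_⟩)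
      · exact ENNReal.mul_ne_top (ENNReal.rpow_ne_top_of_nonneg hq.le ENNReal.ofReal_ne_top) hu
      · exact ENNReal.mul_ne_top ENNReal.coe_ne_top (ENNReal.rpow_ne_top_of_nonneg (by positivity)
          (ENNReal.mul_ne_top ENNReal.coe_ne_top ENNReal.ofReal_ne_top))
    obtain ⟨η, hη0, hηK⟩ := exists_pos_mul_rpow_le (q := 1) one_pos (B := K.toReal) hε
    rw [Real.rpow_one, ENNReal.ofReal_mul hη0.le, ENNReal.ofReal_toReal hKt] at hηK
    obtain ⟨r, hr, hμr⟩ := hμ η.toNNReal (by simpa using hη0)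
    refine ⟨r, hr, fun n => ?_⟩
    set ν := (muMeasure g q β).restrict (Metric.closedBall 0 r)ᶜ with hν
    have hνuniv : ν Set.univ ≤ η.toNNReal * u 0 := by
      refine (measure_mono fun z _ => ?_).trans (hμr 0 0)
      exact ⟨Nat.zero_le _, branch_zero z⟩
    obtain ⟨a, ha1, ha2⟩ := hC' (h n) (hh n)
    have hE := (energy_le_powNorm p α (h n)).trans (hJ n)
    have h0 := norm_zero_le_of_powNorm_le hp hJ0 (hJ n)
    have htree := hC ν η.toNNReal (by simpa using hη0) hμr a
    calc ∫⁻ z in (Metric.closedBall 0 r)ᶜ, ENNReal.ofReal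
          (‖h n z‖ ^ q * ((1 - ‖z‖ ^ 2) ^ β * ‖deriv g z‖ ^ q)) ∂dA
        = ∫⁻ z, ENNReal.ofReal (‖h n z‖ ^ q) ∂ν := by
          rw [hν, setLIntegral_muMeasure g q β _ measurableSet_closedBall.compl]
          refine lintegral_congr fun z => ?_
          rw [ENNReal.ofReal_mul (by positivity), mul_comm]
      _ ≤ ∫⁻ z, ENNReal.ofReal (2 ^ q) * (ENNReal.ofReal (J ^ (1 / p)) ^ q +
            treeSum branch level (fun m i => (a m i : ENNReal)) z ^ q) ∂ν := by
          refine lintegral_mono_ae (ae_restrict_of_ae ((ae_muMeasure_mem_disk g q β).mono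
            fun z hz => ?_))
          have h1 := norm_add_rpow_le hq (h n 0) (h n z - h n 0)
          rw [add_sub_cancel] at h1
          refine (ENNReal.ofReal_le_ofReal h1).trans ?_
          rw [ENNReal.ofReal_mul (by positivity), ENNReal.ofReal_add (by positivity) (by positivity),
            ← ENNReal.ofReal_rpow_of_nonneg (norm_nonneg _) hq.le,
            ← ENNReal.ofReal_rpow_of_nonneg (norm_nonneg _) hq.le]
          gcongr
          exact ha1 z hz
      _ = ENNReal.ofReal (2 ^ q) * (ENNReal.ofReal (J ^ (1 / p)) ^ q * ν Set.univ +
            ∫⁻ z, treeSum branch level (fun m i => (a m i : ENNReal)) z ^ q ∂ν) := by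
          rw [lintegral_const_mul' _ _ ENNReal.ofReal_ne_top, lintegral_add_left measurable_const,
            lintegral_const]
      _ ≤ ENNReal.ofReal (2 ^ q) * (ENNReal.ofReal (J ^ (1 / p)) ^ q * (η.toNNReal * u 0) +
            η.toNNReal * C * (C' * ENNReal.ofReal J) ^ (q / p)) := by
          gcongr
          refine htree.trans ?_
          gcongr
          refine ha2.trans ?_
          gcongr
      _ = ENNReal.ofReal η * K := by
          rw [hK, show ENNReal.ofReal η = (η.toNNReal : ENNReal) from rfl]; ring
      _ ≤ ε := hηK

lemma deriv_mulOp {g f : ℂ → ℂ} (hg : DifferentiableOn ℂ g disk) (hf : DifferentiableOn ℂ f disk)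
    {z : ℂ} (hz : z ∈ disk) : deriv (mulOp g f) z = deriv g z * f z + g z * deriv f z :=
  deriv_mul (differentiableAt_of_mem_disk hg hz) (differentiableAt_of_mem_disk hf hz)

lemma weightedIntegral_congr {q β : ℝ} {φ ψ : ℂ → ℂ} (h : Set.EqOn φ ψ disk) :
    weightedIntegral q β φ = weightedIntegral q β ψ :=
  lintegral_congr_ae (ae_dA_mem_disk.mono fun z hz => by simp only [h hz])

lemma weightedIntegral_add_le {q : ℝ} (β : ℝ) (hq : 0 < q) {φ ψ : ℂ → ℂ}
    (hφ : ContinuousOn φ disk) : weightedIntegral q β (fun z => φ z + ψ z) ≤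
      ENNReal.ofReal (2 ^ q) * (weightedIntegral q β φ + weightedIntegral q β ψ) := by
  have hm : AEMeasurable (fun z => ENNReal.ofReal (‖φ z‖ ^ q * (1 - ‖z‖ ^ 2) ^ β)) dA := by
    have hc : ContinuousOn (fun z => ‖φ z‖ ^ q * (1 - ‖z‖ ^ 2) ^ β) disk :=
      (hφ.norm.rpow_const fun _ _ => Or.inr hq.le).mul (continuousOn_weight β)
    exact ((hc.aemeasurable measurableSet_disk).smul_measure _).ennreal_ofReal
  rw [weightedIntegral, weightedIntegral, weightedIntegral, ← lintegral_add_left' hm,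
    ← lintegral_const_mul' _ _ ENNReal.ofReal_ne_top]
  refine lintegral_dA_mono fun z hz => ?_
  have hw : 0 ≤ (1 - ‖z‖ ^ 2) ^ β := (Real.rpow_pos_of_pos (one_sub_sq_pos hz) β).le
  rw [← ENNReal.ofReal_add (by positivity) (by positivity), ← ENNReal.ofReal_mul (by positivity),
    ← add_mul, ← mul_assoc]
  refine ENNReal.ofReal_le_ofReal ?_
  gcongr
  exact norm_add_rpow_le hq _ _

lemma energy_mulOp_le {q : ℝ} (β : ℝ) (hq : 0 < q) {g f : ℂ → ℂ} (hg : DifferentiableOn ℂ g disk)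
    (hf : DifferentiableOn ℂ f disk) : energy q β (mulOp g f) ≤ ENNReal.ofReal (2 ^ q) *
      (weightedIntegral q β (fun z => deriv g z * f z) +
        weightedIntegral q β (fun z => g z * deriv f z)) := by
  have e : energy q β (mulOp g f) =
      weightedIntegral q β (fun z => deriv g z * f z + g z * deriv f z) :=
    weightedIntegral_congr fun z hz => deriv_mulOp hg hf hz
  rw [e]
  exact weightedIntegral_add_le β hq
    ((differentiableOn_deriv_disk hg).mul hf).continuousOn

/-- The product rule solved for `g' f`; this direction serves necessity. -/
lemma weightedIntegral_deriv_mul_le {q : ℝ} (β : ℝ) (hq : 0 < q) {g f : ℂ → ℂ}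
    (hg : DifferentiableOn ℂ g disk) (hf : DifferentiableOn ℂ f disk) :
    weightedIntegral q β (fun z => deriv g z * f z) ≤ ENNReal.ofReal (2 ^ q) *
      (energy q β (mulOp g f) + weightedIntegral q β (fun z => g z * deriv f z)) := by
  have e : weightedIntegral q β (fun z => deriv g z * f z) =
      weightedIntegral q β (fun z => deriv (mulOp g f) z + -(g z * deriv f z)) :=
    weightedIntegral_congr fun z hz => by simp only [deriv_mulOp hg hf hz]; ring
  have e2 : weightedIntegral q β (fun z => -(g z * deriv f z)) =
      weightedIntegral q β (fun z => g z * deriv f z) := by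
    simp only [weightedIntegral, norm_neg]
  rw [e, ← e2]
  exact weightedIntegral_add_le β hq
    (differentiableOn_deriv_disk (differentiableOn_mulOp hg hf)).continuousOn

/-- Sufficiency: the boundary condition and the embedding condition give compactness. -/
lemma nullToNull_of_conditions {p q α β : ℝ} (hp : 0 < p) (hpq : p < q) (hα : -2 < α)
    {g : ℂ → ℂ} (hg : DifferentiableOn ℂ g disk)
    (hgo : BoundaryLittleO g ((2 + α) / p - (2 + β) / q)) {u : ℕ → ENNReal} (hu : u 0 ≠ ⊤)
    [IsFiniteMeasure (muMeasure g q β)]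
    (hT : TreeEmbedding branch level p q u
      (fun m => ENNReal.ofReal (((1 / 2 : ℝ) ^ m) ^ (α + 2 - p))))
    (hμ : TailSmall (muMeasure g q β) u) : NullToNull p α q β g := by
  rintro h hh ⟨J, hJ0, hJ⟩ hl
  have hq : 0 < q := hp.trans hpq
  have h1 := tendsto_lintegral_mul_deriv hp hpq hα hg hgo hh hJ0 hJ hl
  have h2 := tendsto_lintegral_deriv_mul hp hpq hg hu hT hμ hh hJ0 hJ hl
  have h3 : Tendsto (fun n => ENNReal.ofReal (2 ^ q) *
      (weightedIntegral q β (fun z => deriv g z * h n z) +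
        weightedIntegral q β (fun z => g z * deriv (h n) z))) atTop (𝓝 0) := by
    simpa using ENNReal.Tendsto.const_mul (h2.add h1) (Or.inr ENNReal.ofReal_ne_top)
  have h4 : Tendsto (fun n => ENNReal.ofReal (‖mulOp g (h n) 0‖ ^ q)) atTop (𝓝 0) := by
    have h5 : Tendsto (fun n => mulOp g (h n) 0) atTop (𝓝 (g 0 * 0)) :=
      (hl.tendsto_at (show (0 : ℂ) ∈ disk by simp [disk])).const_mul (g 0)
    have h6 := ENNReal.tendsto_ofReal (h5.norm.rpow_const (p := q) (Or.inr hq.le))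
    simpa [Real.zero_rpow hq.ne'] using h6
  have h7 := h4.add h3
  rw [add_zero] at h7
  exact tendsto_of_tendsto_of_tendsto_of_le_of_le tendsto_const_nhds h7 (fun _ => zero_le)
    fun n => add_le_add le_rfl (energy_mulOp_le β hq hg (hh n))

/-- With the boundary condition available, `g f'` tends to zero by the sufficiency argument, and `(g
f)'` does by hypothesis; their difference is `g' f`. -/
lemma tendsto_weightedIntegral_of_nullToNull {p q α β : ℝ} (hp : 0 < p) (hpq : p < q) (hα : -2 < α)
    {g : ℂ → ℂ} (hg : DifferentiableOn ℂ g disk) (hN : NullToNull p α q β g)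
    (hgo : BoundaryLittleO g ((2 + α) / p - (2 + β) / q)) {h : ℕ → ℂ → ℂ}
    (hh : ∀ n, DifferentiableOn ℂ (h n) disk) {J : ℝ} (hJ0 : 0 ≤ J)
    (hJ : ∀ n, powNorm p α (h n) ≤ ENNReal.ofReal J)
    (hl : TendstoLocallyUniformlyOn h 0 atTop disk) :
    Tendsto (fun n => weightedIntegral q β fun z => deriv g z * h n z) atTop (𝓝 0) := by
  have hq : 0 < q := hp.trans hpq
  have h1 := tendsto_lintegral_mul_deriv hp hpq hα hg hgo hh hJ0 hJ hl
  have h2 := hN h hh ⟨J, hJ0, hJ⟩ hl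
  have h3 : Tendsto (fun n => ENNReal.ofReal (2 ^ q) * (powNorm q β (mulOp g (h n)) +
        weightedIntegral q β (fun z => g z * deriv (h n) z))) atTop (𝓝 0) := by
    simpa using ENNReal.Tendsto.const_mul (h2.add h1) (Or.inr ENNReal.ofReal_ne_top)
  refine tendsto_of_tendsto_of_tendsto_of_le_of_le tendsto_const_nhds h3 (fun _ => zero_le)
    fun n => (weightedIntegral_deriv_mul_le β hq hg (hh n)).trans ?_
  exact mul_le_mul_right (add_le_add (energy_le_powNorm _ _ _) le_rfl) _

lemma exists_measure_compl_closedBall_le {μ : Measure ℂ} [IsFiniteMeasure μ]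
    (hμ : ∀ᵐ z ∂μ, z ∈ disk) {ε : ENNReal} (hε : ε ≠ 0) :
    ∃ r : ℝ, r < 1 ∧ μ (Metric.closedBall 0 r)ᶜ ≤ ε := by
  set s : ℕ → Set ℂ := fun k => (Metric.closedBall 0 (1 - 1 / ((k : ℝ) + 1)))ᶜ with hs
  have hanti : Antitone s := by
    intro a b hab
    refine Set.compl_subset_compl.2 (Metric.closedBall_subset_closedBall ?_)
    have : (a : ℝ) ≤ b := by exact_mod_cast hab
    gcongr
  have h1 := tendsto_measure_iInter_atTop (μ := μ) (s := s)
    (fun k => measurableSet_closedBall.compl.nullMeasurableSet) hanti ⟨0, measure_ne_top _ _⟩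
  have h2 : μ (⋂ k, s k) = 0 := by
    refine measure_mono_null (fun z hz => ?_) (ae_iff.1 hμ)
    intro hzd
    obtain ⟨k, hk⟩ := exists_nat_one_div_lt (one_sub_pos hzd)
    have := Set.mem_iInter.1 hz k
    simp only [hs, Set.mem_compl_iff, mem_closedBall_zero_iff, not_le] at this
    linarith
  rw [h2] at h1
  obtain ⟨k, hk⟩ := (h1.eventually (gt_mem_nhds (pos_iff_ne_zero.2 hε))).exists
  refine ⟨_, ?_, hk.le⟩
  have : (0 : ℝ) < 1 / ((k : ℝ) + 1) := by positivity
  linarith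

lemma tailSmall_one {μ : Measure ℂ} [IsFiniteMeasure μ] (hμ : ∀ᵐ z ∂μ, z ∈ disk) :
    TailSmall μ (fun _ => 1) := by
  intro ε hε
  obtain ⟨r, hr, h⟩ := exists_measure_compl_closedBall_le hμ (ENNReal.coe_ne_zero.2 hε)
  refine ⟨r, hr, fun m i => ?_⟩
  rw [mul_one]
  refine (measure_mono (Set.subset_univ _)).trans ?_
  rwa [Measure.restrict_apply_univ]

/-- The Carleson-type smallness of `μ` on dyadic boxes of large generation. -/
def EventuallySmall (μ : Measure ℂ) (u : ℕ → ENNReal) : Prop :=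
  ∀ ε : NNReal, ε ≠ 0 → ∃ n : ℕ, ∀ m, n ≤ m → ∀ i, μ (treeBox branch level m i) ≤ ε * u m

/-- Late generations are small already. For the finitely many early ones the total mass outside a
large disk is made smaller than each bound. -/
lemma EventuallySmall.tailSmall {μ : Measure ℂ} [IsFiniteMeasure μ] (hμ : ∀ᵐ z ∂μ, z ∈ disk)
    {u : ℕ → ENNReal} (hu : ∀ m, u m ≠ 0) (h : EventuallySmall μ u) : TailSmall μ u := by
  intro ε hε
  obtain ⟨n, hn⟩ := h ε hε
  have key : ∀ k : ℕ, ∃ r : ℝ, r < 1 ∧ ∀ m < k, μ (Metric.closedBall 0 r)ᶜ ≤ ε * u m := by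
    intro k
    induction k with
    | zero => exact ⟨0, by norm_num, by simp⟩
    | succ k ih =>
      obtain ⟨r, hr, hrm⟩ := ih
      obtain ⟨r', hr', h'⟩ := exists_measure_compl_closedBall_le hμ
        (mul_ne_zero (ENNReal.coe_ne_zero.2 hε) (hu k))
      refine ⟨max r r', max_lt hr hr', fun m hm => ?_⟩
      rcases Nat.lt_succ_iff_lt_or_eq.1 hm with h1 | rfl
      · refine (measure_mono ?_).trans (hrm m h1)
        exact Set.compl_subset_compl.2 (Metric.closedBall_subset_closedBall (le_max_left _ _))
      · refine (measure_mono ?_).trans h'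
        exact Set.compl_subset_compl.2 (Metric.closedBall_subset_closedBall (le_max_right _ _))
  obtain ⟨r, hr, hrm⟩ := key n
  refine ⟨r, hr, fun m i => ?_⟩
  rcases lt_or_ge m n with hm | hm
  · refine (measure_mono (Set.subset_univ _)).trans ?_
    rw [Measure.restrict_apply_univ]
    exact hrm m hm
  · exact (Measure.restrict_apply_le _ _).trans (hn m hm i)

lemma muMeasure_closedBall_lt_top {g : ℂ → ℂ} (hg : DifferentiableOn ℂ g disk) {q : ℝ} (hq : 0 < q)
    (β : ℝ) {r : ℝ} (hr : r < 1) : muMeasure g q β (Metric.closedBall 0 r) < ⊤ := by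
  have hc : ContinuousOn (fun z : ℂ => (1 - ‖z‖ ^ 2) ^ β * ‖deriv g z‖ ^ q) disk :=
    (continuousOn_weight β).mul
      ((differentiableOn_deriv_disk hg).continuousOn.norm.rpow_const fun _ _ => Or.inr hq.le)
  obtain ⟨B, hB⟩ := (isCompact_closedBall (0 : ℂ) r).exists_bound_of_continuousOn
    (hc.mono (closedBall_subset_disk hr))
  rw [muMeasure, withDensity_apply _ measurableSet_closedBall]
  calc ∫⁻ z in Metric.closedBall 0 r, ENNReal.ofReal ((1 - ‖z‖ ^ 2) ^ β * ‖deriv g z‖ ^ q) ∂dA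
      ≤ ∫⁻ z in Metric.closedBall 0 r, ENNReal.ofReal B ∂dA :=
        setLIntegral_mono_ae' measurableSet_closedBall (ae_of_all _ fun z hz =>
          ENNReal.ofReal_le_ofReal ((Real.le_norm_self _).trans (hB z hz)))
    _ < ⊤ := by
        rw [setLIntegral_const]
        exact ENNReal.mul_lt_top ENNReal.ofReal_lt_top (measure_lt_top _ _)

/-- A compact disk together with the finitely many boxes of one late generation covers the whole
disk. -/
lemma EventuallySmall.isFiniteMeasure {g : ℂ → ℂ} (hg : DifferentiableOn ℂ g disk) {q : ℝ}
    (hq : 0 < q) {β : ℝ} {u : ℕ → ENNReal} (hu : ∀ m, u m ≠ ⊤)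
    (h : EventuallySmall (muMeasure g q β) u) : IsFiniteMeasure (muMeasure g q β) := by
  obtain ⟨n, hn⟩ := h 1 one_ne_zero
  have hcov : ∀ z ∈ disk, z ∈ Metric.closedBall (0 : ℂ) (1 - (1 / 2) ^ n) ∪
      ⋃ i ∈ Finset.range (2 ^ n), treeBox branch level n i := by
    intro z hz
    by_cases hl : n ≤ level z
    · refine Or.inr (Set.mem_iUnion₂.2 ⟨branch n z, ?_, hl, rfl⟩)
      exact Finset.mem_range.2 (branch_lt n z)
    · refine Or.inl ?_
      rw [le_level_iff hz, not_le] at hl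
      rw [mem_closedBall_zero_iff]; linarith
  refine ⟨?_⟩
  calc muMeasure g q β Set.univ ≤ muMeasure g q β (Metric.closedBall (0 : ℂ) (1 - (1 / 2) ^ n) ∪
      ⋃ i ∈ Finset.range (2 ^ n), treeBox branch level n i) :=
        measure_mono_ae ((ae_muMeasure_mem_disk g q β).mono fun z hz _ => hcov z hz)
    _ ≤ muMeasure g q β (Metric.closedBall (0 : ℂ) (1 - (1 / 2) ^ n)) +
        ∑ i ∈ Finset.range (2 ^ n), muMeasure g q β (treeBox branch level n i) :=
        (measure_union_le _ _).trans (add_le_add le_rfl (measure_biUnion_finset_le _ _))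
    _ < ⊤ := by
        refine ENNReal.add_lt_top.2 ⟨muMeasure_closedBall_lt_top hg hq β ?_, ?_⟩
        · have : (0 : ℝ) < (1 / 2) ^ n := by positivity
          linarith
        · refine ENNReal.sum_lt_top.2 fun i _ => (hn n le_rfl i).trans_lt ?_
          exact ENNReal.mul_lt_top ENNReal.coe_lt_top (hu n).lt_top

lemma eventuallySmall_of_squaresLittleO {μ : Measure ℂ} (hμ : ∀ᵐ z ∂μ, z ∈ disk) {ψ : ℝ → ℝ}
    (h : SquaresLittleO μ ψ) {u : ℕ → ENNReal} {K : ℝ} (hK : 0 < K) {n₁ : ℕ}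
    (hψ : ∀ m, n₁ ≤ m → ENNReal.ofReal (ψ ((1 / 2) ^ m)) ≤ ENNReal.ofReal K * u m) :
    EventuallySmall μ u := by
  intro ε hε
  obtain ⟨δ, hδ, H⟩ := h (ε / K) (by positivity)
  obtain ⟨n, hn⟩ := exists_pow_lt_of_lt_one hδ (by norm_num : (1 / 2 : ℝ) < 1)
  refine ⟨max n n₁, fun m hm i => ?_⟩
  have hmn : (1 / 2 : ℝ) ^ m < δ :=
    (pow_le_pow_of_le_one (by norm_num) (by norm_num) ((le_max_left _ _).trans hm)).trans_lt hn
  set I : Arc := ⟨2 * Real.pi * (i * (1 / 2) ^ m), (1 / 2) ^ m, by positivity,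
    pow_le_one₀ (by norm_num) (by norm_num)⟩ with hI
  calc μ (treeBox branch level m i) ≤ μ (carlesonSquare I) :=
        measure_mono_ae (hμ.mono fun z hz hzb => mem_carlesonSquare_of_mem_treeBox hz hzb I rfl rfl)
    _ ≤ ENNReal.ofReal (ε / K * ψ ((1 / 2) ^ m)) := H I hmn
    _ = ENNReal.ofReal (ε / K) * ENNReal.ofReal (ψ ((1 / 2) ^ m)) :=
        ENNReal.ofReal_mul (by positivity)
    _ ≤ ENNReal.ofReal (ε / K) * (ENNReal.ofReal K * u m) := by
        gcongr
        exact hψ m ((le_max_right _ _).trans hm)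
    _ = ε * u m := by
        rw [← mul_assoc, ← ENNReal.ofReal_mul (by positivity), div_mul_cancel₀ _ hK.ne',
          ENNReal.ofReal_coe_nnreal]

lemma nullToNull_of_vanishingCarleson {p q α β : ℝ} (hp : 0 < p) (hpq : p < q) (hα : -1 < α)
    (hpα : p < α + 2) {g : ℂ → ℂ} (hg : DifferentiableOn ℂ g disk)
    (hgo : BoundaryLittleO g ((2 + α) / p - (2 + β) / q))
    (hμ : IsVanishingCarleson (q * (α + 2 - p) / p) (muMeasure g q β)) :
    NullToNull p α q β g := by
  have hq : 0 < q := hp.trans hpq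
  set s := (α + 2 - p) / p with hs
  have hs0 : 0 < s := div_pos (by linarith) hp
  set u : ℕ → ENNReal := fun m => ENNReal.ofReal (((1 / 2 : ℝ) ^ m) ^ (q * s)) with hu
  have hsmall : EventuallySmall (muMeasure g q β) u :=
    eventuallySmall_of_squaresLittleO (ae_muMeasure_mem_disk g q β) hμ one_pos (n₁ := 0)
      fun m _ => by
        rw [ENNReal.ofReal_one, one_mul, hu, hs, mul_div_assoc]
  have := hsmall.isFiniteMeasure hg hq (fun m => ENNReal.ofReal_ne_top)
  refine nullToNull_of_conditions hp hpq (by linarith) hg hgo (u := u) ENNReal.ofReal_ne_top ?_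
    (hsmall.tailSmall (ae_muMeasure_mem_disk g q β) fun m => by
      simp only [hu, ne_eq, ENNReal.ofReal_eq_zero, not_le]; positivity)
  have e : p * s = α + 2 - p := by rw [hs]; field_simp
  rw [← e]
  exact treeEmbedding_of_pos measurable_branch branch_succ measurable_level hp hpq hs0

lemma nullToNull_of_log {p q α β : ℝ} (hpq : p < q) (hα : -1 < α)
    (hpα : p = α + 2) {g : ℂ → ℂ} (hg : DifferentiableOn ℂ g disk)
    (hgo : BoundaryLittleO g ((2 + α) / p - (2 + β) / q))
    (hμ : SquaresLittleO (muMeasure g q β) (fun t => Real.log (1 / t) ^ ((1 / p - 1) * q))) :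
    NullToNull p α q β g := by
  have hp1 : 1 < p := by linarith
  have hp : 0 < p := by linarith
  have hq : 0 < q := hp.trans hpq
  set e := q * (p - 1) / p with he
  have he0 : 0 < e := div_pos (mul_pos hq (by linarith)) hp
  have he' : (1 / p - 1) * q = -e := by rw [he]; field_simp; ring
  set u : ℕ → ENNReal := fun m => ENNReal.ofReal (((m : ℝ) + 1) ^ (-e)) with hu
  have hlog : 0 < Real.log 2 := Real.log_pos (by norm_num)
  have hsmall : EventuallySmall (muMeasure g q β) u :=
    eventuallySmall_of_squaresLittleO (ae_muMeasure_mem_disk g q β) hμ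
      -- For `m ≥ 1`, `m log 2 ≥ (log 2 / 2)(m + 1)`; generation zero is excluded because the
      -- logarithm vanishes there.
      (K := (Real.log 2 / 2) ^ (-e)) (by positivity) (n₁ := 1) fun m hm => by
        have hm1 : (1 : ℝ) ≤ m := by exact_mod_cast hm
        have hl : Real.log (1 / (1 / 2 : ℝ) ^ m) = m * Real.log 2 := by
          rw [one_div, one_div, inv_pow, inv_inv, Real.log_pow]
        simp only [hl, he', hu]
        rw [← ENNReal.ofReal_mul (by positivity), ← Real.mul_rpow (by positivity) (by positivity)]
        refine ENNReal.ofReal_le_ofReal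
          (Real.rpow_le_rpow_of_nonpos (by positivity) ?_ (by linarith))
        nlinarith
  have := hsmall.isFiniteMeasure hg hq (fun m => ENNReal.ofReal_ne_top)
  refine nullToNull_of_conditions hp hpq (by linarith) hg hgo (u := u) ENNReal.ofReal_ne_top ?_
    (hsmall.tailSmall (ae_muMeasure_mem_disk g q β) fun m => by
      simp only [hu, ne_eq, ENNReal.ofReal_eq_zero, not_le]; positivity)
  have e0 : α + 2 - p = 0 := by linarith
  simp only [e0, Real.rpow_zero, ENNReal.ofReal_one]
  exact treeEmbedding_critical measurable_branch branch_succ measurable_level hp1 hpq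

lemma nullToNull_of_memDirichlet {p q α β : ℝ} (hpq : p < q) (hα : -1 < α)
    (hpα : α + 2 < p) {g : ℂ → ℂ}
    (hgo : BoundaryLittleO g ((2 + α) / p - (2 + β) / q)) (hg : MemDirichlet q β g) :
    NullToNull p α q β g := by
  have hp : 0 < p := by linarith
  have hq : 0 < q := hp.trans hpq
  have hfin : IsFiniteMeasure (muMeasure g q β) := by
    refine ⟨?_⟩
    rw [muMeasure, withDensity_apply _ MeasurableSet.univ, Measure.restrict_univ]
    have h1 := (energy_le_powNorm q β g).trans_lt ((dirichletNorm_lt_top_iff hq).1 hg.2)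
    rw [energy] at h1
    simpa only [mul_comm] using h1
  set σ := (p - α - 2) / p with hσ
  have hσ0 : 0 < σ := div_pos (by linarith) hp
  refine nullToNull_of_conditions hp hpq (by linarith) hg.1 hgo (u := fun _ => 1) ENNReal.one_ne_top
    ?_ (tailSmall_one (ae_muMeasure_mem_disk g q β))
  have e : α + 2 - p = -(p * σ) := by rw [hσ]; field_simp; ring
  rw [e]
  exact treeEmbedding_of_neg branch_zero hp hq hσ0

/-! ### Forelli–Rudin integrals -/

lemma lintegral_Ioi_rpow {c b : ℝ} (hc : 1 < c) (hb : 0 < b) :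
    ∫⁻ x in Set.Ioi b, ENNReal.ofReal (x ^ (-c)) = ENNReal.ofReal (b ^ (1 - c) / (c - 1)) := by
  have hc1 : 0 < c - 1 := by linarith
  rw [← ofReal_integral_eq_lintegral_ofReal (integrableOn_Ioi_rpow_of_lt (by linarith) hb)
    ((ae_restrict_iff' measurableSet_Ioi).2 (ae_of_all _ fun x hx => by
      have : 0 < x := hb.trans hx
      simp only [Pi.zero_apply]; positivity)), integral_Ioi_rpow_of_lt (by linarith) hb]
  congr 1
  rw [show -c + 1 = -(c - 1) by ring, show (1 : ℝ) - c = -(c - 1) by ring]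
  field_simp

lemma lintegral_Ioc_rpow {α d : ℝ} (hα : -1 < α) (hd : 0 < d) :
    ∫⁻ x in Set.Ioc 0 d, ENNReal.ofReal (x ^ α) = ENNReal.ofReal (d ^ (α + 1) / (α + 1)) := by
  have hα1 : 0 < α + 1 := by linarith
  rw [← ofReal_integral_eq_lintegral_ofReal, ← intervalIntegral.integral_of_le hd.le,
    integral_rpow (Or.inl hα), Real.zero_rpow hα1.ne', sub_zero]
  · exact (intervalIntegrable_iff_integrableOn_Ioc_of_le hd.le).1
      (intervalIntegral.intervalIntegrable_rpow' hα)
  · exact (ae_restrict_iff' measurableSet_Ioc).2 (ae_of_all _ fun x hx => by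
      have : 0 < x := hx.1
      simp only [Pi.zero_apply]; positivity)

lemma lintegral_Ioc_inv {d : ℝ} (hd : 0 < d) (hd1 : d ≤ 1) :
    ∫⁻ x in Set.Ioc d 1, ENNReal.ofReal (x ^ (-1 : ℝ)) = ENNReal.ofReal (Real.log (1 / d)) := by
  have h0 : (0 : ℝ) ∉ Set.uIcc d 1 := by
    rw [Set.uIcc_of_le hd1]; exact fun h => hd.not_ge h.1
  rw [← integral_inv h0, intervalIntegral.integral_of_le hd1, ofReal_integral_eq_lintegral_ofReal]
  · simp only [Real.rpow_neg_one]
  · exact (intervalIntegrable_iff_integrableOn_Ioc_of_le hd1).1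
      (intervalIntegral.intervalIntegrable_inv (fun x hx h => h0 (h ▸ hx)) continuousOn_id)
  · exact (ae_restrict_iff' measurableSet_Ioc).2 (ae_of_all _ fun x hx => by
      have : 0 < x := hd.trans hx.1
      simp only [Pi.zero_apply]; positivity)

lemma lintegral_angular_le {c b : ℝ} (hc : 1 < c) (hb : 0 < b) :
    ∫⁻ θ : ℝ, ENNReal.ofReal ((b + |θ|) ^ (-c)) ≤ ENNReal.ofReal (2 / (c - 1) * b ^ (1 - c)) := by
  have hc1 : 0 < c - 1 := by linarith
  set F : ℝ → ENNReal := (Set.Ici b).indicator fun x => ENNReal.ofReal (x ^ (-c)) with hF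
  have hFm : Measurable F := Measurable.indicator (by fun_prop) measurableSet_Ici
  have hFi : ∫⁻ x, F x = ENNReal.ofReal (b ^ (1 - c) / (c - 1)) := by
    rw [hF, lintegral_indicator measurableSet_Ici, ← lintegral_Ioi_rpow hc hb,
      Measure.restrict_congr_set Ioi_ae_eq_Ici]
  calc ∫⁻ θ : ℝ, ENNReal.ofReal ((b + |θ|) ^ (-c))
      ≤ ∫⁻ θ : ℝ, (F (b + θ) + F (b - θ)) := by
        refine lintegral_mono fun θ => ?_
        rcases le_total 0 θ with h | h
        · refine le_trans (le_of_eq ?_) le_self_add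
          rw [abs_of_nonneg h, hF, Set.indicator_of_mem (by simpa using h)]
        · refine le_trans (le_of_eq ?_) le_add_self
          rw [abs_of_nonpos h, hF, Set.indicator_of_mem (by simpa using h), sub_eq_add_neg]
    _ = ENNReal.ofReal (b ^ (1 - c) / (c - 1)) + ENNReal.ofReal (b ^ (1 - c) / (c - 1)) := by
        rw [lintegral_add_left (by fun_prop), lintegral_add_left_eq_self F b,
          lintegral_sub_left_eq_self F b, hFi]
    _ = _ := by
        rw [← ENNReal.ofReal_add (by positivity) (by positivity)]; congr 1; ring

/-- The factor `d + t` is replaced by `d` for `t ≤ d` and by `t` beyond. The outer range `s` is left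
open, since the supercritical case integrates to infinity and the critical case only to `1`. -/
lemma lintegral_radial_le {α c d : ℝ} (hα : -1 < α) (hc : 1 < c) (hd : 0 < d) {s : Set ℝ}
    {T : ℝ} (hT : 0 ≤ T) (hs : Set.Ioo 0 1 ⊆ Set.Ioc 0 d ∪ s) (hsm : MeasurableSet s)
    (hsd : ∀ x ∈ s, d < x)
    (hTs : ∫⁻ x in s, ENNReal.ofReal (x ^ (α + 1 - c)) ≤ ENNReal.ofReal T) :
    ∫⁻ t in Set.Ioo (0 : ℝ) 1, ENNReal.ofReal (t ^ α * (d + t) ^ (1 - c)) ≤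
      ENNReal.ofReal (d ^ (α + 2 - c) / (α + 1) + T) := by
  have hα1 : 0 < α + 1 := by linarith
  calc ∫⁻ t in Set.Ioo (0 : ℝ) 1, ENNReal.ofReal (t ^ α * (d + t) ^ (1 - c))
      ≤ (∫⁻ t in Set.Ioc 0 d, ENNReal.ofReal (t ^ α * (d + t) ^ (1 - c))) +
          ∫⁻ t in s, ENNReal.ofReal (t ^ α * (d + t) ^ (1 - c)) :=
        (lintegral_mono_set hs).trans (lintegral_union_le _ _ _)
    _ ≤ (∫⁻ t in Set.Ioc 0 d, ENNReal.ofReal (d ^ (1 - c)) * ENNReal.ofReal (t ^ α)) +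
          ∫⁻ t in s, ENNReal.ofReal (t ^ (α + 1 - c)) := by
        refine add_le_add
          (setLIntegral_mono_ae' measurableSet_Ioc (ae_of_all _ fun t ht => ?_))
          (setLIntegral_mono_ae' hsm (ae_of_all _ fun t ht => ?_))
        · rw [← ENNReal.ofReal_mul (by positivity), mul_comm]
          refine ENNReal.ofReal_le_ofReal ?_
          have ht0 : 0 < t := ht.1
          have : (d + t) ^ (1 - c) ≤ d ^ (1 - c) :=
            Real.rpow_le_rpow_of_nonpos hd (by linarith) (by linarith)
          gcongr
        · refine ENNReal.ofReal_le_ofReal ?_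
          have ht0 : 0 < t := hd.trans (hsd t ht)
          have : (d + t) ^ (1 - c) ≤ t ^ (1 - c) :=
            Real.rpow_le_rpow_of_nonpos ht0 (by linarith) (by linarith)
          calc t ^ α * (d + t) ^ (1 - c) ≤ t ^ α * t ^ (1 - c) := by gcongr
            _ = _ := by rw [← Real.rpow_add ht0]; congr 1; ring
    _ ≤ ENNReal.ofReal (d ^ (α + 2 - c) / (α + 1)) + ENNReal.ofReal T := by
        refine add_le_add (le_of_eq ?_) hTs
        rw [lintegral_const_mul' _ _ ENNReal.ofReal_ne_top, lintegral_Ioc_rpow hα hd,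
          ← ENNReal.ofReal_mul (by positivity), ← mul_div_assoc, ← Real.rpow_add hd]
        congr 3; ring
    _ = _ := (ENNReal.ofReal_add (by positivity) hT).symm

lemma lintegral_radial_supercritical {α c d : ℝ} (hα : -1 < α) (hc : α + 2 < c) (hd : 0 < d) :
    ∫⁻ t in Set.Ioo (0 : ℝ) 1, ENNReal.ofReal (t ^ α * (d + t) ^ (1 - c)) ≤
      ENNReal.ofReal ((1 / (α + 1) + 1 / (c - α - 2)) * d ^ (α + 2 - c)) := by
  have hc2 : 0 < c - α - 2 := by linarith
  refine (lintegral_radial_le hα (by linarith) hd (s := Set.Ioi d)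
    (T := d ^ (α + 2 - c) / (c - α - 2)) (by positivity) ?_ measurableSet_Ioi (fun x hx => hx)
    ?_).trans (le_of_eq ?_)
  · intro x hx
    rcases le_or_gt x d with h | h
    · exact Or.inl ⟨hx.1, h⟩
    · exact Or.inr h
  · rw [show α + 1 - c = -(c - α - 1) by ring, lintegral_Ioi_rpow (by linarith) hd]
    rw [show 1 - (c - α - 1) = α + 2 - c by ring, show c - α - 1 - 1 = c - α - 2 by ring]
  · congr 1; ring

lemma lintegral_radial_critical {α d : ℝ} (hα : -1 < α) (hd : 0 < d) (hd1 : d ≤ 1) :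
    ∫⁻ t in Set.Ioo (0 : ℝ) 1, ENNReal.ofReal (t ^ α * (d + t) ^ (1 - (α + 2))) ≤
      ENNReal.ofReal (1 / (α + 1) + Real.log (1 / d)) := by
  have hl : 0 ≤ Real.log (1 / d) := Real.log_nonneg ((one_le_div hd).2 hd1)
  refine (lintegral_radial_le hα (by linarith) hd (s := Set.Ioc d 1)
    (T := Real.log (1 / d)) hl ?_ measurableSet_Ioc (fun x hx => hx.1) ?_).trans (le_of_eq ?_)
  · intro x hx
    rcases le_or_gt x d with h | h
    · exact Or.inl ⟨hx.1, h⟩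
    · exact Or.inr ⟨h, hx.2.le⟩
  · rw [show α + 1 - (α + 2) = -1 by ring, lintegral_Ioc_inv hd hd1]
  · rw [sub_self, Real.rpow_zero]

/-- The modulus dominates `1 - ρ r`, hence both `1 - ρ` and `1 - r`. If `ρ r ≥ 1/2` it also
dominates `|θ| / π` by Jordan's inequality; otherwise it exceeds `1/2` and the angle is harmless. -/
lemma one_sub_polar_ge {ρ r θ : ℝ} (hρ0 : 0 ≤ ρ) (hρ1 : ρ < 1) (hr0 : 0 < r) (hr1 : r < 1)
    (hθ : |θ| ≤ Real.pi) :
    ((1 - ρ) + (1 - r) + |θ|) / (4 * Real.pi) ≤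
      ‖1 - (ρ : ℂ) * (r * Complex.exp (θ * Complex.I))‖ := by
  have hpi := Real.pi_gt_three
  set x := ρ * r with hx
  have hx0 : 0 ≤ x := by positivity
  have hx1 : 1 - ρ ≤ 1 - x := by
    have : ρ * r ≤ ρ * 1 := by gcongr
    linarith
  have hx2 : 1 - r ≤ 1 - x := by
    have : ρ * r ≤ 1 * r := by gcongr
    linarith
  set n := ‖1 - (ρ : ℂ) * (r * Complex.exp (θ * Complex.I))‖ with hn
  have hn0 : 0 ≤ n := norm_nonneg _
  have key : n ^ 2 = (1 - x) ^ 2 + 4 * x * Real.sin (θ / 2) ^ 2 := by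
    have h := norm_sub_sq_polar 1 x 0 (θ / (2 * Real.pi))
    rw [mul_div_cancel₀ θ (by positivity)] at h
    rw [hn]
    convert h using 2
    · congr 1
      simp [hx, mul_assoc]
    · rw [mul_one]
      congr 1
      rw [← neg_sq, ← Real.sin_neg]
      congr 2
      field_simp
      ring
  have h1 : 1 - x ≤ n := by
    refine le_of_sq_le_sq ?_ hn0
    rw [key]
    have : 0 ≤ 4 * x * Real.sin (θ / 2) ^ 2 := by positivity
    linarith
  rw [div_le_iff₀ (by positivity)]
  rcases lt_or_ge x (1 / 2) with h | h
  · have h2 : 1 / 2 < n := by linarith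
    nlinarith
  · have hs : (|θ| / Real.pi) ^ 2 ≤ Real.sin (θ / 2) ^ 2 := by
      have h2 := Real.mul_abs_le_abs_sin (x := θ / 2) (by
        rw [abs_div, abs_two]; linarith)
      have h3 : 2 / Real.pi * |θ / 2| = |θ| / Real.pi := by
        rw [abs_div, abs_two]; field_simp
      rw [h3] at h2
      rw [← sq_abs (Real.sin (θ / 2))]
      gcongr
    have h2 : |θ| / Real.pi ≤ n := by
      refine le_of_sq_le_sq ?_ hn0
      rw [key]
      have h4 : 1 * Real.sin (θ / 2) ^ 2 ≤ 4 * x * Real.sin (θ / 2) ^ 2 := by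
        gcongr; linarith
      have h5 := sq_nonneg (1 - x)
      linarith
    rw [div_le_iff₀ (by positivity)] at h2
    nlinarith

/-- A rotation makes `a` a nonnegative real number. In polar coordinates the kernel is then
comparable to a sum of the distances to the circle and the angle, and integrating out the angle over
all of `ℝ` lowers the exponent by one. -/
lemma lintegral_kernel_le {α c : ℝ} (hc : 1 < c) :
    ∃ C : ℝ, 0 < C ∧ ∀ a ∈ disk, ∫⁻ z, ENNReal.ofReal
      (‖1 - (starRingEnd ℂ) a * z‖ ^ (-c) * (1 - ‖z‖ ^ 2) ^ α) ∂dA ≤ ENNReal.ofReal C *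
        ∫⁻ t in Set.Ioo (0 : ℝ) 1, ENNReal.ofReal (t ^ α * ((1 - ‖a‖) + t) ^ (1 - c)) := by
  have hc1 : 0 < c - 1 := by linarith
  have hpi := Real.pi_pos
  refine ⟨1 / Real.pi * (4 ^ |α| * (4 * Real.pi) ^ c * (2 / (c - 1))), by positivity,
    fun a ha => ?_⟩
  set ρ := ‖a‖ with hρ
  have hρ0 : 0 ≤ ρ := norm_nonneg a
  have hρ1 : ρ < 1 := mem_disk.1 ha
  set φ : ℂ → ENNReal := disk.indicator fun z =>
    ENNReal.ofReal (‖1 - (starRingEnd ℂ) a * z‖ ^ (-c) * (1 - ‖z‖ ^ 2) ^ α) with hφ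
  obtain ⟨u, hu1, hau, hrot⟩ : ∃ u : ℂ, ‖u‖ = 1 ∧ (starRingEnd ℂ) a * u = ρ ∧
      ∫⁻ z, φ z = ∫⁻ z, φ (u * z) := by
    refine ⟨Circle.exp a.arg, Circle.norm_coe _, ?_, ?_⟩
    · have h1 : a = ρ * (Circle.exp a.arg : ℂ) := by
        rw [Circle.coe_exp, hρ, Complex.norm_mul_exp_arg_mul_I]
      nth_rw 1 [h1]
      rw [map_mul, Complex.conj_ofReal, mul_assoc, ← Circle.coe_inv_eq_conj, Circle.coe_inv,
        inv_mul_cancel₀ (Circle.coe_ne_zero _), mul_one]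
    · have := (rotation (Circle.exp a.arg)).measurePreserving.lintegral_comp_emb
        (rotation (Circle.exp a.arg)).toHomeomorph.measurableEmbedding φ
      rw [← this]
      rfl
  rw [dA, lintegral_smul_measure, ← lintegral_indicator measurableSet_disk, ← hφ, hrot,
    ENNReal.ofReal_mul (by positivity), mul_assoc, smul_eq_mul]
  refine mul_le_mul_right ?_ _
  set G : ℝ → ENNReal := (Set.Ioo (0 : ℝ) 1).indicator fun t =>
    ENNReal.ofReal (4 ^ |α| * (4 * Real.pi) ^ c * t ^ α) with hG
  have hpoint : ∀ p ∈ Set.Ioi (0 : ℝ) ×ˢ Set.Ioo (-Real.pi) Real.pi,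
      ENNReal.ofReal p.1 • φ (u * Complex.polarCoord.symm p) ≤
      G (1 - p.1) * ENNReal.ofReal (((1 - ρ) + (1 - p.1) + |p.2|) ^ (-c)) := by
    rintro ⟨r, θ⟩ ⟨hr0, hθ⟩
    simp only [Set.mem_Ioi] at hr0
    simp only [Set.mem_Ioo] at hθ
    have hpol : Complex.polarCoord.symm (r, θ) = r * Complex.exp (θ * Complex.I) := by
      rw [Complex.polarCoord_symm_apply, Complex.exp_mul_I]; simp
    have hnorm : ‖u * Complex.polarCoord.symm (r, θ)‖ = r := by
      rw [norm_mul, hu1, hpol, norm_mul, Complex.norm_exp_ofReal_mul_I,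
        Complex.norm_real, Real.norm_of_nonneg hr0.le, one_mul, mul_one]
    have hk : (starRingEnd ℂ) a * (u * Complex.polarCoord.symm (r, θ)) =
        ρ * (r * Complex.exp (θ * Complex.I)) := by
      rw [← mul_assoc, hau, hpol]
    rcases lt_or_ge r 1 with hr1 | hr1
    · have hmem : u * Complex.polarCoord.symm (r, θ) ∈ disk := by rwa [mem_disk, hnorm]
      have hmem' : 1 - r ∈ Set.Ioo (0 : ℝ) 1 := ⟨by linarith, by linarith⟩
      have hr1' : 0 < 1 - r := hmem'.1
      rw [hφ, Set.indicator_of_mem hmem, hG, Set.indicator_of_mem hmem', hnorm, smul_eq_mul,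
        ← ENNReal.ofReal_mul hr0.le, ← ENNReal.ofReal_mul (by positivity), hk]
      refine ENNReal.ofReal_le_ofReal ?_
      have h1 := one_sub_polar_ge hρ0 hρ1 hr0 hr1 (abs_le.2 ⟨hθ.1.le, hθ.2.le⟩)
      have hpos : 0 < (1 - ρ) + (1 - r) + |θ| := by
        have := abs_nonneg θ; linarith
      have h2 := Real.rpow_le_rpow_of_nonpos (z := -c) (by positivity) h1 (by linarith)
      rw [Real.div_rpow hpos.le (by positivity), Real.rpow_neg (by positivity : 0 ≤ 4 * Real.pi),
        div_inv_eq_mul] at h2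
      have hsq : 0 < 1 - r ^ 2 := by nlinarith
      have h3 : (1 - r ^ 2) ^ α ≤ 4 ^ |α| * (1 - r) ^ α :=
        rpow_le_of_comparable α hsq hr1' (by nlinarith) (by nlinarith)
      calc r * (‖1 - (ρ : ℂ) * (r * Complex.exp (θ * Complex.I))‖ ^ (-c) * (1 - r ^ 2) ^ α)
          ≤ 1 * ((((1 - ρ) + (1 - r) + |θ|) ^ (-c) * (4 * Real.pi) ^ c) *
              (4 ^ |α| * (1 - r) ^ α)) := by gcongr
        _ = _ := by ring
    · have hmem : u * Complex.polarCoord.symm (r, θ) ∉ disk := by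
        rw [mem_disk, hnorm, not_lt]; exact hr1
      rw [hφ, Set.indicator_of_notMem hmem, smul_zero]
      exact zero_le
  rw [← Complex.lintegral_comp_polarCoord_symm, polarCoord_target]
  calc ∫⁻ p in Set.Ioi (0 : ℝ) ×ˢ Set.Ioo (-Real.pi) Real.pi,
        ENNReal.ofReal p.1 • φ (u * Complex.polarCoord.symm p)
      ≤ ∫⁻ p in Set.Ioi (0 : ℝ) ×ˢ Set.Ioo (-Real.pi) Real.pi,
          G (1 - p.1) * ENNReal.ofReal (((1 - ρ) + (1 - p.1) + |p.2|) ^ (-c)) :=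
        setLIntegral_mono_ae' (measurableSet_Ioi.prod measurableSet_Ioo) (ae_of_all _ hpoint)
    _ ≤ ∫⁻ p : ℝ × ℝ, G (1 - p.1) * ENNReal.ofReal (((1 - ρ) + (1 - p.1) + |p.2|) ^ (-c)) :=
        setLIntegral_le_lintegral _ _
    _ ≤ ∫⁻ r : ℝ, ∫⁻ θ : ℝ, G (1 - r) * ENNReal.ofReal (((1 - ρ) + (1 - r) + |θ|) ^ (-c)) := by
        rw [Measure.volume_eq_prod]
        exact lintegral_prod_le _
    _ = ∫⁻ t : ℝ, ∫⁻ θ : ℝ, G t * ENNReal.ofReal (((1 - ρ) + t + |θ|) ^ (-c)) :=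
        lintegral_sub_left_eq_self
          (fun t => ∫⁻ θ : ℝ, G t * ENNReal.ofReal (((1 - ρ) + t + |θ|) ^ (-c))) 1
    _ ≤ ∫⁻ t in Set.Ioo (0 : ℝ) 1, ENNReal.ofReal (4 ^ |α| * (4 * Real.pi) ^ c * (2 / (c - 1))) *
          ENNReal.ofReal (t ^ α * ((1 - ρ) + t) ^ (1 - c)) := by
        rw [← lintegral_indicator measurableSet_Ioo]
        refine lintegral_mono fun t => ?_
        by_cases ht : t ∈ Set.Ioo (0 : ℝ) 1
        · rw [Set.indicator_of_mem ht, hG, Set.indicator_of_mem ht,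
            lintegral_const_mul' _ _ ENNReal.ofReal_ne_top]
          have ht0 : 0 < t := ht.1
          have hb : 0 < (1 - ρ) + t := by linarith
          refine (mul_le_mul_right (lintegral_angular_le hc hb) _).trans (le_of_eq ?_)
          rw [← ENNReal.ofReal_mul (by positivity), ← ENNReal.ofReal_mul (by positivity)]
          congr 1; ring
        · rw [hG, Set.indicator_of_notMem ht]; simp
    _ = _ := lintegral_const_mul' _ _ ENNReal.ofReal_ne_top

/-- The Forelli–Rudin estimate above the critical exponent. -/
lemma exists_lintegral_kernel_supercritical {α c : ℝ} (hα : -1 < α) (hc : α + 2 < c) :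
    ∃ C : ℝ, 0 < C ∧ ∀ a ∈ disk, ∫⁻ z, ENNReal.ofReal
      (‖1 - (starRingEnd ℂ) a * z‖ ^ (-c) * (1 - ‖z‖ ^ 2) ^ α) ∂dA ≤
        ENNReal.ofReal (C * (1 - ‖a‖) ^ (α + 2 - c)) := by
  obtain ⟨C, hC, H⟩ := lintegral_kernel_le (α := α) (c := c) (by linarith)
  have h1 : 0 < α + 1 := by linarith
  have h2 : 0 < c - α - 2 := by linarith
  refine ⟨C * (1 / (α + 1) + 1 / (c - α - 2)), by positivity, fun a ha => (H a ha).trans ?_⟩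
  rw [mul_assoc, ENNReal.ofReal_mul hC.le]
  gcongr
  exact lintegral_radial_supercritical hα hc (one_sub_pos ha)

/-- The Forelli–Rudin estimate at the critical exponent. -/
lemma exists_lintegral_kernel_critical {α : ℝ} (hα : -1 < α) :
    ∃ C : ℝ, 0 < C ∧ ∀ a ∈ disk, ∫⁻ z, ENNReal.ofReal
      (‖1 - (starRingEnd ℂ) a * z‖ ^ (-(α + 2)) * (1 - ‖z‖ ^ 2) ^ α) ∂dA ≤
        ENNReal.ofReal (C * (1 + Real.log (1 / (1 - ‖a‖)))) := by
  obtain ⟨C, hC, H⟩ := lintegral_kernel_le (α := α) (c := α + 2) (by linarith)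
  have h1 : 0 < α + 1 := by linarith
  refine ⟨C * (1 / (α + 1) + 1), by positivity, fun a ha => (H a ha).trans ?_⟩
  have hd := one_sub_pos ha
  have hd1 : 1 - ‖a‖ ≤ 1 := by linarith [norm_nonneg a]
  have hl : 0 ≤ Real.log (1 / (1 - ‖a‖)) := Real.log_nonneg ((one_le_div hd).2 hd1)
  rw [mul_assoc, ENNReal.ofReal_mul hC.le]
  refine mul_le_mul_right ((lintegral_radial_critical hα hd hd1).trans
    (ENNReal.ofReal_le_ofReal ?_)) _
  have : 0 < 1 / (α + 1) := by positivity
  nlinarith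

/-! ### Test families -/

/-- A family of functions on the disk, indexed by the points of the disk, that is bounded in the
weighted Dirichlet space and tends to zero locally uniformly as the index tends to the boundary. -/
structure IsTestFamily (p α : ℝ) (F : ℂ → ℂ → ℂ) : Prop where
  differentiableOn : ∀ a ∈ disk, DifferentiableOn ℂ (F a) disk
  powNorm_le : ∃ J : ℝ, 0 ≤ J ∧ ∀ a ∈ disk, powNorm p α (F a) ≤ ENNReal.ofReal J
  norm_le : ∀ r : ℝ, r < 1 → ∃ b : ℝ → ℝ, Tendsto b (𝓝[>] 0) (𝓝 0) ∧
    ∀ a ∈ disk, ∀ z ∈ Metric.closedBall (0 : ℂ) r, ‖F a z‖ ≤ b (1 - ‖a‖)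

/-- If the bound failed at points arbitrarily close to the circle, those points would index a null
sequence contradicting `hΦ`. -/
lemma IsTestFamily.eventually_le {p α : ℝ} {F : ℂ → ℂ → ℂ} (hF : IsTestFamily p α F)
    {Φ : (ℂ → ℂ) → ENNReal}
    (hΦ : ∀ (h : ℕ → ℂ → ℂ) (J : ℝ), (∀ n, DifferentiableOn ℂ (h n) disk) → 0 ≤ J →
      (∀ n, powNorm p α (h n) ≤ ENNReal.ofReal J) → TendstoLocallyUniformlyOn h 0 atTop disk →
      Tendsto (fun n => Φ (h n)) atTop (𝓝 0)) {ε : ENNReal} (hε : ε ≠ 0) :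
    ∃ δ : ℝ, 0 < δ ∧ ∀ a ∈ disk, 1 - ‖a‖ < δ → Φ (F a) ≤ ε := by
  by_contra! H
  choose a ha hlt hbad using fun n : ℕ => H (1 / ((n : ℝ) + 1)) (by positivity)
  obtain ⟨J, hJ0, hJ⟩ := hF.powNorm_le
  have hlim : Tendsto (fun n => 1 - ‖a n‖) atTop (𝓝[>] 0) := by
    refine tendsto_nhdsWithin_iff.2 ⟨?_, Eventually.of_forall fun n => one_sub_pos (ha n)⟩
    exact squeeze_zero (fun n => (one_sub_pos (ha n)).le) (fun n => (hlt n).le)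
      tendsto_one_div_add_atTop_nhds_zero_nat
  have h1 := hΦ (fun n => F (a n)) J (fun n => hF.differentiableOn _ (ha n)) hJ0
    (fun n => hJ _ (ha n)) (tendstoLocallyUniformlyOn_disk_zero fun r _ hr1 => by
      obtain ⟨b, hb, H⟩ := hF.norm_le r hr1
      exact ⟨fun n => b (1 - ‖a n‖), hb.comp hlim, fun n z hz => H _ (ha n) z hz⟩)
  obtain ⟨n, hn⟩ := (ENNReal.tendsto_nhds_zero.1 h1 ε (pos_iff_ne_zero.2 hε)).exists
  exact (hbad n).not_ge hn

lemma one_sub_norm_mul_le (a z : ℂ) : 1 - ‖a‖ * ‖z‖ ≤ ‖1 - (starRingEnd ℂ) a * z‖ := by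
  have := norm_sub_norm_le (1 : ℂ) ((starRingEnd ℂ) a * z)
  rwa [norm_one, norm_mul, Complex.norm_conj] at this

lemma one_sub_le_norm_kernel {a z : ℂ} (ha : a ∈ disk) :
    1 - ‖z‖ ≤ ‖1 - (starRingEnd ℂ) a * z‖ := by
  refine le_trans ?_ (one_sub_norm_mul_le a z)
  nlinarith [norm_nonneg z, mem_disk.1 ha]

lemma one_sub_le_norm_kernel' {a z : ℂ} (hz : z ∈ disk) :
    1 - ‖a‖ ≤ ‖1 - (starRingEnd ℂ) a * z‖ := by
  refine le_trans ?_ (one_sub_norm_mul_le a z)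
  nlinarith [norm_nonneg a, mem_disk.1 hz]

lemma norm_kernel_pos {a z : ℂ} (ha : a ∈ disk) (hz : z ∈ disk) :
    0 < ‖1 - (starRingEnd ℂ) a * z‖ := (one_sub_pos hz).trans_le (one_sub_le_norm_kernel ha)

/-- From `z - a = -a (1 - āz) + z (1 - |a|²)` and `1 - |a|² ≤ 2 |1 - āz|`. -/
lemma norm_sub_le_kernel {a z : ℂ} (ha : a ∈ disk) (hz : z ∈ disk) :
    ‖z - a‖ ≤ 3 * ‖1 - (starRingEnd ℂ) a * z‖ := by
  have h := (mem_disk.1 ha).le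
  have e : z - a = -(a * (1 - (starRingEnd ℂ) a * z)) + z * ((1 - ‖a‖ ^ 2 : ℝ) : ℂ) := by
    have : (starRingEnd ℂ) a * a = ((‖a‖ ^ 2 : ℝ) : ℂ) := by
      rw [mul_comm, Complex.mul_conj, Complex.normSq_eq_norm_sq]
    push_cast at this ⊢
    rw [← this]; ring
  have h1 := one_sub_le_norm_kernel' (a := a) hz
  have h2 := norm_nonneg a
  have h3 := mem_disk.1 hz
  rw [e]
  refine (norm_add_le _ _).trans ?_
  rw [norm_neg, norm_mul, norm_mul, Complex.norm_real, Real.norm_of_nonneg (by nlinarith)]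
  have h4 : ‖z‖ * (1 - ‖a‖ ^ 2) ≤ 1 * (2 * (1 - ‖a‖)) := by
    refine mul_le_mul h3.le (by nlinarith) (by nlinarith) zero_le_one
  have h5 : ‖a‖ * ‖1 - (starRingEnd ℂ) a * z‖ ≤ 1 * ‖1 - (starRingEnd ℂ) a * z‖ := by gcongr
  linarith

/-- A normalization `w` tending to zero makes the family null on compact sets, where `E` stays
bounded; the energy stays bounded when `w ^ p` compensates the growth `c` of the kernel integral. -/
lemma isTestFamily_mul {p α D N B : ℝ} (hp : 0 < p) {w : ℝ → ℝ} {E : ℂ → ℂ → ℂ}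
    (hw : Tendsto w (𝓝[>] 0) (𝓝 0)) (hw0 : ∀ d, 0 < d → d ≤ 1 → 0 ≤ w d ∧ w d ≤ 1)
    (hE : ∀ a ∈ disk, DifferentiableOn ℂ (E a) disk)
    (hEr : ∀ r : ℝ, r < 1 → ∃ K : ℝ, 0 ≤ K ∧ ∀ a ∈ disk, ∀ z ∈ Metric.closedBall (0 : ℂ) r,
      ‖E a z‖ ≤ K) (hD : 0 ≤ D)
    (hder : ∀ a ∈ disk, ∀ z ∈ disk, ‖deriv (E a) z‖ ≤ D * ‖1 - (starRingEnd ℂ) a * z‖ ^ (-N))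
    {c : ℝ → ℝ} (hc : ∀ a ∈ disk, ∫⁻ z, ENNReal.ofReal
      (‖1 - (starRingEnd ℂ) a * z‖ ^ (-(N * p)) * (1 - ‖z‖ ^ 2) ^ α) ∂dA ≤
        ENNReal.ofReal (c (1 - ‖a‖))) (hB0 : 0 ≤ B)
    (hB : ∀ d, 0 < d → d ≤ 1 → w d ^ p * c d ≤ B) :
    IsTestFamily p α fun a z => (w (1 - ‖a‖) : ℂ) * E a z := by
  have hd : ∀ a ∈ disk, 0 ≤ w (1 - ‖a‖) ∧ w (1 - ‖a‖) ≤ 1 := fun a ha =>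
    hw0 _ (one_sub_pos ha) (by linarith [norm_nonneg a])
  have hn : ∀ a ∈ disk, ‖(w (1 - ‖a‖) : ℂ)‖ = w (1 - ‖a‖) := fun a ha => by
    rw [Complex.norm_real, Real.norm_of_nonneg (hd a ha).1]
  refine ⟨fun a ha => (hE a ha).const_mul _, ?_, fun r hr => ?_⟩
  · obtain ⟨K, hK0, hK⟩ := hEr 0 one_pos
    refine ⟨K ^ p + D ^ p * B, by positivity, fun a ha => ?_⟩
    obtain ⟨hw1, hw2⟩ := hd a ha
    rw [powNorm, ENNReal.ofReal_add (by positivity) (by positivity)]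
    refine add_le_add (ENNReal.ofReal_le_ofReal ?_) ?_
    · refine Real.rpow_le_rpow (norm_nonneg _) ?_ hp.le
      rw [norm_mul, hn a ha]
      have := hK a ha 0 (by simp)
      nlinarith [norm_nonneg (E a 0)]
    · have hle : energy p α (fun z => (w (1 - ‖a‖) : ℂ) * E a z) ≤
          ENNReal.ofReal (w (1 - ‖a‖) ^ p * D ^ p) * ∫⁻ z, ENNReal.ofReal
            (‖1 - (starRingEnd ℂ) a * z‖ ^ (-(N * p)) * (1 - ‖z‖ ^ 2) ^ α) ∂dA := by
        rw [energy, ← lintegral_const_mul' _ _ ENNReal.ofReal_ne_top]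
        refine lintegral_dA_mono fun z hz => ?_
        rw [← ENNReal.ofReal_mul (by positivity), ← mul_assoc]
        refine ENNReal.ofReal_le_ofReal
          (mul_le_mul_of_nonneg_right ?_ (Real.rpow_nonneg (one_sub_sq_pos hz).le _))
        rw [deriv_const_mul _ (differentiableAt_of_mem_disk (hE a ha) hz), norm_mul, hn a ha,
          Real.mul_rpow hw1 (norm_nonneg _), mul_assoc]
        refine mul_le_mul_of_nonneg_left ?_ (by positivity)
        rw [← neg_mul, Real.rpow_mul (norm_nonneg _), ← Real.mul_rpow hD (by positivity)]
        exact Real.rpow_le_rpow (norm_nonneg _) (hder a ha z hz) hp.le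
      refine hle.trans ((mul_le_mul_right (hc a ha) _).trans ?_)
      rw [← ENNReal.ofReal_mul (by positivity)]
      refine ENNReal.ofReal_le_ofReal ?_
      have := hB _ (one_sub_pos ha) (by linarith [norm_nonneg a])
      calc w (1 - ‖a‖) ^ p * D ^ p * c (1 - ‖a‖) = D ^ p * (w (1 - ‖a‖) ^ p * c (1 - ‖a‖)) := by
            ring
        _ ≤ _ := by gcongr
  · obtain ⟨K, hK0, hK⟩ := hEr r hr
    refine ⟨fun d => w d * K, by simpa using hw.mul_const K, fun a ha z hz => ?_⟩
    rw [norm_mul, hn a ha]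
    exact mul_le_mul_of_nonneg_left (hK a ha z hz) (hd a ha).1

/-- The supercritical kernel integral with exponent `N * p` grows like `d ^ (-σ p)`, exactly
cancelled by the normalization. -/
lemma isTestFamily_rpow_mul {p α σ N D : ℝ} (hp : 0 < p) (hα : -1 < α) (hσ : 0 < σ)
    (hN : N * p = α + 2 + σ * p) {E : ℂ → ℂ → ℂ}
    (hE : ∀ a ∈ disk, DifferentiableOn ℂ (E a) disk)
    (hEr : ∀ r : ℝ, r < 1 → ∃ K : ℝ, 0 ≤ K ∧ ∀ a ∈ disk, ∀ z ∈ Metric.closedBall (0 : ℂ) r,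
      ‖E a z‖ ≤ K) (hD : 0 ≤ D)
    (hder : ∀ a ∈ disk, ∀ z ∈ disk, ‖deriv (E a) z‖ ≤ D * ‖1 - (starRingEnd ℂ) a * z‖ ^ (-N)) :
    IsTestFamily p α fun a z => (((1 - ‖a‖) ^ σ : ℝ) : ℂ) * E a z := by
  obtain ⟨C, hC, H⟩ := exists_lintegral_kernel_supercritical (c := N * p) hα
    (by nlinarith [mul_pos hσ hp])
  refine isTestFamily_mul (w := fun d => d ^ σ) (B := C)
    (c := fun d => C * d ^ (α + 2 - N * p)) hp ?_ (fun d hd hd1 => ?_) hE hEr hD hder H hC.le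
    fun d hd hd1 => ?_
  · have := (Real.continuousAt_rpow_const 0 σ (Or.inr hσ.le)).tendsto
    rw [Real.zero_rpow hσ.ne'] at this
    exact this.mono_left nhdsWithin_le_nhds
  · exact ⟨by positivity, Real.rpow_le_one hd.le hd1 hσ.le⟩
  · rw [← Real.rpow_mul hd.le, mul_left_comm, ← Real.rpow_add hd, hN]
    simp

lemma hasDerivAt_kernel (a z : ℂ) :
    HasDerivAt (fun w => 1 - (starRingEnd ℂ) a * w) (-(starRingEnd ℂ) a) z := by
  simpa using ((hasDerivAt_id z).const_mul ((starRingEnd ℂ) a)).const_sub 1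

lemma hasDerivAt_kernel_inv_pow {a z : ℂ} (h : 1 - (starRingEnd ℂ) a * z ≠ 0) (m : ℕ) :
    HasDerivAt (fun w => ((1 - (starRingEnd ℂ) a * w) ^ m)⁻¹)
      (m * (starRingEnd ℂ) a * ((1 - (starRingEnd ℂ) a * z) ^ (m + 1))⁻¹) z := by
  have h1 := ((hasDerivAt_kernel a z).fun_pow m).fun_inv (pow_ne_zero m h)
  refine h1.congr_deriv ?_
  cases m with
  | zero => simp
  | succ m =>
    rw [Nat.add_sub_cancel]
    field_simp
    ring

lemma norm_kernel_inv_pow {a z : ℂ} (m : ℕ) :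
    ‖((1 - (starRingEnd ℂ) a * z) ^ m)⁻¹‖ = ‖1 - (starRingEnd ℂ) a * z‖ ^ (-(m : ℝ)) := by
  rw [norm_inv, norm_pow, Real.rpow_neg (norm_nonneg _), Real.rpow_natCast]

lemma norm_kernel_inv_pow_le {a z : ℂ} {r : ℝ} (hr : r < 1) (ha : a ∈ disk)
    (hz : z ∈ Metric.closedBall (0 : ℂ) r) (m : ℕ) :
    ‖((1 - (starRingEnd ℂ) a * z) ^ m)⁻¹‖ ≤ ((1 - r) ^ m)⁻¹ := by
  rw [norm_inv, norm_pow]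
  have h1 := one_sub_le_norm_kernel (z := z) ha
  have h2 := mem_closedBall_zero_iff.1 hz
  have h3 : 0 < 1 - r := by linarith
  gcongr
  linarith

lemma kernel_ne_zero {a z : ℂ} (ha : a ∈ disk) (hz : z ∈ disk) : 1 - (starRingEnd ℂ) a * z ≠ 0 :=
  norm_pos_iff.1 (norm_kernel_pos ha hz)

lemma isTestFamily_pow {p α s : ℝ} {m : ℕ} (hp : 0 < p) (hα : -1 < α) (hs : s * p = α + 2 - p)
    (hm : s < m) : IsTestFamily p α fun a z =>
      (((1 - ‖a‖) ^ (m - s) : ℝ) : ℂ) * ((1 - (starRingEnd ℂ) a * z) ^ m)⁻¹ := by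
  refine isTestFamily_rpow_mul (N := (m : ℝ) + 1) (D := m) hp hα (by linarith) (by linarith)
    (fun a ha z hz => ?_) (fun r hr => ?_) (by positivity) fun a ha z hz => ?_
  · exact (hasDerivAt_kernel_inv_pow (kernel_ne_zero ha hz) m).differentiableAt
      |>.differentiableWithinAt
  · have h3 : 0 < 1 - r := by linarith
    exact ⟨((1 - r) ^ m)⁻¹, by positivity, fun a ha z hz => norm_kernel_inv_pow_le hr ha hz m⟩
  · rw [(hasDerivAt_kernel_inv_pow (kernel_ne_zero ha hz) m).deriv, norm_mul, norm_kernel_inv_pow,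
      norm_mul, Complex.norm_natCast, Complex.norm_conj]
    push_cast
    refine mul_le_mul_of_nonneg_right ?_ (by positivity)
    exact mul_le_of_le_one_right (by positivity) (mem_disk.1 ha).le

lemma hasDerivAt_sub_mul_kernel {a z : ℂ} (h : 1 - (starRingEnd ℂ) a * z ≠ 0) (m : ℕ) :
    HasDerivAt (fun w => (w - a) * ((1 - (starRingEnd ℂ) a * w) ^ m)⁻¹)
      (((1 - (starRingEnd ℂ) a * z) ^ m)⁻¹ +
        (z - a) * (m * (starRingEnd ℂ) a * ((1 - (starRingEnd ℂ) a * z) ^ (m + 1))⁻¹)) z := by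
  refine (((hasDerivAt_id z).sub_const a).fun_mul (hasDerivAt_kernel_inv_pow h m)).congr_deriv ?_
  rw [one_mul, id]

/-- The factor `z - a` makes each function vanish at its own index, while its size is absorbed by
one power of the kernel; so the derivative is still of order `|1 - āz|^(-m)`. -/
lemma isTestFamily_sub_mul_pow {p α k : ℝ} {m : ℕ} (hp : 0 < p) (hα : -1 < α) (hk : k * p = α + 2)
    (hm : k < m) : IsTestFamily p α fun a z =>
      (((1 - ‖a‖) ^ (m - k) : ℝ) : ℂ) * ((z - a) * ((1 - (starRingEnd ℂ) a * z) ^ m)⁻¹) := by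
  refine isTestFamily_rpow_mul (N := m) (D := 1 + 3 * m) hp hα (by linarith) (by linarith)
    (fun a ha z hz => ?_) (fun r hr => ?_) (by positivity) fun a ha z hz => ?_
  · exact (hasDerivAt_sub_mul_kernel (kernel_ne_zero ha hz) m).differentiableAt
      |>.differentiableWithinAt
  · have h3 : 0 < 1 - r := by linarith
    refine ⟨2 * ((1 - r) ^ m)⁻¹, by positivity, fun a ha z hz => ?_⟩
    rw [norm_mul]
    refine mul_le_mul ?_ (norm_kernel_inv_pow_le hr ha hz m) (norm_nonneg _) zero_le_two
    have h1 := mem_closedBall_zero_iff.1 hz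
    have h2 := mem_disk.1 ha
    linarith [norm_sub_le z a]
  · have hpos := norm_kernel_pos ha hz
    have h1 := norm_sub_le_kernel ha hz
    rw [(hasDerivAt_sub_mul_kernel (kernel_ne_zero ha hz) m).deriv]
    refine (norm_add_le _ _).trans ?_
    rw [norm_mul, norm_mul, norm_kernel_inv_pow, norm_kernel_inv_pow, norm_mul,
      Complex.norm_natCast, Complex.norm_conj]
    have h2 : m * ‖a‖ ≤ m := mul_le_of_le_one_right (by positivity) (mem_disk.1 ha).le
    set x := ‖1 - (starRingEnd ℂ) a * z‖ with hx
    have h3 : x ^ (-((m + 1 : ℕ) : ℝ)) = x ^ (-(m : ℝ)) / x := by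
      push_cast
      rw [neg_add, Real.rpow_add hpos, Real.rpow_neg_one]; rfl
    rw [h3]
    calc x ^ (-(m : ℝ)) + ‖z - a‖ * (m * ‖a‖ * (x ^ (-(m : ℝ)) / x))
        ≤ x ^ (-(m : ℝ)) + (3 * x) * (m * (x ^ (-(m : ℝ)) / x)) := by gcongr
      _ = _ := by field_simp

lemma kernel_mem_slitPlane {a z : ℂ} (ha : a ∈ disk) (hz : z ∈ disk) :
    1 - (starRingEnd ℂ) a * z ∈ Complex.slitPlane := by
  rw [sub_eq_add_neg]
  refine Complex.mem_slitPlane_of_norm_lt_one ?_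
  rw [norm_neg, norm_mul, Complex.norm_conj]
  nlinarith [norm_nonneg z, norm_nonneg a, mem_disk.1 hz, mem_disk.1 ha]

/-- For `p = α + 2` the derivative of the logarithm hits the critical kernel exponent; the
logarithmic growth of that integral dictates the normalization. -/
lemma isTestFamily_log {p α : ℝ} (hα : -1 < α) (hpα : p = α + 2) : IsTestFamily p α fun a z =>
      (((1 + Real.log (1 / (1 - ‖a‖))) ^ (-(1 / p)) : ℝ) : ℂ) *
        Complex.log (1 - (starRingEnd ℂ) a * z) := by
  have hp : 0 < p := by linarith
  obtain ⟨C, hC, H⟩ := exists_lintegral_kernel_critical hα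
  have hlog : ∀ d : ℝ, 0 < d → d ≤ 1 → 1 ≤ 1 + Real.log (1 / d) := fun d hd hd1 => by
    have := Real.log_nonneg ((one_le_div hd).2 hd1)
    linarith
  have hder : ∀ a ∈ disk, ∀ z ∈ disk, HasDerivAt (fun z => Complex.log (1 - (starRingEnd ℂ) a * z))
      (-(starRingEnd ℂ) a / (1 - (starRingEnd ℂ) a * z)) z := fun a ha z hz =>
    (hasDerivAt_kernel a z).clog (kernel_mem_slitPlane ha hz)
  refine isTestFamily_mul (w := fun d => (1 + Real.log (1 / d)) ^ (-(1 / p))) (D := 1) (N := 1)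
    (B := C) (c := fun d => C * (1 + Real.log (1 / d))) hp ?_ (fun d hd hd1 => ?_)
    (fun a ha z hz => (hder a ha z hz).differentiableAt.differentiableWithinAt) (fun r hr => ?_)
    zero_le_one (fun a ha z hz => ?_) ?_ hC.le fun d hd hd1 => ?_
  · refine (tendsto_rpow_neg_atTop (by positivity : 0 < 1 / p)).comp ?_
    refine tendsto_atTop_add_const_left _ _ (Real.tendsto_log_atTop.comp ?_)
    exact tendsto_inv_nhdsGT_zero.congr fun x => (one_div x).symm
  · have := hlog d hd hd1
    refine ⟨by positivity, Real.rpow_le_one_of_one_le_of_nonpos this ?_⟩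
    rw [neg_nonpos]; positivity
  · have h3 : 0 < 1 - r := by linarith
    refine ⟨(1 - r)⁻¹ / 2 + 1, by positivity, fun a ha z hz => ?_⟩
    have hz' := mem_closedBall_zero_iff.1 hz
    have h4 : ‖-((starRingEnd ℂ) a * z)‖ ≤ ‖z‖ := by
      rw [norm_neg, norm_mul, Complex.norm_conj]
      exact mul_le_of_le_one_left (norm_nonneg z) (mem_disk.1 ha).le
    set x := ‖-((starRingEnd ℂ) a * z)‖ with hx
    have hx0 : 0 ≤ x := norm_nonneg _
    rw [sub_eq_add_neg]
    refine (Complex.norm_log_one_add_le (by linarith)).trans ?_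
    rw [← hx]
    have h5 : x ^ 2 * (1 - x)⁻¹ ≤ 1 * (1 - r)⁻¹ := by
      refine mul_le_mul (pow_le_one₀ hx0 (by linarith)) ?_ ?_ zero_le_one
      · exact inv_anti₀ h3 (by linarith)
      · exact inv_nonneg.2 (by linarith)
    linarith
  · rw [(hder a ha z hz).deriv, norm_div, norm_neg, Complex.norm_conj, Real.rpow_neg_one, one_mul,
      ← one_div]
    have := norm_kernel_pos ha hz
    gcongr
    exact (mem_disk.1 ha).le
  · simpa only [one_mul, hpα] using H
  · have := hlog d hd hd1
    rw [← Real.rpow_mul (by linarith), neg_mul, one_div_mul_cancel hp.ne', Real.rpow_neg_one,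
      mul_left_comm, inv_mul_cancel₀ (by linarith), mul_one]

/-! ### Necessity of the conditions -/

/-- The boundary condition on the multiplier is necessary. -/
lemma NullToNull.boundaryLittleO {p q α β : ℝ} (hp : 0 < p) (hq : 0 < q) (hα : -1 < α)
    {g : ℂ → ℂ} (hg : DifferentiableOn ℂ g disk) (hN : NullToNull p α q β g) :
    BoundaryLittleO g ((2 + α) / p - (2 + β) / q) := by
  set k := (2 + α) / p with hk
  have hkp : k * p = α + 2 := by rw [hk]; field_simp; ring
  obtain ⟨m, hm⟩ := exists_nat_gt k
  have hF := isTestFamily_sub_mul_pow hp hα hkp hm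
  obtain ⟨C, hC, H⟩ := exists_norm_deriv_le hq β
  set γ := k - (2 + β) / q with hγ
  rw [boundaryLittleO_iff]
  intro c hc
  -- Chosen to absorb the constants of the derivative bound and of the comparisons between `1 - ‖a‖`
  -- and `1 - ‖a‖ ^ 2`.
  set t := c / (2 ^ m * C * 4 ^ |γ|) with ht
  have ht0 : 0 < t := by positivity
  obtain ⟨δ, hδ, hδF⟩ := hF.eventually_le (Φ := fun h => powNorm q β (mulOp g h))
    (fun h J hd hJ0 hJ hl => hN h hd ⟨J, hJ0, hJ⟩ hl) (ε := ENNReal.ofReal (t ^ q))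
    (by rw [ne_eq, ENNReal.ofReal_eq_zero, not_le]; positivity)
  refine ⟨max (1 / 2) (1 - δ), by positivity, max_lt (by norm_num) (by linarith), fun a ha hra => ?_⟩
  have had : 1 - ‖a‖ < δ := by linarith [(le_max_right _ _).trans_lt hra]
  have hd := one_sub_pos ha
  set d := 1 - ‖a‖ with hd'
  have hE := (energy_le_powNorm _ _ _).trans (hδF a ha had)
  have hFd := hF.differentiableOn a ha
  have h1 := H _ (differentiableOn_mulOp hg hFd) _ (by positivity) hE a ha
  have hne := kernel_ne_zero ha ha
  have hκ : ‖1 - (starRingEnd ℂ) a * a‖ = 1 - ‖a‖ ^ 2 := by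
    rw [mul_comm, Complex.mul_conj, Complex.normSq_eq_norm_sq, ← Complex.ofReal_one,
      ← Complex.ofReal_sub, Complex.norm_real, Real.norm_of_nonneg (one_sub_sq_pos ha).le]
  -- As the test function vanishes at `a`, only `g(a)` times its derivative survives in the product
  -- rule.
  rw [deriv_mulOp hg hFd ha, ((hasDerivAt_sub_mul_kernel hne m).const_mul _).deriv, ← Real.rpow_mul
    ht0.le, mul_one_div_cancel hq.ne', Real.rpow_one, sub_self, zero_mul, zero_mul, mul_zero,
    mul_zero, zero_add, add_zero, norm_mul, norm_mul, norm_kernel_inv_pow, Complex.norm_real,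
    Real.norm_of_nonneg (by positivity), hκ, ← hd'] at h1
  have h2 : (2 * d) ^ (-(m : ℝ)) ≤ (1 - ‖a‖ ^ 2) ^ (-(m : ℝ)) :=
    Real.rpow_le_rpow_of_nonpos (one_sub_sq_pos ha) (one_sub_sq_le ha) (by simp)
  have h3 : d ^ γ ≤ 4 ^ |γ| * (1 - ‖a‖ ^ 2) ^ γ :=
    rpow_le_of_comparable γ hd (one_sub_sq_pos ha) (by linarith [one_sub_le_one_sub_sq ha])
      (by linarith [one_sub_sq_le ha])
  have h4 : ‖g a‖ * (d ^ (m - k) * (2 * d) ^ (-(m : ℝ))) ≤ C * d ^ (-((2 + β) / q)) * t :=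
    le_trans (by gcongr) h1
  have h5 : d ^ (m - k) * (2 * d) ^ (-(m : ℝ)) = (2 ^ m)⁻¹ * d ^ (-k) := by
    rw [Real.mul_rpow zero_le_two hd.le, mul_left_comm, ← Real.rpow_add hd,
      Real.rpow_neg zero_le_two, Real.rpow_natCast]
    congr 2; ring
  have h6 : d ^ γ = d ^ k * d ^ (-((2 + β) / q)) := by
    rw [hγ, sub_eq_add_neg, Real.rpow_add hd]
  have h7 : ‖g a‖ ≤ 2 ^ m * C * t * d ^ γ := by
    rw [h5, Real.rpow_neg hd.le k, ← mul_inv, ← div_eq_mul_inv, div_le_iff₀ (by positivity)] at h4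
    refine h4.trans (le_of_eq ?_)
    rw [h6]; ring
  calc ‖g a‖ ≤ 2 ^ m * C * t * d ^ γ := h7
    _ ≤ 2 ^ m * C * t * (4 ^ |γ| * (1 - ‖a‖ ^ 2) ^ γ) := by gcongr
    _ = _ := by rw [ht]; field_simp

lemma muMeasure_le_weightedIntegral {g φ : ℂ → ℂ} {q β t : ℝ} (hq : 0 < q) (ht : 0 < t)
    (hφ : Measurable φ) {S : Set ℂ} (hS : ∀ z ∈ S, t ≤ ‖φ z‖) :
    muMeasure g q β S ≤ ENNReal.ofReal (t ^ (-q)) *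
      weightedIntegral q β fun z => deriv g z * φ z := by
  have h1 := mul_meas_ge_le_lintegral (μ := muMeasure g q β)
    (f := fun z => ENNReal.ofReal (‖φ z‖ ^ q)) (by fun_prop) (ENNReal.ofReal (t ^ q))
  have h2 : ∫⁻ z, ENNReal.ofReal (‖φ z‖ ^ q) ∂muMeasure g q β =
      weightedIntegral q β fun z => deriv g z * φ z := by
    rw [← setLIntegral_univ, setLIntegral_muMeasure _ _ _ _ MeasurableSet.univ, setLIntegral_univ]
    refine lintegral_congr_ae (ae_dA_mem_disk.mono fun z hz => ?_)
    simp only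
    rw [← ENNReal.ofReal_mul
      (mul_nonneg (Real.rpow_nonneg (one_sub_sq_pos hz).le _) (by positivity)), norm_mul,
      Real.mul_rpow (norm_nonneg _) (norm_nonneg _)]
    ring_nf
  rw [h2] at h1
  calc muMeasure g q β S
      ≤ muMeasure g q β {z | ENNReal.ofReal (t ^ q) ≤ ENNReal.ofReal (‖φ z‖ ^ q)} :=
        measure_mono fun z hz =>
          ENNReal.ofReal_le_ofReal (Real.rpow_le_rpow ht.le (hS z hz) hq.le)
    _ = ENNReal.ofReal (t ^ (-q)) * (ENNReal.ofReal (t ^ q) *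
        muMeasure g q β {z | ENNReal.ofReal (t ^ q) ≤ ENNReal.ofReal (‖φ z‖ ^ q)}) := by
        rw [← mul_assoc, ← ENNReal.ofReal_mul (by positivity), ← Real.rpow_add ht, neg_add_cancel,
          Real.rpow_zero, ENNReal.ofReal_one, one_mul]
    _ ≤ _ := by gcongr

/-- The point of the disk over the starting point of an arc, at the height of its square. -/
def Arc.corner (I : Arc) : ℂ := ((1 - I.length : ℝ) : ℂ) * Complex.exp (I.start * Complex.I)

lemma Arc.norm_corner (I : Arc) : ‖I.corner‖ = 1 - I.length := by
  rw [corner, norm_mul, Complex.norm_exp_ofReal_mul_I, mul_one, Complex.norm_real,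
    Real.norm_of_nonneg (by linarith [I.length_le_one])]

lemma Arc.corner_mem_disk (I : Arc) : I.corner ∈ disk := by
  rw [mem_disk, I.norm_corner]; linarith [I.length_pos]

lemma carlesonSquare_subset_disk (I : Arc) : carlesonSquare I ⊆ disk := by
  rintro z ⟨r, ζ, ⟨θ, -, rfl⟩, hr, hr1, rfl⟩
  rw [mem_disk, norm_mul, Complex.norm_exp_ofReal_mul_I, mul_one, Complex.norm_real,
    Real.norm_of_nonneg (by linarith [I.length_le_one])]
  exact hr1

/-- The radial defect is at most `2 |I|` and the angular one at most `2π |I|`; together they stay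
below `9 |I|`. -/
lemma norm_kernel_corner_le {I : Arc} {z : ℂ} (hz : z ∈ carlesonSquare I) :
    ‖1 - (starRingEnd ℂ) I.corner * z‖ ≤ 9 * I.length := by
  obtain ⟨r, ζ, ⟨θ, ⟨hθ1, hθ2⟩, rfl⟩, hr, hr1, rfl⟩ := hz
  have hl0 := I.length_pos
  have hl1 := I.length_le_one
  set ℓ := I.length with hl
  have e : 1 - (starRingEnd ℂ) I.corner * (r * Complex.exp (θ * Complex.I)) =
      ((1 - (1 - ℓ) * r : ℝ) : ℂ) -
        (((1 - ℓ) * r : ℝ) : ℂ) * (Complex.exp (Complex.I * ((θ - I.start : ℝ) : ℂ)) - 1) := by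
    have h1 : Complex.exp (Complex.I * ((θ - I.start : ℝ) : ℂ)) =
        Complex.exp (-(I.start * Complex.I)) * Complex.exp (θ * Complex.I) := by
      rw [← Complex.exp_add]; congr 1; push_cast; ring
    rw [Arc.corner, map_mul, Complex.conj_ofReal, ← Complex.exp_conj, map_mul, Complex.conj_ofReal,
      Complex.conj_I, mul_neg, h1, ← hl]
    push_cast
    ring
  have hr0 : 0 ≤ r := by linarith
  have h2 : (1 - ℓ) * r ≤ 1 := by nlinarith
  have h3 : 0 ≤ (1 - ℓ) * r := mul_nonneg (by linarith) hr0
  have h4 := Real.norm_exp_I_mul_ofReal_sub_one_le (x := θ - I.start)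
  rw [Real.norm_of_nonneg (by linarith)] at h4
  rw [e]
  refine (norm_sub_le _ _).trans ?_
  rw [norm_mul, Complex.norm_real, Complex.norm_real, Real.norm_of_nonneg (by linarith),
    Real.norm_of_nonneg h3]
  have h5 : (1 - ℓ) * r * ‖Complex.exp (Complex.I * ((θ - I.start : ℝ) : ℂ)) - 1‖ ≤
      1 * (2 * Real.pi * ℓ) := mul_le_mul h2 (h4.trans (by linarith)) (norm_nonneg _) zero_le_one
  nlinarith [Real.pi_lt_d2]

/-- The Carleson condition follows from a test family that is large on the squares. -/
lemma squaresLittleO_of_testFamily {p q α β : ℝ} (hp : 0 < p) (hpq : p < q) (hα : -1 < α)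
    {g : ℂ → ℂ} (hg : DifferentiableOn ℂ g disk) (hN : NullToNull p α q β g) {F : ℂ → ℂ → ℂ}
    (hF : IsTestFamily p α F) (hFm : ∀ a, Measurable (F a)) {ψ : ℝ → ℝ} {c δ₀ : ℝ} (hc : 0 < c)
    (hδ₀ : 0 < δ₀) (hψ : ∀ I : Arc, I.length < δ₀ → 0 < ψ I.length)
    (hlow : ∀ I : Arc, I.length < δ₀ → ∀ z ∈ carlesonSquare I,
      c * ψ I.length ^ (-(1 / q)) ≤ ‖F I.corner z‖) :
    SquaresLittleO (muMeasure g q β) ψ := by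
  have hq : 0 < q := hp.trans hpq
  have hgo := hN.boundaryLittleO hp hq hα hg
  intro ε hε
  obtain ⟨δ, hδ, hδF⟩ := hF.eventually_le
    (Φ := fun h => weightedIntegral q β fun z => deriv g z * h z)
    (fun h J hd hJ0 hJ hl => tendsto_weightedIntegral_of_nullToNull hp hpq (by linarith) hg hN hgo
      hd hJ0 hJ hl) (ε := ENNReal.ofReal (ε * c ^ q))
    (by rw [ne_eq, ENNReal.ofReal_eq_zero, not_le]; positivity)
  refine ⟨min δ δ₀, lt_min hδ hδ₀, fun I hI => ?_⟩
  have hI1 := hI.trans_le (min_le_left _ _)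
  have hI2 := hI.trans_le (min_le_right _ _)
  have hψI := hψ I hI2
  refine (muMeasure_le_weightedIntegral hq (t := c * ψ I.length ^ (-(1 / q))) (by positivity)
    (hFm I.corner) (hlow I hI2)).trans ?_
  refine (mul_le_mul_right (hδF I.corner I.corner_mem_disk (by rw [I.norm_corner]; linarith))
    _).trans ?_
  rw [← ENNReal.ofReal_mul (by positivity)]
  refine ENNReal.ofReal_le_ofReal (le_of_eq ?_)
  rw [Real.mul_rpow hc.le (by positivity), ← Real.rpow_mul hψI.le, neg_mul_neg,
    one_div_mul_cancel hq.ne', Real.rpow_one, Real.rpow_neg hc.le]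
  field_simp

/-- On the square over `I` the normalized kernel power indexed by the corner is at least a constant
times `|I|^(-s)`. -/
lemma NullToNull.vanishingCarleson {p q α β : ℝ} (hp : 0 < p) (hpq : p < q) (hα : -1 < α)
    {g : ℂ → ℂ} (hg : DifferentiableOn ℂ g disk) (hN : NullToNull p α q β g) :
    IsVanishingCarleson (q * (α + 2 - p) / p) (muMeasure g q β) := by
  have hq : 0 < q := hp.trans hpq
  set s := (α + 2 - p) / p with hs
  obtain ⟨m, hm⟩ := exists_nat_gt s
  have hF := isTestFamily_pow (m := m) hp hα (div_mul_cancel₀ (α + 2 - p) hp.ne') hm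
  refine squaresLittleO_of_testFamily hp hpq hα hg hN hF (fun a => by fun_prop)
    (c := 9 ^ (-(m : ℝ))) (δ₀ := 1) (by positivity) one_pos
    (fun I _ => Real.rpow_pos_of_pos I.length_pos _) fun I _ z hz => ?_
  have hl := I.length_pos
  have hzd := carlesonSquare_subset_disk I hz
  rw [norm_mul, norm_kernel_inv_pow, I.norm_corner, sub_sub_cancel, Complex.norm_real,
    Real.norm_of_nonneg (by positivity), ← Real.rpow_mul hl.le]
  have h1 : (9 * I.length) ^ (-(m : ℝ)) ≤ ‖1 - (starRingEnd ℂ) I.corner * z‖ ^ (-(m : ℝ)) :=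
    Real.rpow_le_rpow_of_nonpos (norm_kernel_pos I.corner_mem_disk hzd)
      (norm_kernel_corner_le hz) (by simp)
  refine le_trans (le_of_eq ?_) (mul_le_mul_of_nonneg_left h1 (by positivity))
  rw [Real.mul_rpow (by norm_num) hl.le, mul_left_comm, ← Real.rpow_add hl, ← hs]
  congr 2
  rw [hs]; field_simp; ring

/-- On the square over `I` the modulus of the logarithm is at least half of `L = log (1/|I|)`, so
the normalized test function is at least of order `L ^ (1 - 1/p)`. -/
lemma NullToNull.squaresLittleO_log {p q α β : ℝ} (hpq : p < q) (hα : -1 < α) (hpα : p = α + 2)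
    {g : ℂ → ℂ} (hg : DifferentiableOn ℂ g disk) (hN : NullToNull p α q β g) :
    SquaresLittleO (muMeasure g q β) (fun t => Real.log (1 / t) ^ ((1 / p - 1) * q)) := by
  have hp : 0 < p := by linarith
  have hq : 0 < q := hp.trans hpq
  -- Below `1 / 81` one has `(9 |I|)² ≤ |I|`, which lets the constant `9` be absorbed into half of
  -- the logarithm.
  have hlog : ∀ I : Arc, I.length < 1 / 81 → 1 ≤ Real.log (1 / I.length) := fun I hI => by
    have hl := I.length_pos
    rw [Real.le_log_iff_exp_le (by positivity), le_div_iff₀ hl]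
    nlinarith [Real.exp_one_lt_three]
  refine squaresLittleO_of_testFamily hp hpq hα hg hN (isTestFamily_log hα hpα)
    (fun a => by fun_prop) (c := 2 ^ (-(1 / p)) / 2) (δ₀ := 1 / 81) (by positivity) (by norm_num)
    (fun I hI => Real.rpow_pos_of_pos (by linarith [hlog I hI]) _) fun I hI z hz => ?_
  have hl := I.length_pos
  have hL := hlog I hI
  have hzd := carlesonSquare_subset_disk I hz
  have hpos := norm_kernel_pos I.corner_mem_disk hzd
  rw [norm_mul, I.norm_corner, sub_sub_cancel, Complex.norm_real]
  set L := Real.log (1 / I.length) with hLd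
  rw [Real.norm_of_nonneg (by positivity), ← Real.rpow_mul (by linarith)]
  have h1 : L / 2 ≤ ‖Complex.log (1 - (starRingEnd ℂ) I.corner * z)‖ := by
    have h2 := Complex.abs_re_le_norm (Complex.log (1 - (starRingEnd ℂ) I.corner * z))
    rw [Complex.log_re] at h2
    have h3 : Real.log ‖1 - (starRingEnd ℂ) I.corner * z‖ ≤ Real.log (9 * I.length) :=
      Real.log_le_log hpos (norm_kernel_corner_le hz)
    have h4 : Real.log ((9 * I.length) ^ 2) ≤ Real.log I.length :=
      Real.log_le_log (by positivity) (by nlinarith)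
    rw [Real.log_pow] at h4
    push_cast at h4
    have h5 : L = -Real.log I.length := by rw [hLd, one_div, Real.log_inv]
    linarith [neg_abs_le (Real.log ‖1 - (starRingEnd ℂ) I.corner * z‖)]
  have h2 : (2 * L) ^ (-(1 / p)) ≤ (1 + L) ^ (-(1 / p)) :=
    Real.rpow_le_rpow_of_nonpos (by linarith) (by linarith) (by rw [neg_nonpos]; positivity)
  refine le_trans (le_of_eq ?_) (mul_le_mul h2 h1 (by positivity) (by positivity))
  have h3 : (1 / p - 1) * q * -(1 / q) = -(1 / p) + 1 := by field_simp; ring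
  rw [h3, Real.rpow_add (by linarith), Real.rpow_one, Real.mul_rpow zero_le_two (by linarith)]
  ring

/-- `g` is the image of the constant function `1`. -/
lemma NullToNull.memDirichlet_self {p q α β : ℝ} (hp : 0 < p) (hq : 0 < q) (hα : -1 < α)
    {g : ℂ → ℂ} (hg : DifferentiableOn ℂ g disk) (hN : NullToNull p α q β g) :
    MemDirichlet q β g := by
  have h1 : MemDirichlet p α (fun _ => 1) := by
    refine ⟨differentiableOn_const _, (dirichletNorm_lt_top_iff hp).2 ?_⟩
    simp [powNorm, energy, Real.zero_rpow hp.ne']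
  have h2 := hN.memDirichlet hp hq (by linarith) hg h1
  rwa [show mulOp g (fun _ => 1) = g from funext fun z => mul_one _] at h2

end

end WeightedDirichlet

theorem mainTheorem6 (p q α β : ℝ) (hα : -1 < α) (hβ : -1 < β) (hp : 0 < p) (hpq : p < q)
    (g : ℂ → ℂ) (hg : DifferentiableOn ℂ g WeightedDirichlet.disk) :
    (p < α + 2 →
      (WeightedDirichlet.IsCompactBetween p α q β (WeightedDirichlet.mulOp g) ↔
        WeightedDirichlet.IsVanishingCarleson (q * (α + 2 - p) / p)
            (WeightedDirichlet.muMeasure g q β) ∧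
          WeightedDirichlet.BoundaryLittleO g ((2 + α) / p - (2 + β) / q))) ∧
    (p = α + 2 →
      (WeightedDirichlet.IsCompactBetween p α q β (WeightedDirichlet.mulOp g) ↔
        WeightedDirichlet.BoundaryLittleO g ((2 + α) / p - (2 + β) / q) ∧
          WeightedDirichlet.SquaresLittleO (WeightedDirichlet.muMeasure g q β)
            (fun t => Real.log (1 / t) ^ ((1 / p - 1) * q)))) ∧
    (α + 2 < p →
      (WeightedDirichlet.IsCompactBetween p α q β (WeightedDirichlet.mulOp g) ↔
        WeightedDirichlet.BoundaryLittleO g ((2 + α) / p - (2 + β) / q) ∧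
          WeightedDirichlet.MemDirichlet q β g)) := by
  have hq : 0 < q := hp.trans hpq
  rw [WeightedDirichlet.isCompactBetween_iff_nullToNull hp hq (by linarith) (by linarith) hg]
  refine ⟨fun h => ⟨fun hN => ⟨hN.vanishingCarleson hp hpq hα hg, hN.boundaryLittleO hp hq hα hg⟩,
      fun H => WeightedDirichlet.nullToNull_of_vanishingCarleson hp hpq hα h hg H.2 H.1⟩,
    fun h => ⟨fun hN => ⟨hN.boundaryLittleO hp hq hα hg, hN.squaresLittleO_log hpq hα h hg⟩,
      fun H => WeightedDirichlet.nullToNull_of_log hpq hα h hg H.1 H.2⟩,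
    fun h => ⟨fun hN => ⟨hN.boundaryLittleO hp hq hα hg, hN.memDirichlet_self hp hq hα hg⟩,
      fun H => WeightedDirichlet.nullToNull_of_memDirichlet hpq hα h H.1 H.2⟩⟩
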